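/- Let $d\ge 1$, let $\Omega\subset\mathbb R^d$ be a bounded polytopal domain (open, connected, equal to the interior of its closure), $\gamma\subset\partial\Omega$ closed and possibly empty, and $s\in[0,1]$. Put $\mathscr V:=[L_2(\Omega),H^1_{0,\gamma}(\Omega)]_{s,2}$ (real interpolation; $L_2(\Omega)$ for $s=0$ and $H^1_{0,\gamma}(\Omega)$ for $s=1$), where $H^1_{0,\gamma}(\Omega)$ is the closure in $H^1(\Omega)$ of the functions that vanish in a neighbourhood of $\gamma$, and put $\mathscr W:=\mathscr V'$, so that $\mathscr V\hookrightarrow L_2(\Omega)\simeq L_2(\Omega)'\hookrightarrow\mathscr W$. Let $\mathbb T$ be a family of conforming partitions $\mathcal T$ of $\overline\Omega$ into finitely many closed $d$-simplices, such that $\gamma$ is for each $\mathcal T$ a (possibly empty) union of $(d-1)$-faces of simplices of $\mathcal T$. Assume that any two simplices of $\mathcal T$ with a common vertex $\nu$ are connected by a chain of simplices of $\mathcal T$ with vertex $\nu$, of which consecutive ones share a $(d-1)$-face (this is automatic if $\Omega$ is a Lipschitz domain). Let $\mathbb T$ be uniformly shape regular, i.e. $\sup_{\mathcal T\in\mathbb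 T}\max_{T\in\mathcal T}\operatorname{diam}(T)/h_T<\infty$ with $h_T:=|T|^{1/d}$; if $d=1$, assume also that $h_T/h_{T'}$ is bounded uniformly over all $\mathcal T\in\mathbb T$ and all $T,T'\in\mathcal T$ with $T\cap T'\ne\emptyset$. Let $N^0_{\mathcal T}$ be the set of vertices of $\mathcal T$ that are not on $\gamma$, let $\omega_\nu$ be the union of the $T\in\mathcal T$ with vertex $\nu$, let $\mathscr V_{\mathcal T}:=\{u\in H^1_{0,\gamma}(\Omega):u|_T\in\mathcal P_1\ (T\in\mathcal T)\}$, equipped with the norm of $\mathscr V$, and let $\Phi_{\mathcal T}=\{\phi_\nu:\nu\in N^0_{\mathcal T}\}$ be the nodal (hat) functions. Let $\Psi_{\mathcal T}=\{\psi_\nu:\nu\in N^0_{\mathcal T}\}\subset L_2(\Omega)$ be collections such that $\langle\phi_\nu,\psi_{\nu'}\rangle_{L_2(\Omega)}=0$ for $\nu\neq\nu'$, $\langle\phi_\nu,\psi_\nu\rangle_{L_2(\Omega)}\ne0$, $|\langle\phi_\nu,\psi_\nu\rangle_{L_2(\Omega)}|\ge c\,\|\phi_\nu\|_{L_2(\Omega)}\|\psi_\nu\|_{L_2(\Omega)}$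 with a constant $c>0$ that is independent of $\nu$ and $\mathcal T$, and $\operatorname{supp}\psi_\nu\subseteq\omega_\nu$. Let $\mathscr W_{\mathcal T}:=\operatorname{span}\Psi_{\mathcal T}\subset\mathscr W$, equipped with the norm of $\mathscr W$, and define $D_{\mathcal T}:\mathscr V_{\mathcal T}\to\mathscr W_{\mathcal T}'$ by $(D_{\mathcal T}v)(w):=\langle v,w\rangle_{L_2(\Omega)}$. For normed spaces $Y$, $Z$, $\mathcal L\mathrm{is}(Y,Z)$ is the set of boundedly invertible $C\in\mathcal L(Y,Z)$, and a family $C_i\in\mathcal L\mathrm{is}(Y_i,Z_i)$ is uniform if $\sup_i\max(\|C_i\|,\|C_i^{-1}\|)<\infty$. For reflexive $Y$, $\mathcal L\mathrm{is}_c(Y,Y')$ is the set of those $C\in\mathcal L\mathrm{is}(Y,Y')$ for which $(Cy)(y)\ge c\|y\|_Y^2$ for all $y \in Y$, with some $c>0$; a family $C_i\in\mathcal L\mathrm{is}_c(Y_i,Y_i')$ is uniform if $\sup_i\max(\|C_i\|,\|\Re(C_i)^{-1}\|)<\infty$, where $\Re(C):=\frac12(C+C')$. The same applies to $\mathcal L\mathrm{is}_c(Y',Y)$,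 with $Y$ identified with $Y''$. Then, for every $\mathcal T\in\mathbb T$, $D_{\mathcal T}$ and its adjoint $D_{\mathcal T}':\mathscr W_{\mathcal T}\to\mathscr V_{\mathcal T}'$ are invertible, $\Phi_{\mathcal T}$ and $\Psi_{\mathcal T}$ are bases of $\mathscr V_{\mathcal T}$ and $\mathscr W_{\mathcal T}$, and the matrix $[(D_{\mathcal T}\phi_{\nu'})(\psi_{\nu})]_{\nu,\nu'}$ of $D_{\mathcal T}$ with respect to them is diagonal. Moreover, if $B_{\mathcal T}\in\mathcal L\mathrm{is}_c(\mathscr W_{\mathcal T},\mathscr W_{\mathcal T}')$ uniformly in $\mathcal T\in\mathbb T$, then $G_{\mathcal T}:=D_{\mathcal T}^{-1}B_{\mathcal T}(D_{\mathcal T}')^{-1}\in\mathcal L\mathrm{is}_c(\mathscr V_{\mathcal T}',\mathscr V_{\mathcal T})$ uniformly in $\mathcal T\in\mathbb T$; and it is a uniform preconditioner: for all $A_{\mathcal T}\in\mathcal L\mathrm{is}_c(\mathscr V_{\mathcal T},\mathscr V_{\mathcal T}')$ uniformly in $\mathcal T\in\mathbb T$, also $G_{\mathcal T}A_{\mathcal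 T}\in\mathcal L\mathrm{is}(\mathscr V_{\mathcal T},\mathscr V_{\mathcal T})$ uniformly in $\mathcal T\in\mathbb T$. -/

import Mathlib

open MeasureTheory Set Filter Topology
open scoped ENNReal ContDiff RealInnerProductSpace

noncomputable section

namespace OpPrec

/-! ### Function spaces on a domain `Ω ⊆ ℝᵈ` -/

/-- Euclidean space `ℝᵈ`. -/
abbrev E (d : ℕ) : Type := EuclideanSpace ℝ (Fin d)

/-- The measure with respect to which all functions on `Ω` are considered. -/
abbrev mu {d : ℕ} (Ω : Set (E d)) : Measure (E d) := volume.restrict Ω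

/-- `L₂(Ω)`. -/
abbrev L2 {d : ℕ} (Ω : Set (E d)) : Type := Lp ℝ 2 (mu Ω)

/-- `L₂(Ω)ᵈ`. -/
abbrev L2vec {d : ℕ} (Ω : Set (E d)) : Type := Lp (E d) 2 (mu Ω)

/-- Pairs of a function and a vector field in `L₂(Ω)`, normed by `(‖u‖² + ‖g‖²)^(1/2)`. -/
abbrev L2pair {d : ℕ} (Ω : Set (E d)) : Type := WithLp 2 (L2 Ω × L2vec Ω)

/-- `g` is the weak gradient of `u` on `Ω`. -/
def HasWeakGrad {d : ℕ} (Ω : Set (E d)) (u : L2 Ω) (g : L2vec Ω) : Prop :=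
  ∀ φ : E d → ℝ, ContDiff ℝ ∞ φ → HasCompactSupport φ → tsupport φ ⊆ Ω → ∀ v : E d,
    ∫ x in Ω, u x * fderiv ℝ φ x v = - ∫ x in Ω, ⟪g x, v⟫ * φ x

theorem integrable_mul_test {d : ℕ} (Ω : Set (E d)) (u : L2 Ω) (f : E d → ℝ)
    (hf : Continuous f) (hc : HasCompactSupport f) :
    Integrable (fun x => u x * f x) (mu Ω) :=
  MemLp.integrable_mul (p := 2) (q := 2) (Lp.memLp u) (hf.memLp_of_hasCompactSupport hc)

theorem integrable_inner_test {d : ℕ} (Ω : Set (E d)) (g : L2vec Ω) (v : E d) (f : E d → ℝ)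
    (hf : Continuous f) (hc : HasCompactSupport f) :
    Integrable (fun x => ⟪g x, v⟫ * f x) (mu Ω) :=
  MemLp.integrable_mul (p := 2) (q := 2) ((Lp.memLp g).inner_const v) (hf.memLp_of_hasCompactSupport hc)

theorem continuous_fderiv_test {d : ℕ} {φ : E d → ℝ} (h : ContDiff ℝ ∞ φ) (v : E d) :
    Continuous fun x => fderiv ℝ φ x v :=
  (h.continuous_fderiv (by simp)).clm_apply continuous_const

theorem hasCompactSupport_fderiv_test {d : ℕ} {φ : E d → ℝ} (h : HasCompactSupport φ) (v : E d) :
    HasCompactSupport fun x => fderiv ℝ φ x v :=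
  h.fderiv_apply (𝕜 := ℝ) v

theorem HasWeakGrad.add {d : ℕ} {Ω : Set (E d)} {u₁ u₂ : L2 Ω} {g₁ g₂ : L2vec Ω}
    (h₁ : HasWeakGrad Ω u₁ g₁) (h₂ : HasWeakGrad Ω u₂ g₂) :
    HasWeakGrad Ω (u₁ + u₂) (g₁ + g₂) := by
  intro φ hφ hc hs v
  have e1 : ∫ x in Ω, (u₁ + u₂) x * fderiv ℝ φ x v
      = ∫ x in Ω, (u₁ x * fderiv ℝ φ x v + u₂ x * fderiv ℝ φ x v) := by
    refine integral_congr_ae ?_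
    filter_upwards [Lp.coeFn_add u₁ u₂] with x hx
    rw [hx, Pi.add_apply, add_mul]
  have e2 : ∫ x in Ω, ⟪(g₁ + g₂) x, v⟫ * φ x
      = ∫ x in Ω, (⟪g₁ x, v⟫ * φ x + ⟪g₂ x, v⟫ * φ x) := by
    refine integral_congr_ae ?_
    filter_upwards [Lp.coeFn_add g₁ g₂] with x hx
    rw [hx, Pi.add_apply, inner_add_left, add_mul]
  rw [e1, e2, integral_add (integrable_mul_test Ω _ _ (continuous_fderiv_test hφ v)
      (hasCompactSupport_fderiv_test hc v)) (integrable_mul_test Ω _ _ (continuous_fderiv_test hφ v)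
      (hasCompactSupport_fderiv_test hc v)),
    integral_add (integrable_inner_test Ω _ v _ hφ.continuous hc)
      (integrable_inner_test Ω _ v _ hφ.continuous hc), h₁ φ hφ hc hs v, h₂ φ hφ hc hs v]
  ring

theorem HasWeakGrad.smul {d : ℕ} {Ω : Set (E d)} {u : L2 Ω} {g : L2vec Ω} (c : ℝ)
    (h : HasWeakGrad Ω u g) : HasWeakGrad Ω (c • u) (c • g) := by
  intro φ hφ hc hs v
  have e1 : ∫ x in Ω, (c • u) x * fderiv ℝ φ x v = ∫ x in Ω, c * (u x * fderiv ℝ φ x v) := by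
    refine integral_congr_ae ?_
    filter_upwards [Lp.coeFn_smul c u] with x hx
    rw [hx, Pi.smul_apply, smul_eq_mul, mul_assoc]
  have e2 : ∫ x in Ω, ⟪(c • g) x, v⟫ * φ x = ∫ x in Ω, c * (⟪g x, v⟫ * φ x) := by
    refine integral_congr_ae ?_
    filter_upwards [Lp.coeFn_smul c g] with x hx
    rw [hx, Pi.smul_apply, real_inner_smul_left, mul_assoc]
  rw [e1, e2, integral_const_mul, integral_const_mul, h φ hφ hc hs v]
  ring

theorem HasWeakGrad.zero {d : ℕ} (Ω : Set (E d)) : HasWeakGrad Ω 0 0 := by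
  intro φ _ _ _ v
  have e1 : ∫ x in Ω, (0 : L2 Ω) x * fderiv ℝ φ x v = 0 := by
    rw [← integral_zero (E d) ℝ (μ := mu Ω)]
    refine integral_congr_ae ?_
    filter_upwards [Lp.coeFn_zero ℝ 2 (mu Ω)] with x hx
    rw [hx]; simp
  have e2 : ∫ x in Ω, ⟪(0 : L2vec Ω) x, v⟫ * φ x = 0 := by
    rw [← integral_zero (E d) ℝ (μ := mu Ω)]
    refine integral_congr_ae ?_
    filter_upwards [Lp.coeFn_zero (E d) 2 (mu Ω)] with x hx
    rw [hx]; simp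
  rw [e1, e2, neg_zero]

/-- `H¹(Ω)`, as the space of the pairs `(u, ∇u)`; the norm inherited from `L2pair Ω` is the
`H¹(Ω)`-norm `(‖u‖² + ‖∇u‖²)^(1/2)`. -/
def H1 {d : ℕ} (Ω : Set (E d)) : Submodule ℝ (L2pair Ω) where
  carrier := {z | HasWeakGrad Ω z.fst z.snd}
  add_mem' h₁ h₂ := h₁.add h₂
  zero_mem' := HasWeakGrad.zero Ω
  smul_mem' c _ h := h.smul c

/-- The elements of `H¹(Ω)` that vanish in a neighbourhood of `γ`. -/
def H1near {d : ℕ} (Ω γ : Set (E d)) : Submodule ℝ (L2pair Ω) where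
  carrier := {z | z ∈ H1 Ω ∧ ∃ U : Set (E d), IsOpen U ∧ γ ⊆ U ∧
    ∀ᵐ x ∂(mu Ω), x ∈ U → z.fst x = 0}
  add_mem' := by
    rintro z₁ z₂ ⟨h₁, U₁, o₁, g₁, a₁⟩ ⟨h₂, U₂, o₂, g₂, a₂⟩
    refine ⟨add_mem h₁ h₂, U₁ ∩ U₂, o₁.inter o₂, subset_inter g₁ g₂, ?_⟩
    filter_upwards [a₁, a₂, Lp.coeFn_add z₁.fst z₂.fst] with x b₁ b₂ hx hU
    rw [WithLp.add_fst, hx, Pi.add_apply, b₁ hU.1, b₂ hU.2, add_zero]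
  zero_mem' := by
    refine ⟨zero_mem _, univ, isOpen_univ, subset_univ _, ?_⟩
    filter_upwards [Lp.coeFn_zero ℝ 2 (mu Ω)] with x hx _
    rw [WithLp.zero_fst, hx]; rfl
  smul_mem' := by
    rintro c z ⟨h, U, o, g, a⟩
    refine ⟨Submodule.smul_mem _ c h, U, o, g, ?_⟩
    filter_upwards [a, Lp.coeFn_smul c z.fst] with x b hx hU
    rw [WithLp.smul_fst, hx, Pi.smul_apply, b hU, smul_zero]

/-- `H¹_{0,γ}(Ω)`: the closure in `H¹(Ω)` of the functions that vanish in a neighbourhood of `γ`,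
with the `H¹(Ω)`-norm (so `H¹(Ω)` for empty `γ`, and `H¹₀(Ω)` for `γ = ∂Ω`). -/
def H10 {d : ℕ} (Ω γ : Set (E d)) : Submodule ℝ (L2pair Ω) :=
  (H1near Ω γ).topologicalClosure

/-! ### The interpolation space `𝒱 = [L₂(Ω), H¹_{0,γ}(Ω)]_{s,2}` -/

/-- Peetre's `K`-functional of the couple `(L₂(Ω), H¹_{0,γ}(Ω))`. -/
def K {d : ℕ} (Ω γ : Set (E d)) (t : ℝ) (u : L2 Ω) : ℝ≥0∞ :=
  ⨅ y : H10 Ω γ, (‖u - (y : L2pair Ω).fst‖ₑ + ENNReal.ofReal t * ‖y‖ₑ)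

/-- The measure `dt / t` on `(0, ∞)`. -/
def logMeasure : Measure ℝ :=
  (volume.restrict (Ioi 0)).withDensity fun t => ENNReal.ofReal t⁻¹

open Classical in
/-- The norm of `[L₂(Ω), H¹_{0,γ}(Ω)]_{s,2}`, with value `∞` outside that space:
`(∫₀^∞ (t^{-s} K(t,u))² dt/t)^{1/2}` for `0 < s < 1`; for `s = 0` and `s = 1`, by the usual
convention, the norms of `L₂(Ω)` and `H¹_{0,γ}(Ω)` themselves (the infimum for `s = 1` is over at
most one element, since weak gradients are unique, and is `∞` if there is none). -/
def interpNorm {d : ℕ} (Ω γ : Set (E d)) (s : ℝ) (u : L2 Ω) : ℝ≥0∞ :=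
  if s = 0 then ‖u‖ₑ
  else if s = 1 then ⨅ (y : H10 Ω γ) (_ : (y : L2pair Ω).fst = u), ‖y‖ₑ
  else (∫⁻ t, (ENNReal.ofReal (t ^ (-s)) * K Ω γ t u) ^ (2 : ℝ) ∂logMeasure) ^ (1 / (2 : ℝ))

theorem K_add {d : ℕ} (Ω γ : Set (E d)) (t : ℝ) (u v : L2 Ω) :
    K Ω γ t (u + v) ≤ K Ω γ t u + K Ω γ t v := by
  unfold K
  refine ENNReal.le_iInf_add_iInf fun y z => (iInf_le _ (y + z)).trans ?_
  have h1 : ‖u + v - ((y + z : H10 Ω γ) : L2pair Ω).fst‖ₑ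
      ≤ ‖u - (y : L2pair Ω).fst‖ₑ + ‖v - (z : L2pair Ω).fst‖ₑ := by
    have : u + v - ((y + z : H10 Ω γ) : L2pair Ω).fst
        = (u - (y : L2pair Ω).fst) + (v - (z : L2pair Ω).fst) := by
      rw [Submodule.coe_add, WithLp.add_fst]; abel
    rw [this]; exact enorm_add_le _ _
  have h2 : ENNReal.ofReal t * ‖y + z‖ₑ ≤ ENNReal.ofReal t * (‖y‖ₑ + ‖z‖ₑ) := by
    gcongr; exact enorm_add_le _ _
  calc _ ≤ _ := add_le_add h1 h2
    _ = _ := by ring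

theorem K_smul {d : ℕ} (Ω γ : Set (E d)) (t : ℝ) (c : ℝ) (u : L2 Ω) :
    K Ω γ t (c • u) ≤ ‖c‖ₑ * K Ω γ t u := by
  by_cases hc : c = 0
  · subst hc
    refine (iInf_le _ (0 : H10 Ω γ)).trans ?_
    rw [enorm_zero (E := H10 Ω γ)]
    simp
  · unfold K
    rw [ENNReal.mul_iInf_of_ne (by simpa using hc) enorm_ne_top]
    refine le_iInf fun y => (iInf_le _ (c • y)).trans ?_
    have : c • u - ((c • y : H10 Ω γ) : L2pair Ω).fst = c • (u - (y : L2pair Ω).fst) := by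
      rw [Submodule.coe_smul, WithLp.smul_fst, smul_sub]
    rw [this, enorm_smul, enorm_smul, mul_add]
    exact le_of_eq (by ring)

theorem K_mono {d : ℕ} (Ω γ : Set (E d)) (u : L2 Ω) : Monotone fun t => K Ω γ t u := by
  intro t t' h
  refine iInf_mono fun y => ?_
  gcongr

theorem enorm_fst_le {d : ℕ} {Ω γ : Set (E d)} (y : H10 Ω γ) :
    ‖(y : L2pair Ω).fst‖ₑ ≤ ‖y‖ₑ :=
  WithLp.enorm_fst_le (L2 Ω) (y : L2pair Ω)

theorem le_K {d : ℕ} (Ω γ : Set (E d)) (u : L2 Ω) {t : ℝ} (ht : 1 ≤ t) : ‖u‖ₑ ≤ K Ω γ t u := by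
  refine le_iInf fun y => ?_
  have h1 : ‖u‖ₑ ≤ ‖u - (y : L2pair Ω).fst‖ₑ + ‖(y : L2pair Ω).fst‖ₑ := by
    simpa using enorm_add_le (u - (y : L2pair Ω).fst) (y : L2pair Ω).fst
  refine h1.trans ?_
  gcongr
  calc _ ≤ ‖y‖ₑ := enorm_fst_le y
    _ = 1 * ‖y‖ₑ := (one_mul _).symm
    _ ≤ _ := by gcongr; simpa using ht

theorem aemeasurable_K {d : ℕ} (Ω γ : Set (E d)) (s : ℝ) (u : L2 Ω) :
    AEMeasurable (fun t : ℝ => ENNReal.ofReal (t ^ (-s)) * K Ω γ t u) logMeasure :=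
  ((measurable_id.pow_const (-s)).ennreal_ofReal.mul (K_mono Ω γ u).measurable).aemeasurable

theorem interpNorm_add {d : ℕ} (Ω γ : Set (E d)) (s : ℝ) (u v : L2 Ω) :
    interpNorm Ω γ s (u + v) ≤ interpNorm Ω γ s u + interpNorm Ω γ s v := by
  unfold interpNorm
  split_ifs
  · exact enorm_add_le _ _
  · refine ENNReal.le_iInf_add_iInf fun y z => ?_
    refine ENNReal.le_iInf_add_iInf fun hy hz => ?_
    refine (iInf₂_le (y + z) ?_).trans (enorm_add_le y z)
    rw [Submodule.coe_add, WithLp.add_fst, hy, hz]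
  · refine le_trans ?_ (ENNReal.lintegral_Lp_add_le (aemeasurable_K Ω γ s u)
      (aemeasurable_K Ω γ s v) one_le_two)
    gcongr with t
    simp only [Pi.add_apply]
    rw [← mul_add]
    gcongr
    exact K_add Ω γ t u v

theorem interpNorm_zero {d : ℕ} (Ω γ : Set (E d)) (s : ℝ) : interpNorm Ω γ s 0 = 0 := by
  unfold interpNorm
  split_ifs
  · simp
  · have h : ((0 : H10 Ω γ) : L2pair Ω).fst = 0 := rfl
    refine le_antisymm ((iInf₂_le (0 : H10 Ω γ) h).trans ?_) bot_le
    rw [enorm_zero (E := H10 Ω γ)]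
  · have : ∀ t, K Ω γ t 0 = 0 := fun t => le_antisymm (by simpa using K_smul Ω γ t 0 0) bot_le
    simp [this]

theorem interpNorm_smul_le {d : ℕ} (Ω γ : Set (E d)) (s : ℝ) (c : ℝ) (u : L2 Ω) :
    interpNorm Ω γ s (c • u) ≤ ‖c‖ₑ * interpNorm Ω γ s u := by
  by_cases hc : c = 0
  · subst hc; simp [interpNorm_zero]
  unfold interpNorm
  split_ifs
  · exact (enorm_smul c u).le
  · rw [ENNReal.mul_iInf_of_ne (by simpa using hc) enorm_ne_top]
    refine le_iInf fun y => ?_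
    rw [ENNReal.mul_iInf_of_ne (by simpa using hc) enorm_ne_top]
    refine le_iInf fun hy => (iInf₂_le (c • y) ?_).trans (enorm_smul c y).le
    rw [Submodule.coe_smul, WithLp.smul_fst, hy]
  · have h : ∀ t : ℝ, (ENNReal.ofReal (t ^ (-s)) * K Ω γ t (c • u)) ^ (2 : ℝ)
        ≤ ‖c‖ₑ ^ (2 : ℝ) * (ENNReal.ofReal (t ^ (-s)) * K Ω γ t u) ^ (2 : ℝ) := by
      intro t
      rw [← ENNReal.mul_rpow_of_nonneg _ _ zero_le_two]
      refine ENNReal.rpow_le_rpow ?_ zero_le_two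
      calc _ ≤ ENNReal.ofReal (t ^ (-s)) * (‖c‖ₑ * K Ω γ t u) := by
            gcongr; exact K_smul Ω γ t c u
        _ = _ := by ring
    calc _ ≤ (∫⁻ t, ‖c‖ₑ ^ (2 : ℝ) * (ENNReal.ofReal (t ^ (-s)) * K Ω γ t u) ^ (2 : ℝ)
            ∂logMeasure) ^ (1 / (2 : ℝ)) :=
          ENNReal.rpow_le_rpow (lintegral_mono h) (by norm_num)
      _ = _ := by
        rw [lintegral_const_mul' _ _ (ENNReal.rpow_ne_top_of_nonneg zero_le_two enorm_ne_top),
          ENNReal.mul_rpow_of_nonneg _ _ (by norm_num), ← ENNReal.rpow_mul]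
        norm_num

theorem interpNorm_smul {d : ℕ} (Ω γ : Set (E d)) (s : ℝ) (c : ℝ) (u : L2 Ω) :
    interpNorm Ω γ s (c • u) = ‖c‖ₑ * interpNorm Ω γ s u := by
  by_cases hc : c = 0
  · subst hc; simp [interpNorm_zero]
  refine le_antisymm (interpNorm_smul_le Ω γ s c u) ?_
  have h := interpNorm_smul_le Ω γ s c⁻¹ (c • u)
  rw [smul_smul, inv_mul_cancel₀ hc, one_smul] at h
  calc _ ≤ ‖c‖ₑ * (‖c⁻¹‖ₑ * interpNorm Ω γ s (c • u)) := by gcongr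
    _ = _ := by
      rw [← mul_assoc, ← enorm_mul, mul_inv_cancel₀ hc, enorm_one, one_mul]

/-- The interpolation space embeds continuously into `L₂(Ω)`. -/
theorem exists_le_interpNorm {d : ℕ} (Ω γ : Set (E d)) (s : ℝ) :
    ∃ C : ℝ≥0∞, C ≠ ⊤ ∧ ∀ u : L2 Ω, ‖u‖ₑ ≤ C * interpNorm Ω γ s u := by
  by_cases h0 : s = 0
  · exact ⟨1, ENNReal.one_ne_top, fun u => by simp [interpNorm, h0]⟩
  by_cases h1 : s = 1
  · refine ⟨1, ENNReal.one_ne_top, fun u => ?_⟩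
    rw [one_mul, interpNorm, if_neg h0, if_pos h1]
    refine le_iInf₂ fun y hy => ?_
    rw [← hy]
    exact enorm_fst_le y
  set f : ℝ → ℝ≥0∞ := fun t => ENNReal.ofReal (t ^ (-s)) ^ (2 : ℝ) with hf
  have hfm : Measurable f := ((measurable_id.pow_const (-s)).ennreal_ofReal).pow_const _
  have hgm : Measurable fun t : ℝ => ENNReal.ofReal t⁻¹ := measurable_inv.ennreal_ofReal
  have hI : (∫⁻ t in Ioi 1, f t ∂logMeasure) ≠ 0 := by
    rw [logMeasure, restrict_withDensity measurableSet_Ioi,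
      Measure.restrict_restrict measurableSet_Ioi,
      lintegral_withDensity_eq_lintegral_mul _ hgm hfm]
    intro hz
    rw [lintegral_eq_zero_iff (hgm.mul hfm), inter_eq_left.2 (Ioi_subset_Ioi zero_le_one),
      Filter.EventuallyEq, ae_restrict_iff' measurableSet_Ioi] at hz
    have hz' : volume (Ioi (1 : ℝ)) = 0 := by
      refine measure_mono_null (fun t ht => ?_) hz
      have ht0 : (0 : ℝ) < t := lt_trans zero_lt_one ht
      simp only [mem_compl_iff, mem_ofPred_eq, not_forall]
      refine ⟨ht, ?_⟩
      simp only [Pi.mul_apply, Pi.zero_apply, mul_eq_zero, not_or, hf]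
      refine ⟨by simpa using ht0, ?_⟩
      rw [ENNReal.rpow_eq_zero_iff]
      have := Real.rpow_pos_of_pos ht0 (-s)
      simp [this]
    simp at hz'
  set c : ℝ≥0∞ := (∫⁻ t in Ioi 1, f t ∂logMeasure) ^ (1 / (2 : ℝ)) with hc
  have hc0 : c ≠ 0 := by
    rw [hc, Ne, ENNReal.rpow_eq_zero_iff]
    simp [hI]
  have key : ∀ u : L2 Ω, c * ‖u‖ₑ ≤ interpNorm Ω γ s u := by
    intro u
    rw [interpNorm, if_neg h0, if_neg h1]
    have e : c * ‖u‖ₑ = (∫⁻ t in Ioi 1, f t * ‖u‖ₑ ^ (2 : ℝ) ∂logMeasure) ^ (1 / (2 : ℝ)) := by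
      rw [lintegral_mul_const' _ _ (ENNReal.rpow_ne_top_of_nonneg zero_le_two enorm_ne_top),
        ENNReal.mul_rpow_of_nonneg _ _ (by norm_num), ← ENNReal.rpow_mul]
      norm_num [hc]
    rw [e]
    refine ENNReal.rpow_le_rpow ?_ (by norm_num)
    refine le_trans ?_ (setLIntegral_le_lintegral (Ioi 1) _)
    refine setLIntegral_mono' measurableSet_Ioi fun t ht => ?_
    rw [hf, ← ENNReal.mul_rpow_of_nonneg _ _ zero_le_two]
    refine ENNReal.rpow_le_rpow ?_ zero_le_two
    gcongr
    exact le_K Ω γ u (le_of_lt ht)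
  have hm0 : min c 1 ≠ 0 := by
    simp [hc0]
  have hmt : min c 1 ≠ ⊤ := ne_top_of_le_ne_top ENNReal.one_ne_top (min_le_right c 1)
  refine ⟨(min c 1)⁻¹, by simpa using hm0, fun u => ?_⟩
  calc ‖u‖ₑ = (min c 1)⁻¹ * (min c 1 * ‖u‖ₑ) := by
        rw [← mul_assoc, ENNReal.inv_mul_cancel hm0 hmt, one_mul]
    _ ≤ (min c 1)⁻¹ * (c * ‖u‖ₑ) := by gcongr; exact min_le_left c 1
    _ ≤ _ := by gcongr; exact key u

/-- `[L₂(Ω), H¹_{0,γ}(Ω)]_{s,2}` as a subspace of `L₂(Ω)`. -/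
def interpSubmodule {d : ℕ} (Ω γ : Set (E d)) (s : ℝ) : Submodule ℝ (L2 Ω) where
  carrier := {u | interpNorm Ω γ s u < ⊤}
  add_mem' h₁ h₂ := (interpNorm_add Ω γ s _ _).trans_lt (ENNReal.add_lt_top.2 ⟨h₁, h₂⟩)
  zero_mem' := by
    rw [mem_ofPred_eq, interpNorm_zero]; exact ENNReal.zero_lt_top
  smul_mem' c u h :=
    (interpNorm_smul_le Ω γ s c u).trans_lt (ENNReal.mul_lt_top enorm_lt_top h)

/-- The space `𝒱 = [L₂(Ω), H¹_{0,γ}(Ω)]_{s,2}`, a normed space with its own norm `interpNorm`. -/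
def VSpace {d : ℕ} (Ω γ : Set (E d)) (s : ℝ) : Type := interpSubmodule Ω γ s

namespace VSpace

instance {d : ℕ} (Ω γ : Set (E d)) (s : ℝ) : AddCommGroup (VSpace Ω γ s) :=
  inferInstanceAs (AddCommGroup (interpSubmodule Ω γ s))

instance {d : ℕ} (Ω γ : Set (E d)) (s : ℝ) : Module ℝ (VSpace Ω γ s) :=
  inferInstanceAs (Module ℝ (interpSubmodule Ω γ s))

/-- The embedding `𝒱 ⊆ L₂(Ω)`. -/
def toL2 {d : ℕ} (Ω γ : Set (E d)) (s : ℝ) : VSpace Ω γ s →ₗ[ℝ] L2 Ω :=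
  (interpSubmodule Ω γ s).subtype

theorem toL2_injective {d : ℕ} (Ω γ : Set (E d)) (s : ℝ) : Function.Injective (toL2 Ω γ s) :=
  Subtype.val_injective

theorem interpNorm_lt_top {d : ℕ} {Ω γ : Set (E d)} {s : ℝ} (u : VSpace Ω γ s) :
    interpNorm Ω γ s (toL2 Ω γ s u) < ⊤ :=
  Subtype.property u

instance {d : ℕ} (Ω γ : Set (E d)) (s : ℝ) : Norm (VSpace Ω γ s) :=
  ⟨fun u => (interpNorm Ω γ s (toL2 Ω γ s u)).toReal⟩

theorem norm_def {d : ℕ} {Ω γ : Set (E d)} {s : ℝ} (u : VSpace Ω γ s) :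
    ‖u‖ = (interpNorm Ω γ s (toL2 Ω γ s u)).toReal := rfl

theorem exists_norm_toL2_le {d : ℕ} (Ω γ : Set (E d)) (s : ℝ) :
    ∃ C : ℝ, ∀ u : VSpace Ω γ s, ‖toL2 Ω γ s u‖ ≤ C * ‖u‖ := by
  obtain ⟨C, hC, h⟩ := exists_le_interpNorm Ω γ s
  refine ⟨C.toReal, fun u => ?_⟩
  rw [norm_def, ← ENNReal.toReal_mul, ← toReal_enorm]
  exact ENNReal.toReal_mono (ENNReal.mul_ne_top hC (interpNorm_lt_top u).ne) (h _)

theorem core {d : ℕ} (Ω γ : Set (E d)) (s : ℝ) : NormedSpace.Core ℝ (VSpace Ω γ s) where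
  norm_nonneg u := ENNReal.toReal_nonneg
  norm_smul c u := by
    rw [norm_def, map_smul, interpNorm_smul, ENNReal.toReal_mul, toReal_enorm, norm_def]
  norm_triangle u v := by
    rw [norm_def, norm_def, norm_def, map_add,
      ← ENNReal.toReal_add (interpNorm_lt_top u).ne (interpNorm_lt_top v).ne]
    exact ENNReal.toReal_mono (ENNReal.add_lt_top.2
      ⟨interpNorm_lt_top u, interpNorm_lt_top v⟩).ne (interpNorm_add Ω γ s _ _)
  norm_eq_zero_iff u := by
    constructor
    · intro h
      obtain ⟨C, hC⟩ := exists_norm_toL2_le Ω γ s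
      have := hC u
      rw [h, mul_zero] at this
      exact toL2_injective Ω γ s (by rw [map_zero]; exact norm_le_zero_iff.1 this)
    · rintro rfl
      rw [norm_def, map_zero, interpNorm_zero, ENNReal.toReal_zero]

instance {d : ℕ} (Ω γ : Set (E d)) (s : ℝ) : NormedAddCommGroup (VSpace Ω γ s) :=
  NormedAddCommGroup.ofCore (core Ω γ s)

instance {d : ℕ} (Ω γ : Set (E d)) (s : ℝ) : NormedSpace ℝ (VSpace Ω γ s) :=
  NormedSpace.ofCore (core Ω γ s)

end VSpace

/-- The space `𝒲 = 𝒱'`, with the dual norm. -/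
def WSpace {d : ℕ} (Ω γ : Set (E d)) (s : ℝ) : Type := StrongDual ℝ (VSpace Ω γ s)

namespace WSpace

instance {d : ℕ} (Ω γ : Set (E d)) (s : ℝ) : NormedAddCommGroup (WSpace Ω γ s) :=
  inferInstanceAs (NormedAddCommGroup (StrongDual ℝ (VSpace Ω γ s)))

instance {d : ℕ} (Ω γ : Set (E d)) (s : ℝ) : NormedSpace ℝ (WSpace Ω γ s) :=
  inferInstanceAs (NormedSpace ℝ (StrongDual ℝ (VSpace Ω γ s)))

/-- The identity from `𝒲` to the dual of `𝒱`. -/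
def toDual {d : ℕ} (Ω γ : Set (E d)) (s : ℝ) :
    WSpace Ω γ s ≃ₗᵢ[ℝ] StrongDual ℝ (VSpace Ω γ s) :=
  LinearIsometryEquiv.refl ℝ (StrongDual ℝ (VSpace Ω γ s))

/-- `𝒲 = 𝒱'`, as a continuous linear map. -/
def toDualL {d : ℕ} (Ω γ : Set (E d)) (s : ℝ) :
    WSpace Ω γ s →L[ℝ] StrongDual ℝ (VSpace Ω γ s) :=
  (toDual Ω γ s).toContinuousLinearEquiv

end WSpace

/-- The embedding `L₂(Ω) → 𝒲` of the Gelfand triple `𝒱 ⊆ L₂(Ω) ≃ L₂(Ω)' → 𝒲`: the function `w`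
acts on `v ∈ 𝒱` by `⟨w, v⟩_{L₂(Ω)}`. -/
def toW {d : ℕ} (Ω γ : Set (E d)) (s : ℝ) : L2 Ω →ₗ[ℝ] WSpace Ω γ s where
  toFun w := (WSpace.toDual Ω γ s).symm ((innerSL ℝ w).comp
    ((VSpace.toL2 Ω γ s).mkContinuousOfExistsBound (VSpace.exists_norm_toL2_le Ω γ s)))
  map_add' w w' := by
    rw [← map_add]; congr 1; ext v; simp
  map_smul' c w := by
    rw [RingHom.id_apply, ← map_smul]; congr 1; ext v; simp

theorem toW_apply {d : ℕ} (Ω γ : Set (E d)) (s : ℝ) (w : L2 Ω) (v : VSpace Ω γ s) :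
    WSpace.toDual Ω γ s (toW Ω γ s w) v = ⟪w, VSpace.toL2 Ω γ s v⟫ := rfl

/-! ### Meshes -/

/-- The simplex with vertex set `T`. -/
abbrev conv {d : ℕ} (T : Finset (E d)) : Set (E d) := convexHull ℝ (T : Set (E d))

/-- A conforming partition of `Ω` into (finitely many) closed `d`-simplices, each given by its set
of vertices. -/
structure Mesh {d : ℕ} (Ω : Set (E d)) where
  /-- The vertex sets of the simplices. -/
  cells : Finset (Finset (E d))
  card_eq : ∀ T ∈ cells, T.card = d + 1
  indep : ∀ T ∈ cells, AffineIndependent ℝ ((↑) : T → E d)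
  union_eq : ⋃ T ∈ cells, conv T = closure Ω
  /-- Two simplices are disjoint, or meet in a common face. -/
  conforming : ∀ S ∈ cells, ∀ T ∈ cells, conv S ∩ conv T ⊆ convexHull ℝ (S ∩ T : Set (E d))
  /-- Any two simplices with a common vertex `ν` are connected by a chain of simplices with vertex
  `ν`, of which each two consecutive ones share a `(d-1)`-face. For partitions of a Lipschitz
  domain this holds automatically; it excludes domains that touch themselves. -/
  star_connected : ∀ ν, ∀ S ∈ cells, ∀ T ∈ cells, ν ∈ S → ν ∈ T →
    Relation.ReflTransGen (fun A B : Finset (E d) => A ∈ cells ∧ B ∈ cells ∧ ν ∈ A ∧ ν ∈ B ∧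
      (A ∩ B : Set (E d)).ncard = d) S T

/-- `|T|`. -/
def vol {d : ℕ} (T : Finset (E d)) : ℝ := (volume (conv T)).toReal

/-- `h_T = |T|^{1/d}`. -/
def meshSize {d : ℕ} (T : Finset (E d)) : ℝ := vol T ^ (1 / (d : ℝ))

namespace Mesh

/-- `N⁰_𝒯`: the vertices of the partition that are not on `γ`. -/
def freeVertices {d : ℕ} {Ω : Set (E d)} (𝒯 : Mesh Ω) (γ : Set (E d)) : Set (E d) :=
  {ν | (∃ T ∈ 𝒯.cells, ν ∈ T) ∧ ν ∉ γ}

/-- The patch `ω_ν`. -/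
def patch {d : ℕ} {Ω : Set (E d)} (𝒯 : Mesh Ω) (ν : E d) : Set (E d) :=
  ⋃ T ∈ {T ∈ 𝒯.cells | ν ∈ T}, conv T

/-- `γ` is a (possibly empty) union of `(d-1)`-faces of simplices of the partition. -/
def IsUnionOfFaces {d : ℕ} {Ω : Set (E d)} (𝒯 : Mesh Ω) (γ : Set (E d)) : Prop :=
  ∃ F : Set (Finset (E d)), (∀ f ∈ F, f.card = d ∧ ∃ T ∈ 𝒯.cells, f ⊆ T) ∧ γ = ⋃ f ∈ F, conv f

/-- `w` is the family of barycentric coordinates of the point `x`: its coordinates with respect to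
the vertices of a simplex that contains it, and zero for all other points. -/
def IsBarycentric {d : ℕ} {Ω : Set (E d)} (𝒯 : Mesh Ω) (x : E d) (w : E d → ℝ) : Prop :=
  ∃ T ∈ 𝒯.cells, (∀ v, 0 ≤ w v) ∧ (∀ v, v ∉ T → w v = 0) ∧ ∑ v ∈ T, w v = 1 ∧
    ∑ v ∈ T, w v • v = x

open Classical in
/-- The nodal basis function `φ_ν`: the continuous piecewise linear function on the closure of `Ω`
with value `1` at `ν` and `0` at the other vertices, that is, the barycentric coordinate with
respect to `ν` (zero outside the closure of `Ω`). -/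
def hat {d : ℕ} {Ω : Set (E d)} (𝒯 : Mesh Ω) (ν : E d) (x : E d) : ℝ :=
  if h : ∃ w, 𝒯.IsBarycentric x w then h.choose ν else 0

/-- `𝒱_𝒯 = {u ∈ H¹_{0,γ}(Ω) : u|_T ∈ P₁ for all T ∈ 𝒯}`, as a subspace of `𝒱`. -/
def VT {d : ℕ} {Ω : Set (E d)} (𝒯 : Mesh Ω) (γ : Set (E d)) (s : ℝ) :
    Submodule ℝ (VSpace Ω γ s) where
  carrier := {u | (∃ y : H10 Ω γ, (y : L2pair Ω).fst = VSpace.toL2 Ω γ s u) ∧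
    ∀ T ∈ 𝒯.cells, ∃ p : E d →ᵃ[ℝ] ℝ,
      ∀ᵐ x ∂(mu Ω), x ∈ conv T → VSpace.toL2 Ω γ s u x = p x}
  add_mem' := by
    rintro u v ⟨⟨y, hy⟩, hu⟩ ⟨⟨z, hz⟩, hv⟩
    refine ⟨⟨y + z, by rw [Submodule.coe_add, WithLp.add_fst, hy, hz, map_add]⟩,
      fun T hT => ?_⟩
    obtain ⟨p, hp⟩ := hu T hT
    obtain ⟨q, hq⟩ := hv T hT
    refine ⟨p + q, ?_⟩
    filter_upwards [hp, hq, Lp.coeFn_add (VSpace.toL2 Ω γ s u) (VSpace.toL2 Ω γ s v)]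
      with x h1 h2 h3 hx
    rw [map_add, h3, Pi.add_apply, h1 hx, h2 hx]; rfl
  zero_mem' := by
    refine ⟨⟨0, by rw [map_zero]; rfl⟩, fun T _ => ⟨0, ?_⟩⟩
    filter_upwards [Lp.coeFn_zero ℝ 2 (mu Ω)] with x h _
    rw [map_zero, h]; rfl
  smul_mem' := by
    rintro c u ⟨⟨y, hy⟩, hu⟩
    refine ⟨⟨c • y, by rw [Submodule.coe_smul, WithLp.smul_fst, hy, map_smul]⟩,
      fun T hT => ?_⟩
    obtain ⟨p, hp⟩ := hu T hT
    refine ⟨c • p, ?_⟩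
    filter_upwards [hp, Lp.coeFn_smul c (VSpace.toL2 Ω γ s u)] with x h1 h2 hx
    rw [map_smul, h2, Pi.smul_apply, h1 hx]; rfl

end Mesh

/-- `𝒲_𝒯 = span Ψ_𝒯 ⊆ 𝒲`, for a collection `Ψ_𝒯 ⊆ L₂(Ω)`. -/
def WT {d : ℕ} {Ω : Set (E d)} (γ : Set (E d)) (s : ℝ) {ν : Type*} (ψ : ν → L2 Ω) :
    Submodule ℝ (WSpace Ω γ s) :=
  Submodule.span ℝ (range fun i => toW Ω γ s (ψ i))

/-- The element `ψ_i` of `𝒲_𝒯`. -/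
def WT.gen {d : ℕ} {Ω : Set (E d)} (γ : Set (E d)) (s : ℝ) {ν : Type*} (ψ : ν → L2 Ω) (i : ν) :
    WT γ s ψ :=
  ⟨toW Ω γ s (ψ i), Submodule.subset_span ⟨i, rfl⟩⟩

/-- The family is uniformly shape regular: `diam(T) ≲ h_T`. -/
def UniformlyShapeRegular {d : ℕ} {Ω : Set (E d)} {ι : Type*} (𝒯 : ι → Mesh Ω) : Prop :=
  ∃ σ : ℝ, ∀ i, ∀ T ∈ (𝒯 i).cells, Metric.diam (conv T) ≤ σ * meshSize T

/-- Neighbouring simplices have uniformly comparable sizes. -/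
def UniformKMesh {d : ℕ} {Ω : Set (E d)} {ι : Type*} (𝒯 : ι → Mesh Ω) : Prop :=
  ∃ κ : ℝ, ∀ i, ∀ S ∈ (𝒯 i).cells, ∀ T ∈ (𝒯 i).cells, (conv S ∩ conv T).Nonempty →
    meshSize S ≤ κ * meshSize T

/-- The conditions on the collections `Ψ_𝒯 = {ψ_ν : ν ∈ N⁰_𝒯}`: biorthogonality to `Φ_𝒯`,
`|⟨φ_ν, ψ_ν'⟩| ≂ δ_{νν'} ‖φ_ν‖ ‖ψ_ν'‖` in `L₂(Ω)` uniformly in `𝒯` and in the vertices (the upper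
bound is the Cauchy-Schwarz inequality), and `supp ψ_ν ⊆ ω_ν`. -/
structure UniformlyBiorthogonal {d : ℕ} {Ω : Set (E d)} {ι : Type*} (γ : Set (E d))
    (𝒯 : ι → Mesh Ω) (ψ : ∀ i, (𝒯 i).freeVertices γ → L2 Ω) : Prop where
  orthogonal : ∀ i, ∀ ν ν' : (𝒯 i).freeVertices γ, ν ≠ ν' →
    ∫ x in Ω, (𝒯 i).hat ν x * ψ i ν' x = 0
  diag_ne_zero : ∀ i, ∀ ν : (𝒯 i).freeVertices γ, ∫ x in Ω, (𝒯 i).hat ν x * ψ i ν x ≠ 0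
  lower_bound : ∃ c : ℝ, 0 < c ∧ ∀ i, ∀ ν : (𝒯 i).freeVertices γ,
    c * ((eLpNorm ((𝒯 i).hat ν) 2 (mu Ω)).toReal * ‖ψ i ν‖)
      ≤ |∫ x in Ω, (𝒯 i).hat ν x * ψ i ν x|
  support : ∀ i, ∀ ν : (𝒯 i).freeVertices γ, ∀ᵐ x ∂(mu Ω), x ∉ (𝒯 i).patch ν → ψ i ν x = 0

/-! ### Boundedly invertible and coercive operators -/

/-- `C_i ∈ ℒis(Y_i, Z_i)` uniformly in `i`. -/
def UniformLis {ι : Type*} {Y Z : ι → Type*} [∀ i, NormedAddCommGroup (Y i)]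
    [∀ i, NormedSpace ℝ (Y i)] [∀ i, NormedAddCommGroup (Z i)] [∀ i, NormedSpace ℝ (Z i)]
    (C : ∀ i, Y i →L[ℝ] Z i) : Prop :=
  (∀ i, (C i).IsInvertible) ∧ ∃ M : ℝ, ∀ i, ‖C i‖ ≤ M ∧ ‖(C i).inverse‖ ≤ M

/-- `Re(C) = (C + C') / 2`, where `C'` is the adjoint restricted to `Y ⊆ Y''`. -/
def re {Y : Type*} [NormedAddCommGroup Y] [NormedSpace ℝ Y] (C : Y →L[ℝ] StrongDual ℝ Y) :
    Y →L[ℝ] StrongDual ℝ Y :=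
  (1 / 2 : ℝ) • (C + C.flip)

/-- `C ∈ ℒis_c(Y, Y')`: boundedly invertible and coercive. -/
def IsLisc {Y : Type*} [NormedAddCommGroup Y] [NormedSpace ℝ Y] (C : Y →L[ℝ] StrongDual ℝ Y) :
    Prop :=
  C.IsInvertible ∧ ∃ c : ℝ, 0 < c ∧ ∀ y, c * ‖y‖ ^ 2 ≤ C y y

/-- `C_i ∈ ℒis_c(Y_i, Y_i')` uniformly in `i`. -/
def UniformLisc {ι : Type*} {Y : ι → Type*} [∀ i, NormedAddCommGroup (Y i)]
    [∀ i, NormedSpace ℝ (Y i)] (C : ∀ i, Y i →L[ℝ] StrongDual ℝ (Y i)) : Prop :=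
  (∀ i, IsLisc (C i)) ∧
    ∃ M : ℝ, ∀ i, ‖C i‖ ≤ M ∧ (re (C i)).IsInvertible ∧ ‖(re (C i)).inverse‖ ≤ M

/-- `G_i ∈ ℒis_c(Y_i', Y_i)` uniformly in `i`, where `Y_i` is identified with its image in
`Y_i''` (for reflexive `Y_i`). -/
def UniformLiscDual {ι : Type*} {Y : ι → Type*} [∀ i, NormedAddCommGroup (Y i)]
    [∀ i, NormedSpace ℝ (Y i)] (G : ∀ i, StrongDual ℝ (Y i) →L[ℝ] Y i) : Prop :=
  UniformLisc fun i => (NormedSpace.inclusionInDoubleDual ℝ (Y i)).comp (G i)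

/-! ### The preconditioner -/

/-- `D_𝒯 : 𝒱_𝒯 → 𝒲_𝒯'`, `(D_𝒯 v)(w) = ⟨v, w⟩` with the duality pairing of `𝒱` and `𝒲`, which for
`w ∈ L₂(Ω)` is the `L₂(Ω)`-scalar product. -/
def DT {d : ℕ} {Ω : Set (E d)} (γ : Set (E d)) (s : ℝ) (V : Submodule ℝ (VSpace Ω γ s))
    (W : Submodule ℝ (WSpace Ω γ s)) : V →L[ℝ] StrongDual ℝ W :=
  ((WSpace.toDualL Ω γ s).comp W.subtypeL).flip.comp V.subtypeL

theorem DT_apply {d : ℕ} {Ω : Set (E d)} (γ : Set (E d)) (s : ℝ)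
    (V : Submodule ℝ (VSpace Ω γ s)) (W : Submodule ℝ (WSpace Ω γ s)) (v : V) (w : W) :
    DT γ s V W v w = WSpace.toDual Ω γ s (w : WSpace Ω γ s) v := rfl

theorem DT_apply_gen {d : ℕ} {Ω : Set (E d)} (γ : Set (E d)) (s : ℝ)
    (V : Submodule ℝ (VSpace Ω γ s)) {ν : Type*} (ψ : ν → L2 Ω) (v : V) (i : ν) :
    DT γ s V (WT γ s ψ) v (WT.gen γ s ψ i) = ⟪ψ i, VSpace.toL2 Ω γ s v⟫ := rfl

/-- `G = D⁻¹ B (D')⁻¹`, where `D' : W → V'` is the adjoint of `D : V → W'` (restricted to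
`W ⊆ W''`). -/
def precond {V W : Type*} [NormedAddCommGroup V] [NormedSpace ℝ V] [NormedAddCommGroup W]
    [NormedSpace ℝ W] (D : V →L[ℝ] StrongDual ℝ W) (B : W →L[ℝ] StrongDual ℝ W) :
    StrongDual ℝ V →L[ℝ] V :=
  D.inverse.comp (B.comp D.flip.inverse)

end OpPrec

/-! Everything rests on the stability estimate ‖v‖ ≤ C ‖D v‖ on 𝒱_𝒯, with C independent of 𝒯. The
opposite bound ‖D‖ ≤ 1 is free, because 𝒲 carries the norm dual to that of 𝒱. Given both,
sandwiching B between D⁻¹ and (D')⁻¹ changes norms and coercivity constants by fixed factors only: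
f(G f) = (B w)(w) with w = (D')⁻¹ f and ‖f‖ ≤ ‖w‖ (`apply_precond`, `uniform_preconditioner`).

Stability is Fortin's argument in dual form (`norm_le_mul_norm_DT`). Let P u = ∑ ⟨u, ψ_ν⟩ / ⟨φ_ν,
ψ_ν⟩ φ_ν be the biorthogonal projector onto 𝒱_𝒯. If f is a norming functional of v, then f ∘ P is
the pairing with an element of 𝒲_𝒯 of norm at most ‖P‖, and its value at v is ‖v‖. So P has to be
bounded on 𝒱 uniformly in 𝒯, and by interpolation (`interpNorm_map_le`) it is enough to bound it on
L₂ and on H¹_{0,γ}.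

On L₂ the bound is local: the lower bound on |⟨φ_ν, ψ_ν⟩| controls each coefficient by the norm of
the function on the patch (`IsDual.vol_mul_sq_dualCoef_le`), and patches overlap finitely often. In
the H¹-seminorm, gradients of nodal functions cost a factor 1 / diam T. It is regained by
subtracting a constant a that approximates the function near T up to diam T times its gradient
(`Regular.exists_const`). Near γ one takes a = 0; elsewhere P reproduces constants
(`IsDual.dualCoef_one`), so that the subtraction does not change the gradient of the projection
(`sum_nodalExt_sub_smul`).

The boundary of Ω may be irregular, so no global Poincaré or trace theorem is used. A bound on
translates in convex open sets (`lintegral_translate_sub_sq_le`, `poincare_pair`) compares the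
constants of two cells inside an open convex set around their common face
(`IsAdjacent.faceCone_inter_subset`, `Regular.mul_sq_le_of_isAdjacent`), and chains of cells around
a vertex do the rest (`star_abs_sub_le`). At a face on γ, the extension by zero across the face is
weakly differentiable (`localWeakGrad_faceCone`), so the neighbour is replaced by zero
(`Regular.mul_sq_le_of_isFace`).

Shape regularity enters through volume packing: it bounds the gradients of barycentric coordinates
(`abs_bary_sub_mul_le`), the number of cells at a vertex (`card_star_le`), and the ratios of their
diameters (`cellDiam_le_of_star`).

That the nodal functions form a basis of 𝒱_𝒯 has two halves. They lie in H¹_{0,γ} as limits of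
truncations that vanish near γ (`exists_hat_mem_H10`). Conversely, a piecewise affine function in
H¹_{0,γ} has no jumps and vanishes at the vertices on γ, since a jump is incompatible with a bounded
weak gradient (`eq_of_weakGrad_bounded`). -/

namespace OpPrec

/-! ### Uniform coercivity and the abstract preconditioner -/

section Functional

variable {Y Z : Type*} [NormedAddCommGroup Y] [NormedSpace ℝ Y] [NormedAddCommGroup Z]
  [NormedSpace ℝ Z]

theorem finrank_strongDual [FiniteDimensional ℝ Y] :
    Module.finrank ℝ (StrongDual ℝ Y) = Module.finrank ℝ Y := by
  rw [← Subspace.dual_finrank_eq (K := ℝ) (V := Y)]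
  exact (LinearMap.toContinuousLinearMap (𝕜 := ℝ) (E := Y) (F' := ℝ)).finrank_eq.symm

theorem isInvertible_of_injective [FiniteDimensional ℝ Y] [FiniteDimensional ℝ Z]
    (C : Y →L[ℝ] Z) (hinj : Function.Injective C)
    (hdim : Module.finrank ℝ Y = Module.finrank ℝ Z) : C.IsInvertible := by
  refine ⟨(LinearEquiv.ofInjectiveOfFinrankEq (C : Y →ₗ[ℝ] Z) hinj hdim).toContinuousLinearEquiv,
    ?_⟩
  ext y
  rfl

theorem isInvertible_of_coercive [FiniteDimensional ℝ Y] (C : Y →L[ℝ] StrongDual ℝ Y) {c : ℝ}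
    (hc : 0 < c) (h : ∀ y, c * ‖y‖ ^ 2 ≤ C y y) : C.IsInvertible := by
  refine isInvertible_of_injective C ?_ finrank_strongDual.symm
  rw [injective_iff_map_eq_zero]
  intro y hy
  have h1 := h y
  rw [hy, zero_apply] at h1
  by_contra hne
  have : 0 < ‖y‖ := norm_pos_iff.2 hne
  have : 0 < c * ‖y‖ ^ 2 := by positivity
  linarith

theorem norm_inverse_le_of_coercive {C : Y →L[ℝ] StrongDual ℝ Y} (hC : C.IsInvertible) {c : ℝ}
    (hc : 0 < c) (h : ∀ y, c * ‖y‖ ^ 2 ≤ C y y) : ‖C.inverse‖ ≤ c⁻¹ := by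
  refine C.inverse.opNorm_le_bound (by positivity) fun f => ?_
  have h1 := h (C.inverse f)
  rw [hC.self_apply_inverse] at h1
  have h2 : f (C.inverse f) ≤ ‖f‖ * ‖C.inverse f‖ := (le_abs_self _).trans (f.le_opNorm _)
  rcases (norm_nonneg (C.inverse f)).eq_or_lt with h0 | h0
  · rw [← h0]; positivity
  · rw [inv_mul_eq_div, le_div_iff₀ hc]
    nlinarith

theorem re_apply (C : Y →L[ℝ] StrongDual ℝ Y) (x y : Y) :
    re C x y = (1 / 2) * (C x y + C y x) := rfl

theorem re_apply_self (C : Y →L[ℝ] StrongDual ℝ Y) (y : Y) : re C y y = C y y := by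
  rw [re_apply]; ring

/-- Cauchy–Schwarz for a semidefinite symmetric form: the quadratic polynomial t ↦ C(x + t y)(x + t
y) is nonnegative, so its discriminant is not positive. -/
theorem re_apply_sq_le (C : Y →L[ℝ] StrongDual ℝ Y) (h : ∀ y, 0 ≤ C y y) (x y : Y) :
    re C x y ^ 2 ≤ C x x * C y y := by
  have h1 : ∀ t : ℝ, 0 ≤ C x x + t * (2 * re C x y) + t ^ 2 * C y y := fun t => by
    have := h (x + t • y)
    simp only [map_add, map_smul, add_apply, smul_apply, smul_eq_mul] at this
    rw [re_apply]
    linarith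
  have h2 : ∀ t : ℝ, 0 ≤ C y y * (t * t) + (2 * re C x y) * t + C x x := fun t => by
    have := h1 t
    linarith
  have := discrim_le_zero h2
  rw [discrim] at this
  linarith

/-- Converts the bound on ‖Re(C)⁻¹‖ into a coercivity constant, although no inner product underlies
the norm. With a norming functional f of y and z = Re(C)⁻¹ f, one has ‖y‖² = f(y)² = (Re(C) z)(y)²,
and Cauchy–Schwarz leaves the factor C z z = f(z), which is at most ‖Re(C)⁻¹‖. -/
theorem sq_norm_le_of_re_inverse {C : Y →L[ℝ] StrongDual ℝ Y} (h : ∀ y, 0 ≤ C y y)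
    (hR : (re C).IsInvertible) (y : Y) : ‖y‖ ^ 2 ≤ ‖(re C).inverse‖ * C y y := by
  obtain ⟨f, hf1, hf2⟩ := exists_dual_vector'' ℝ y
  set z := (re C).inverse f
  have hz : re C z = f := hR.self_apply_inverse f
  have h1 := re_apply_sq_le C h z y
  have h2 : C z z ≤ ‖(re C).inverse‖ := by
    rw [← re_apply_self, hz]
    calc f z ≤ ‖f‖ * ‖z‖ := (le_abs_self _).trans (f.le_opNorm _)
      _ ≤ 1 * (‖(re C).inverse‖ * ‖f‖) := by gcongr; exact (re C).inverse.le_opNorm f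
      _ ≤ 1 * (‖(re C).inverse‖ * 1) := by gcongr
      _ = _ := by ring
  rw [hz, hf2] at h1
  refine h1.trans ?_
  gcongr
  exact h y

variable {V W : Type*} [NormedAddCommGroup V] [NormedSpace ℝ V] [NormedAddCommGroup W]
  [NormedSpace ℝ W]

/-- A norming functional g of w = (D')⁻¹ f equals D v with v = D⁻¹ g, hence ‖w‖ = g(w) = f(v). -/
theorem norm_flip_inverse_le {D : V →L[ℝ] StrongDual ℝ W} (hD : D.IsInvertible)
    (hD' : D.flip.IsInvertible) : ‖D.flip.inverse‖ ≤ ‖D.inverse‖ := by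
  refine D.flip.inverse.opNorm_le_bound D.inverse.opNorm_nonneg fun f => ?_
  set w := D.flip.inverse f
  have hw : D.flip w = f := hD'.self_apply_inverse f
  obtain ⟨g, hg1, hg2⟩ := exists_dual_vector'' ℝ w
  have hg : D (D.inverse g) = g := hD.self_apply_inverse g
  have h1 : f (D.inverse g) = ‖w‖ := by
    rw [← hw, ContinuousLinearMap.flip_apply, hg, hg2]; rfl
  rw [← h1]
  calc f (D.inverse g) ≤ ‖f‖ * ‖D.inverse g‖ := (le_abs_self _).trans (f.le_opNorm _)
    _ ≤ ‖f‖ * (‖D.inverse‖ * ‖g‖) := by gcongr; exact D.inverse.le_opNorm g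
    _ ≤ ‖f‖ * (‖D.inverse‖ * 1) := by gcongr
    _ = _ := by ring

theorem precond_isInvertible {D : V →L[ℝ] StrongDual ℝ W} (hD : D.IsInvertible)
    (hD' : D.flip.IsInvertible) {B : W →L[ℝ] StrongDual ℝ W} (hB : B.IsInvertible) :
    (precond D B).IsInvertible :=
  hD.inverse.comp (hB.comp hD'.inverse)

theorem norm_precond_le {D : V →L[ℝ] StrongDual ℝ W} (hD : D.IsInvertible)
    (hD' : D.flip.IsInvertible) (B : W →L[ℝ] StrongDual ℝ W) :
    ‖precond D B‖ ≤ ‖D.inverse‖ * (‖B‖ * ‖D.inverse‖) := by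
  refine (ContinuousLinearMap.opNorm_comp_le _ _).trans ?_
  gcongr
  refine (ContinuousLinearMap.opNorm_comp_le _ _).trans ?_
  gcongr
  exact norm_flip_inverse_le hD hD'

theorem norm_precond_inverse_le {D : V →L[ℝ] StrongDual ℝ W} (hD : D.IsInvertible)
    (hD' : D.flip.IsInvertible) {B : W →L[ℝ] StrongDual ℝ W} (hB : B.IsInvertible) :
    ‖(precond D B).inverse‖ ≤ ‖D‖ * (‖B.inverse‖ * ‖D‖) := by
  rw [precond, hD.inverse.inverse_comp_of_left, hB.inverse_comp_of_left, hD.inverse_inverse,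
    hD'.inverse_inverse]
  refine (ContinuousLinearMap.opNorm_comp_le _ _).trans ?_
  have h := ContinuousLinearMap.opNorm_comp_le D.flip B.inverse
  rw [ContinuousLinearMap.opNorm_flip] at h
  rw [← mul_assoc]
  gcongr

/-- Reduces coercivity of G to that of B: writing f = D' w moves D onto D⁻¹ B w and cancels it. -/
theorem apply_precond {D : V →L[ℝ] StrongDual ℝ W} (hD : D.IsInvertible)
    (hD' : D.flip.IsInvertible) (B : W →L[ℝ] StrongDual ℝ W) (f : StrongDual ℝ V) :
    f (precond D B f) = B (D.flip.inverse f) (D.flip.inverse f) := by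
  set w := D.flip.inverse f with hw
  have h1 : D.flip w = f := hD'.self_apply_inverse f
  have h2 : precond D B f = D.inverse (B w) := rfl
  rw [h2]
  conv_lhs => rw [← h1]
  rw [ContinuousLinearMap.flip_apply, hD.self_apply_inverse]

theorem uniform_preconditioner {ι : Type*} {V W : ι → Type*} [∀ i, NormedAddCommGroup (V i)]
    [∀ i, NormedSpace ℝ (V i)] [∀ i, NormedAddCommGroup (W i)] [∀ i, NormedSpace ℝ (W i)]
    [∀ i, FiniteDimensional ℝ (V i)]
    (D : ∀ i, V i →L[ℝ] StrongDual ℝ (W i)) (hD : ∀ i, (D i).IsInvertible)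
    (hD' : ∀ i, (D i).flip.IsInvertible) (hD1 : ∀ i, ‖D i‖ ≤ 1) {C : ℝ}
    (hC : ∀ i, ‖(D i).inverse‖ ≤ C) (B : ∀ i, W i →L[ℝ] StrongDual ℝ (W i))
    (hB : UniformLisc B) :
    UniformLiscDual (fun i => precond (D i) (B i)) ∧
      ∀ A : ∀ i, V i →L[ℝ] StrongDual ℝ (V i), UniformLisc A →
        UniformLis (fun i => (precond (D i) (B i)).comp (A i)) := by
  obtain ⟨hB1, M, hM⟩ := hB
  have hBnn : ∀ i w, 0 ≤ B i w w := fun i w => by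
    obtain ⟨_, c, hc, h⟩ := hB1 i
    exact (by positivity : 0 ≤ c * ‖w‖ ^ 2).trans (h w)
  -- The maximum with 1 guarantees positivity, also when some of the spaces are trivial.
  set K : ℝ := max M 1 with hK
  have hK1 : 1 ≤ K := le_max_right _ _
  have hK0 : 0 < K := by linarith
  have hBK : ∀ i w, ‖w‖ ^ 2 ≤ K * B i w w := fun i w => by
    refine (sq_norm_le_of_re_inverse (hBnn i) (hM i).2.1 w).trans ?_
    gcongr
    · exact hBnn i w
    · exact (hM i).2.2.trans (le_max_left _ _)
  have hG : ∀ i, ∀ f : StrongDual ℝ (V i), K⁻¹ * ‖f‖ ^ 2 ≤ f (precond (D i) (B i) f) := by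
    intro i f
    rw [apply_precond (hD i) (hD' i), inv_mul_le_iff₀ hK0]
    refine le_trans ?_ (hBK i _)
    -- Since ‖D‖ ≤ 1, the functional f = D' w satisfies ‖f‖ ≤ ‖w‖, and coercivity of B in w becomes
    -- coercivity of G in f.
    have h1 : (D i).flip ((D i).flip.inverse f) = f := (hD' i).self_apply_inverse f
    have h2 := (D i).flip.le_opNorm ((D i).flip.inverse f)
    rw [h1, ContinuousLinearMap.opNorm_flip] at h2
    have h3 : ‖f‖ ≤ ‖(D i).flip.inverse f‖ :=
      h2.trans (mul_le_of_le_one_left (norm_nonneg _) (hD1 i))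
    gcongr
  have hGn : ∀ i, ‖precond (D i) (B i)‖ ≤ C * (M * C) := fun i => by
    have h0 : 0 ≤ C := (D i).inverse.opNorm_nonneg.trans (hC i)
    have h1 : 0 ≤ M := (B i).opNorm_nonneg.trans (hM i).1
    refine (norm_precond_le (hD i) (hD' i) (B i)).trans ?_
    gcongr
    · exact hC i
    · exact (hM i).1
    · exact hC i
  have hJ : ∀ i, (NormedSpace.inclusionInDoubleDual ℝ (V i)).IsInvertible := fun i => by
    have h1 := finrank_strongDual (Y := StrongDual ℝ (V i))
    rw [finrank_strongDual (Y := V i)] at h1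
    exact isInvertible_of_injective (Z := StrongDual ℝ (StrongDual ℝ (V i))) _
      (NormedSpace.inclusionInDoubleDualLi ℝ (E := V i)).injective h1.symm
  have hinv := fun i => precond_isInvertible (hD i) (hD' i) (hB1 i).1
  constructor
  · have hre : ∀ i, ∀ f : StrongDual ℝ (V i), K⁻¹ * ‖f‖ ^ 2 ≤
        re ((NormedSpace.inclusionInDoubleDual ℝ (V i)).comp (precond (D i) (B i))) f f :=
      fun i f => by
        rw [re_apply_self]
        exact hG i f
    have hrei := fun i => isInvertible_of_coercive _ (inv_pos.2 hK0) (hre i)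
    refine ⟨fun i => ⟨(hJ i).comp (hinv i), K⁻¹, inv_pos.2 hK0, hG i⟩, max (C * (M * C)) K,
      fun i => ⟨?_, hrei i, ?_⟩⟩
    · refine le_trans (ContinuousLinearMap.opNorm_comp_le _ _) ?_
      refine le_trans (mul_le_of_le_one_left (norm_nonneg _)
        (NormedSpace.inclusionInDoubleDual_norm_le ℝ _)) ?_
      exact (hGn i).trans (le_max_left _ _)
    · have := norm_inverse_le_of_coercive (hrei i) (inv_pos.2 hK0) (hre i)
      rw [inv_inv] at this
      exact this.trans (le_max_right _ _)
  · rintro A ⟨hA1, N, hN⟩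
    have hAnn : ∀ i v, 0 ≤ A i v v := fun i v => by
      obtain ⟨_, c, hc, h⟩ := hA1 i
      exact (by positivity : 0 ≤ c * ‖v‖ ^ 2).trans (h v)
    set N' : ℝ := max N 1
    have hN0 : 0 < N' := lt_of_lt_of_le one_pos (le_max_right _ _)
    have hAc : ∀ i v, N'⁻¹ * ‖v‖ ^ 2 ≤ A i v v := fun i v => by
      rw [inv_mul_le_iff₀ hN0]
      refine (sq_norm_le_of_re_inverse (hAnn i) (hN i).2.1 v).trans ?_
      gcongr
      · exact hAnn i v
      · exact (hN i).2.2.trans (le_max_left _ _)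
    have hAinv : ∀ i, ‖(A i).inverse‖ ≤ N' := fun i => by
      have := norm_inverse_le_of_coercive (hA1 i).1 (inv_pos.2 hN0) (hAc i)
      rwa [inv_inv] at this
    have hBinv : ∀ i, ‖(B i).inverse‖ ≤ K := fun i => by
      have := norm_inverse_le_of_coercive (hB1 i).1 (inv_pos.2 hK0) fun w => by
        rw [inv_mul_le_iff₀ hK0]; exact hBK i w
      rwa [inv_inv] at this
    refine ⟨fun i => (hinv i).comp (hA1 i).1, max (C * (M * C) * N) (N' * K), fun i => ⟨?_, ?_⟩⟩
    · refine ((ContinuousLinearMap.opNorm_comp_le _ _).trans ?_).trans (le_max_left _ _)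
      gcongr
      · exact (precond (D i) (B i)).opNorm_nonneg.trans (hGn i)
      · exact hGn i
      · exact (hN i).1
    -- (G A)⁻¹ = A⁻¹ G⁻¹, where ‖G⁻¹‖ ≤ ‖D‖ ‖B⁻¹‖ ‖D‖ ≤ K.
    · rw [(hinv i).inverse_comp_of_left]
      refine ((ContinuousLinearMap.opNorm_comp_le _ _).trans ?_).trans (le_max_right _ _)
      gcongr
      · exact hAinv i
      · refine (norm_precond_inverse_le (hD i) (hD' i) (hB1 i).1).trans ?_
        calc ‖D i‖ * (‖(B i).inverse‖ * ‖D i‖) ≤ 1 * (K * 1) := by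
              gcongr
              · exact hD1 i
              · exact hBinv i
              · exact hD1 i
          _ = K := by ring

end Functional

end OpPrec

namespace OpPrec

/-! ### Simplices -/

/-- `T` is the vertex set of a nondegenerate `d`-simplex. -/
def IsSimplex {d : ℕ} (T : Finset (E d)) : Prop :=
  T.card = d + 1 ∧ AffineIndependent ℝ ((↑) : T → E d)

/-- The vertices of a nondegenerate simplex as an affine basis. -/
def IsSimplex.basis {d : ℕ} {T : Finset (E d)} (hT : IsSimplex T) : AffineBasis T ℝ (E d) :=
  ⟨(↑), hT.2, by
    rw [hT.2.affineSpan_eq_top_iff_card_eq_finrank_add_one, Fintype.card_coe, hT.1,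
      finrank_euclideanSpace_fin]⟩

theorem IsSimplex.basis_apply {d : ℕ} {T : Finset (E d)} (hT : IsSimplex T) (v : T) :
    hT.basis v = v := rfl

open Classical in
/-- The barycentric coordinate with respect to the vertex `v` of `T` (zero if `v` is not a
vertex). -/
def bary {d : ℕ} (T : Finset (E d)) (v : E d) : E d →ᵃ[ℝ] ℝ :=
  if h : IsSimplex T ∧ v ∈ T then h.1.basis.coord ⟨v, h.2⟩ else 0

theorem bary_eq_coord {d : ℕ} {T : Finset (E d)} (hT : IsSimplex T) {v : E d} (hv : v ∈ T) :
    bary T v = hT.basis.coord ⟨v, hv⟩ := by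
  rw [bary, dif_pos ⟨hT, hv⟩]

theorem bary_of_notMem {d : ℕ} {T : Finset (E d)} {v : E d} (hv : v ∉ T) : bary T v = 0 := by
  rw [bary, dif_neg (fun h => hv h.2)]

theorem bary_self {d : ℕ} {T : Finset (E d)} (hT : IsSimplex T) {v : E d} (hv : v ∈ T) :
    bary T v v = 1 := by
  rw [bary_eq_coord hT hv]
  exact hT.basis.coord_apply_eq ⟨v, hv⟩

theorem bary_ne {d : ℕ} {T : Finset (E d)} (hT : IsSimplex T) {v w : E d} (hw : w ∈ T)
    (h : v ≠ w) : bary T v w = 0 := by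
  by_cases hv : v ∈ T
  · rw [bary_eq_coord hT hv]
    exact hT.basis.coord_apply_ne (i := ⟨v, hv⟩) (j := ⟨w, hw⟩) (by simpa using h)
  · rw [bary_of_notMem hv]; rfl

theorem sum_bary {d : ℕ} {T : Finset (E d)} (hT : IsSimplex T) (x : E d) :
    ∑ v ∈ T, bary T v x = 1 := by
  rw [← hT.basis.sum_coord_apply_eq_one x, ← Finset.sum_coe_sort]
  exact Finset.sum_congr rfl fun v _ => by rw [bary_eq_coord hT v.2]

theorem sum_bary_smul {d : ℕ} {T : Finset (E d)} (hT : IsSimplex T) (x : E d) :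
    ∑ v ∈ T, bary T v x • v = x := by
  conv_rhs => rw [← hT.basis.linear_combination_coord_eq_self x]
  rw [← Finset.sum_coe_sort]
  exact Finset.sum_congr rfl fun v _ => by rw [bary_eq_coord hT v.2]; rfl

theorem affineMap_combination {d : ℕ} {T : Finset (E d)} {w : E d → ℝ} (hw : ∑ v ∈ T, w v = 1)
    (p : E d →ᵃ[ℝ] ℝ) : p (∑ v ∈ T, w v • v) = ∑ v ∈ T, w v * p v := by
  have h1 : ∀ x, p x = p.linear x + p 0 := fun x => by
    have := congrFun p.decomp x
    simpa using this
  rw [h1, map_sum]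
  simp_rw [map_smul, smul_eq_mul]
  have h2 : ∀ v, w v * p v = w v * p.linear v + w v * p 0 := fun v => by rw [h1 v]; ring
  rw [Finset.sum_congr rfl fun v _ => h2 v, Finset.sum_add_distrib, ← Finset.sum_mul, hw, one_mul]

theorem affineMap_eq_sum_bary {d : ℕ} {T : Finset (E d)} (hT : IsSimplex T) (p : E d →ᵃ[ℝ] ℝ)
    (x : E d) : p x = ∑ v ∈ T, bary T v x * p v := by
  conv_lhs => rw [← sum_bary_smul hT x]
  exact affineMap_combination (sum_bary hT x) p

theorem bary_unique {d : ℕ} {T : Finset (E d)} (hT : IsSimplex T) {w : E d → ℝ} {x : E d}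
    (hw : ∑ v ∈ T, w v = 1) (hx : ∑ v ∈ T, w v • v = x) {v : E d} (hv : v ∈ T) :
    bary T v x = w v := by
  rw [← hx, affineMap_combination hw, Finset.sum_eq_single v]
  · rw [bary_self hT hv, mul_one]
  · intro u hu huv
    rw [bary_ne hT hu huv.symm, mul_zero]
  · exact fun h => absurd hv h

theorem range_basis {d : ℕ} {T : Finset (E d)} (hT : IsSimplex T) :
    range hT.basis = (T : Set (E d)) := by
  ext x
  constructor
  · rintro ⟨v, rfl⟩; exact v.2
  · exact fun hx => ⟨⟨x, hx⟩, rfl⟩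

theorem mem_conv_iff {d : ℕ} {T : Finset (E d)} (hT : IsSimplex T) {x : E d} :
    x ∈ conv T ↔ ∀ v ∈ T, 0 ≤ bary T v x := by
  rw [conv, ← range_basis hT, hT.basis.convexHull_eq_nonneg_coord]
  constructor
  · intro h v hv
    rw [bary_eq_coord hT hv]; exact h ⟨v, hv⟩
  · rintro h ⟨v, hv⟩
    rw [← bary_eq_coord hT hv]; exact h v hv

theorem mem_interior_conv_iff {d : ℕ} {T : Finset (E d)} (hT : IsSimplex T) {x : E d} :
    x ∈ interior (conv T) ↔ ∀ v ∈ T, 0 < bary T v x := by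
  rw [conv, ← range_basis hT, hT.basis.interior_convexHull]
  constructor
  · intro h v hv
    rw [bary_eq_coord hT hv]; exact h ⟨v, hv⟩
  · rintro h ⟨v, hv⟩
    rw [← bary_eq_coord hT hv]; exact h v hv

theorem bary_nonneg {d : ℕ} {T : Finset (E d)} (hT : IsSimplex T) {x : E d} (hx : x ∈ conv T)
    (v : E d) : 0 ≤ bary T v x := by
  by_cases hv : v ∈ T
  · exact (mem_conv_iff hT).1 hx v hv
  · rw [bary_of_notMem hv]; exact le_rfl

theorem bary_le_one {d : ℕ} {T : Finset (E d)} (hT : IsSimplex T) {x : E d} (hx : x ∈ conv T)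
    (v : E d) : bary T v x ≤ 1 := by
  by_cases hv : v ∈ T
  · rw [← sum_bary hT x]
    exact Finset.single_le_sum (f := fun v => bary T v x) (fun u _ => bary_nonneg hT hx u) hv
  · rw [bary_of_notMem hv]; exact zero_le_one

theorem continuous_affineMap {d : ℕ} (p : E d →ᵃ[ℝ] ℝ) : Continuous p :=
  AffineMap.continuous_of_finiteDimensional p

theorem bary_eq_zero_of_mem_face {d : ℕ} {T : Finset (E d)} (hT : IsSimplex T) {F : Set (E d)}
    (hF : F ⊆ T) {x : E d} (hx : x ∈ convexHull ℝ F) {v : E d} (hv : v ∉ F) :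
    bary T v x = 0 := by
  have : convexHull ℝ F ⊆ (bary T v) ⁻¹' {0} :=
    convexHull_min (fun w hw => bary_ne hT (hF hw) (fun h => hv (h ▸ hw)))
      ((convex_singleton (𝕜 := ℝ) (0 : ℝ)).affine_preimage _)
  exact this hx

theorem affineMap_homothety {d : ℕ} (p : E d →ᵃ[ℝ] ℝ) (b x : E d) (δ : ℝ) :
    p (AffineMap.homothety b δ x) = p b + δ * (p x - p b) := by
  rw [AffineMap.homothety_eq_lineMap, AffineMap.apply_lineMap, AffineMap.lineMap_apply,
    vsub_eq_sub, vadd_eq_add, smul_eq_mul]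
  ring

theorem isCompact_conv {d : ℕ} (T : Finset (E d)) : IsCompact (conv T) :=
  T.finite_toSet.isCompact_convexHull ℝ

theorem convex_conv {d : ℕ} (T : Finset (E d)) : Convex ℝ (conv T) := convex_convexHull ℝ _

theorem volume_conv_ne_top {d : ℕ} (T : Finset (E d)) : volume (conv T) ≠ ⊤ :=
  (isCompact_conv T).measure_ne_top

theorem interior_conv_ae_eq {d : ℕ} (T : Finset (E d)) :
    (interior (conv T) : Set (E d)) =ᵐ[volume] conv T :=
  interior_ae_eq_of_null_frontier ((convex_conv T).addHaar_frontier volume)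

theorem volume_interior_conv {d : ℕ} (T : Finset (E d)) :
    volume (interior (conv T)) = volume (conv T) :=
  measure_congr (interior_conv_ae_eq T)

theorem IsSimplex.nonempty {d : ℕ} {T : Finset (E d)} (hT : IsSimplex T) : T.Nonempty := by
  rw [← Finset.card_pos, hT.1]; omega

theorem IsSimplex.interior_nonempty {d : ℕ} {T : Finset (E d)} (hT : IsSimplex T) :
    (interior (conv T)).Nonempty := by
  have : 0 < (T.card : ℝ) := by exact_mod_cast hT.nonempty.card_pos
  refine ⟨∑ v ∈ T, (fun _ => (T.card : ℝ)⁻¹) v • v, (mem_interior_conv_iff hT).2 fun v hv => ?_⟩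
  rw [bary_unique hT (w := fun _ => (T.card : ℝ)⁻¹) ?_ rfl hv]
  · positivity
  · rw [Finset.sum_const, nsmul_eq_mul, mul_inv_cancel₀ this.ne']

theorem vol_pos {d : ℕ} {T : Finset (E d)} (hT : IsSimplex T) : 0 < vol T := by
  refine ENNReal.toReal_pos ?_ (volume_conv_ne_top T)
  rw [← volume_interior_conv]
  exact (isOpen_interior.measure_pos volume hT.interior_nonempty).ne'

theorem ofReal_vol {d : ℕ} (T : Finset (E d)) : ENNReal.ofReal (vol T) = volume (conv T) :=
  ENNReal.ofReal_toReal (volume_conv_ne_top T)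

/-- `diam T`. -/
def cellDiam {d : ℕ} (T : Finset (E d)) : ℝ := Metric.diam (conv T)

theorem dist_le_cellDiam {d : ℕ} {T : Finset (E d)} {x y : E d} (hx : x ∈ conv T)
    (hy : y ∈ conv T) : dist x y ≤ cellDiam T :=
  Metric.dist_le_diam_of_mem (isCompact_conv T).isBounded hx hy

theorem mem_conv_of_mem {d : ℕ} {T : Finset (E d)} {v : E d} (hv : v ∈ T) : v ∈ conv T :=
  subset_convexHull ℝ _ hv

theorem cellDiam_pos {d : ℕ} (hd : 1 ≤ d) {T : Finset (E d)} (hT : IsSimplex T) :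
    0 < cellDiam T := by
  obtain ⟨v, hv, w, hw, hne⟩ := Finset.one_lt_card.1 (by rw [hT.1]; omega : 1 < T.card)
  exact (dist_pos.2 hne).trans_le (dist_le_cellDiam (mem_conv_of_mem hv) (mem_conv_of_mem hw))

/-- The volume of the unit ball. -/
def ballVol (d : ℕ) : ℝ := volume.real (Metric.ball (0 : E d) 1)

theorem ballVol_pos (d : ℕ) : 0 < ballVol d :=
  ENNReal.toReal_pos (Metric.measure_ball_pos volume _ one_pos).ne' measure_ball_lt_top.ne

theorem volume_closedBall {d : ℕ} (x : E d) {r : ℝ} (hr : 0 ≤ r) :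
    volume (Metric.closedBall x r) = ENNReal.ofReal (r ^ d * ballVol d) := by
  rw [Measure.addHaar_closedBall _ _ hr, finrank_euclideanSpace_fin,
    ENNReal.ofReal_mul (by positivity), ballVol, measureReal_def,
    ENNReal.ofReal_toReal measure_ball_lt_top.ne]

theorem vol_le {d : ℕ} {T : Finset (E d)} (hT : IsSimplex T) :
    vol T ≤ cellDiam T ^ d * ballVol d := by
  obtain ⟨v, hv⟩ := hT.nonempty
  have h0 : 0 ≤ cellDiam T := Metric.diam_nonneg
  have := ballVol_pos d
  refine ENNReal.toReal_le_of_le_ofReal (by positivity) ?_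
  rw [← volume_closedBall v h0]
  exact measure_mono fun x hx => dist_le_cellDiam hx (mem_conv_of_mem hv)

/-- Disjoint sets of equal volume in a ball. -/
theorem card_mul_le_of_disjoint {d : ℕ} {κ : Type*} (s : Finset κ) (A : κ → Set (E d))
    (hA : ∀ k ∈ s, MeasurableSet (A k)) (hdisj : (s : Set κ).PairwiseDisjoint A) {m r : ℝ}
    (hr : 0 ≤ r) (hvol : ∀ k ∈ s, ENNReal.ofReal m ≤ volume (A k)) {x : E d}
    (hsub : ∀ k ∈ s, A k ⊆ Metric.closedBall x r) : s.card * m ≤ r ^ d * ballVol d := by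
  have h1 : ENNReal.ofReal (s.card * m) ≤ ENNReal.ofReal (r ^ d * ballVol d) := by
    rw [← volume_closedBall x hr]
    calc ENNReal.ofReal (s.card * m) = ∑ k ∈ s, ENNReal.ofReal m := by
          rw [Finset.sum_const, nsmul_eq_mul, ENNReal.ofReal_mul (by positivity),
            ENNReal.ofReal_natCast]
      _ ≤ ∑ k ∈ s, volume (A k) := Finset.sum_le_sum hvol
      _ = volume (⋃ k ∈ s, A k) := (measure_biUnion_finset hdisj hA).symm
      _ ≤ _ := measure_mono (iUnion₂_subset hsub)
  have := ballVol_pos d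
  exact (ENNReal.ofReal_le_ofReal_iff (by positivity)).1 h1

/-- The barycentric coordinates of a shape regular simplex have gradients of order
`1 / diam T`. -/
theorem abs_bary_sub_mul_le {d : ℕ} (hd : 1 ≤ d) {T : Finset (E d)} (hT : IsSimplex T) {σ : ℝ}
    (hσ : cellDiam T ^ d ≤ σ * vol T) (v x y : E d) :
    |bary T v x - bary T v y| * cellDiam T ≤ (σ * (3 ^ d * ballVol d)) * dist x y := by
  have hD := cellDiam_pos hd hT
  have hV := vol_pos hT
  have hb := ballVol_pos d
  have hσ0 : 0 < σ := by
    by_contra h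
    have : σ * vol T ≤ 0 := mul_nonpos_of_nonpos_of_nonneg (not_lt.1 h) hV.le
    have : 0 < cellDiam T ^ d := by positivity
    linarith
  by_cases hv : v ∈ T
  swap
  · rw [bary_of_notMem hv]
    simp only [AffineMap.coe_zero, Pi.zero_apply, sub_zero, abs_zero, zero_mul]
    positivity
  set ℓ : StrongDual ℝ (E d) := LinearMap.toContinuousLinearMap (bary T v).linear with hℓ
  have hsub : ∀ x y, bary T v x - bary T v y = ℓ (x - y) := fun x y => by
    have := (bary T v).linearMap_vsub x y
    rw [vsub_eq_sub, vsub_eq_sub] at this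
    exact this.symm
  obtain ⟨w, hw, hwv⟩ : ∃ w ∈ T, w ≠ v :=
    Finset.exists_mem_ne (by rw [hT.1]; omega : 1 < T.card) v
  have hvw : ℓ (v - w) = 1 := by
    rw [← hsub, bary_self hT hv, bary_ne hT hw hwv.symm, sub_zero]
  set a := ‖ℓ‖ with ha
  have haD : 1 ≤ a * cellDiam T := by
    have h1 := ℓ.le_opNorm (v - w)
    rw [hvw, norm_one, ← dist_eq_norm] at h1
    exact h1.trans (mul_le_mul_of_nonneg_left
      (dist_le_cellDiam (mem_conv_of_mem hv) (mem_conv_of_mem hw)) (norm_nonneg _))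
  have ha0 : 0 < a := by
    by_contra h
    have : a * cellDiam T ≤ 0 := mul_nonpos_of_nonpos_of_nonneg (not_lt.1 h) hD.le
    linarith
  -- A shortest vector along which the coordinate grows by one, namely the gradient divided by a².
  obtain ⟨e, he1, he2⟩ : ∃ e : E d, ℓ e = 1 ∧ ‖e‖ = a⁻¹ := by
    set g := (InnerProductSpace.toDual ℝ (E d)).symm ℓ with hg
    have hgn : ‖g‖ = a := LinearIsometryEquiv.norm_map _ _
    refine ⟨(a ^ 2)⁻¹ • g, ?_, ?_⟩
    · rw [map_smul, ← InnerProductSpace.toDual_symm_apply, ← hg, real_inner_self_eq_norm_sq, hgn,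
        smul_eq_mul, inv_mul_cancel₀ (by positivity)]
    · rw [norm_smul, hgn, norm_inv, norm_pow, Real.norm_of_nonneg ha0.le]
      field_simp
  -- Packing: the translates of T by e, 2e, ... are disjoint, since on the k-th one the coordinate
  -- of v lies in (k, k+1). If the gradient a is large then e is short, and N ≥ a diam T of them fit
  -- into a ball of radius 3 diam T, which bounds N and thus a.
  set N := ⌈cellDiam T * a⌉₊ with hN
  have hN1 : cellDiam T * a ≤ N := Nat.le_ceil _
  have hN2 : (N : ℝ) < cellDiam T * a + 1 := Nat.ceil_lt_add_one (by positivity)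
  set A : ℕ → Set (E d) := fun k => (fun x => x + -((k : ℝ) • e)) ⁻¹' interior (conv T) with hA
  have hAL : ∀ k : ℕ, ∀ x ∈ A k, (k : ℝ) < bary T v x ∧ bary T v x < k + 1 := by
    intro k x hx
    have h1 : bary T v x - bary T v (x + -((k : ℝ) • e)) = k := by
      rw [hsub, show x - (x + -((k : ℝ) • e)) = (k : ℝ) • e by abel, map_smul, he1, smul_eq_mul,
        mul_one]
    have hx' := (mem_interior_conv_iff hT).1 hx
    have h2 : bary T v (x + -((k : ℝ) • e)) < 1 := by
      rw [← sum_bary hT (x + -((k : ℝ) • e))]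
      refine Finset.single_lt_sum hwv hv hw (hx' w hw) fun u hu _ => (hx' u hu).le
    have h3 := hx' v hv
    constructor <;> linarith
  have hdisj : ((Finset.range N : Finset ℕ) : Set ℕ).PairwiseDisjoint A := by
    intro k _ l _ hkl
    refine Set.disjoint_left.2 fun x hx hx' => hkl ?_
    obtain ⟨h1, h2⟩ := hAL k x hx
    obtain ⟨h3, h4⟩ := hAL l x hx'
    have h5 : (k : ℝ) < l + 1 := by linarith
    have h6 : (l : ℝ) < k + 1 := by linarith
    norm_cast at h5 h6
    omega
  have hmain := card_mul_le_of_disjoint (x := v) (r := 3 * cellDiam T) (m := vol T)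
    (Finset.range N) A
    (fun k _ => (isOpen_interior.preimage (by fun_prop)).measurableSet) hdisj (by positivity)
    (fun k _ => by
      rw [ofReal_vol, ← volume_interior_conv, hA]
      exact (measure_preimage_add_right volume _ _).ge) (by
    intro k hk x hx
    have h1 : dist (x + -((k : ℝ) • e)) v ≤ cellDiam T :=
      dist_le_cellDiam (interior_subset hx) (mem_conv_of_mem hv)
    have h2 : dist x (x + -((k : ℝ) • e)) = k * a⁻¹ := by
      rw [dist_eq_norm, show x - (x + -((k : ℝ) • e)) = (k : ℝ) • e by abel, norm_smul, he2]
      simp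
    have hkN : (k : ℝ) ≤ N := by exact_mod_cast (Finset.mem_range.1 hk).le
    -- k ≤ N < a diam T + 1 ≤ 2 a diam T, by `haD`.
    have h3 : (k : ℝ) * a⁻¹ ≤ 2 * cellDiam T := by
      rw [mul_inv_le_iff₀ ha0]
      linarith
    have := dist_triangle x (x + -((k : ℝ) • e)) v
    rw [Metric.mem_closedBall]
    linarith)
  rw [Finset.card_range, mul_pow] at hmain
  have hkey : a * cellDiam T ≤ σ * (3 ^ d * ballVol d) := by
    have hDd : 0 < cellDiam T ^ d := by positivity
    refine le_of_mul_le_mul_right ?_ hDd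
    calc a * cellDiam T * cellDiam T ^ d ≤ N * (σ * vol T) := by
          gcongr
          linarith
      _ = σ * (N * vol T) := by ring
      _ ≤ σ * (3 ^ d * cellDiam T ^ d * ballVol d) := by gcongr
      _ = _ := by ring
  rw [hsub, ← Real.norm_eq_abs, dist_eq_norm]
  calc ‖ℓ (x - y)‖ * cellDiam T ≤ (a * ‖x - y‖) * cellDiam T := by gcongr; exact ℓ.le_opNorm _
    _ = (a * cellDiam T) * ‖x - y‖ := by ring
    _ ≤ _ := by gcongr

end OpPrec

namespace OpPrec

/-! ### Square integrals -/

theorem sq_lintegral_mul_le {α : Type*} [MeasurableSpace α] (μ : Measure α) {f g : α → ℝ≥0∞}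
    (hf : AEMeasurable f μ) (hg : AEMeasurable g μ) :
    (∫⁻ x, f x * g x ∂μ) ^ 2 ≤ (∫⁻ x, f x ^ 2 ∂μ) * ∫⁻ x, g x ^ 2 ∂μ := by
  have h := ENNReal.lintegral_mul_le_Lp_mul_Lq μ (Real.HolderConjugate.two_two) hf hg
  simp only [ENNReal.rpow_two, Pi.mul_apply] at h
  have h2 : ∀ a : ℝ≥0∞, (a ^ (1 / 2 : ℝ)) ^ 2 = a := fun a => by
    rw [← ENNReal.rpow_two, ← ENNReal.rpow_mul]; norm_num
  calc _ ≤ _ := pow_le_pow_left₀ (by positivity) h 2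
    _ = _ := by rw [mul_pow, h2, h2]

theorem eLpNorm_two_sq {α F : Type*} [MeasurableSpace α] [NormedAddCommGroup F] (μ : Measure α)
    (f : α → F) : eLpNorm f 2 μ ^ 2 = ∫⁻ x, ‖f x‖ₑ ^ 2 ∂μ := by
  have h := eLpNorm_nnreal_pow_eq_lintegral (μ := μ) (f := f) (p := 2) (by norm_num)
  simpa [ENNReal.rpow_two] using h

theorem enorm_Lp_sq {α F : Type*} [MeasurableSpace α] [NormedAddCommGroup F] {μ : Measure α}
    (f : Lp F 2 μ) : ‖f‖ₑ ^ 2 = ∫⁻ x, ‖f x‖ₑ ^ 2 ∂μ := by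
  rw [← eLpNorm_two_sq, Lp.enorm_def]

theorem MemLp.lintegral_sq_lt_top {α F : Type*} [MeasurableSpace α] [NormedAddCommGroup F]
    {μ : Measure α} {f : α → F} (hf : MemLp f 2 μ) : ∫⁻ x, ‖f x‖ₑ ^ 2 ∂μ < ⊤ := by
  rw [← eLpNorm_two_sq]
  exact ENNReal.pow_lt_top hf.2

theorem enorm_sq (r : ℝ) : ‖r‖ₑ ^ 2 = ENNReal.ofReal (r ^ 2) := by
  rw [Real.enorm_eq_ofReal_abs, ← ENNReal.ofReal_pow (abs_nonneg r), sq_abs]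

theorem enorm_norm_sq {F : Type*} [NormedAddCommGroup F] (x : F) :
    ‖x‖ₑ ^ 2 = ENNReal.ofReal (‖x‖ ^ 2) := by
  rw [← ofReal_norm, ← ENNReal.ofReal_pow (norm_nonneg x)]

/-! ### Local weak gradients -/

/-- The smooth functions with compact support in `O`. -/
structure IsTest {d : ℕ} (O : Set (E d)) (φ : E d → ℝ) : Prop where
  smooth : ContDiff ℝ ∞ φ
  compact : HasCompactSupport φ
  support : tsupport φ ⊆ O

theorem IsTest.continuous {d : ℕ} {O : Set (E d)} {φ : E d → ℝ} (h : IsTest O φ) :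
    Continuous φ := h.smooth.continuous

theorem IsTest.memLp {d : ℕ} {O : Set (E d)} {φ : E d → ℝ} (h : IsTest O φ) (p : ℝ≥0∞)
    (μ : Measure (E d)) [IsLocallyFiniteMeasure μ] : MemLp φ p μ :=
  h.continuous.memLp_of_hasCompactSupport h.compact

theorem IsTest.eq_zero {d : ℕ} {O : Set (E d)} {φ : E d → ℝ} (h : IsTest O φ) {x : E d}
    (hx : x ∉ O) : φ x = 0 :=
  image_eq_zero_of_notMem_tsupport fun h' => hx (h.support h')

theorem IsTest.mono {d : ℕ} {O O' : Set (E d)} {φ : E d → ℝ} (h : IsTest O φ) (hO : O ⊆ O') :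
    IsTest O' φ := ⟨h.smooth, h.compact, h.support.trans hO⟩

/-- `g` is a weak gradient of `u` on the open set `O`. -/
def LocalWeakGrad {d : ℕ} (O : Set (E d)) (u : E d → ℝ) (g : E d → E d) : Prop :=
  ∀ φ, IsTest O φ → ∀ v : E d,
    ∫ x, u x * fderiv ℝ φ x v = - ∫ x, ⟪g x, v⟫ * φ x

/-- The test functions on `A` as a subspace of `L₂(A)`. -/
def testSubmodule {d : ℕ} (A : Set (E d)) : Submodule ℝ (L2 A) where
  carrier := {f | ∃ φ, IsTest A φ ∧ f =ᵐ[mu A] φ}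
  add_mem' := by
    rintro f₁ f₂ ⟨φ₁, h₁, e₁⟩ ⟨φ₂, h₂, e₂⟩
    refine ⟨φ₁ + φ₂, ⟨h₁.smooth.add h₂.smooth, h₁.compact.add h₂.compact,
      (tsupport_add φ₁ φ₂).trans (union_subset h₁.support h₂.support)⟩, ?_⟩
    exact (Lp.coeFn_add f₁ f₂).trans (e₁.add e₂)
  zero_mem' := ⟨0, ⟨contDiff_const, HasCompactSupport.zero, by simp⟩, Lp.coeFn_zero _ _ _⟩
  smul_mem' := by
    rintro c f ⟨φ, h, e⟩
    refine ⟨c • φ, ⟨h.smooth.const_smul c, h.compact.smul_left (f := fun _ => c),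
      (closure_mono (Function.support_const_smul_subset c φ)).trans h.support⟩, ?_⟩
    exact (Lp.coeFn_smul c f).trans (e.const_smul c)

/-- The fundamental lemma of the calculus of variations: what is orthogonal to all test functions is
zero. -/
theorem testSubmodule_dense {d : ℕ} {A : Set (E d)} (hA : IsOpen A) :
    (testSubmodule A).topologicalClosure = ⊤ := by
  rw [Submodule.topologicalClosure_eq_top_iff, Submodule.eq_bot_iff]
  intro r hr
  rw [Submodule.mem_orthogonal] at hr
  have hloc : LocallyIntegrableOn r A volume :=
    locallyIntegrableOn_of_locallyIntegrable_restrict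
      ((Lp.memLp r).locallyIntegrable one_le_two)
  have h0 := hA.ae_eq_zero_of_integral_contDiff_smul_eq_zero hloc fun φ h1 h2 h3 => by
    have ht : IsTest A φ := ⟨h1, h2, h3⟩
    have := hr ((ht.memLp 2 (mu A)).toLp φ) ⟨φ, ht, MemLp.coeFn_toLp _⟩
    rw [L2.inner_def] at this
    rw [← setIntegral_eq_integral_of_forall_compl_eq_zero (s := A)
      (fun x hx => by rw [ht.eq_zero hx, zero_smul]), ← this]
    refine integral_congr_ae ?_
    filter_upwards [MemLp.coeFn_toLp (ht.memLp 2 (mu A))] with x hx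
    rw [hx, real_inner_eq_re_inner, RCLike.inner_apply]
    simp [mul_comm]
  refine Lp.ext ?_
  filter_upwards [(ae_restrict_iff' hA.measurableSet).2 h0, Lp.coeFn_zero ℝ 2 (mu A)] with x h1 h2
  rw [h1, h2]; rfl

/-- A function is controlled in `L₂(A)` by its pairings with test functions. -/
theorem lintegral_sq_le_of_test {d : ℕ} {A : Set (E d)} (hA : IsOpen A) {h : E d → ℝ}
    (hh : MemLp h 2 volume) {M : ℝ} (hM : 0 ≤ M)
    (hbd : ∀ φ, IsTest A φ → |∫ x, h x * φ x| ≤ M * (eLpNorm φ 2 (mu A)).toReal) :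
    ∫⁻ x in A, ‖h x‖ₑ ^ 2 ≤ ENNReal.ofReal (M ^ 2) := by
  have hhA : MemLp h 2 (mu A) := hh.restrict A
  set h' : L2 A := hhA.toLp h
  have key : ∀ f : L2 A, |⟪h', f⟫| ≤ M * ‖f‖ := by
    intro f
    have hf : f ∈ (testSubmodule A).topologicalClosure := by
      rw [testSubmodule_dense hA]; trivial
    have hcl : IsClosed {f : L2 A | |⟪h', f⟫| ≤ M * ‖f‖} :=
      isClosed_le (by fun_prop) (by fun_prop)
    refine closure_minimal (s := (testSubmodule A : Set (L2 A))) ?_ hcl hf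
    rintro f ⟨φ, hφ, hfφ⟩
    have e1 : ⟪h', f⟫ = ∫ x, h x * φ x := by
      rw [L2.inner_def, ← setIntegral_eq_integral_of_forall_compl_eq_zero (s := A)
        (f := fun x => h x * φ x) (fun x hx => by rw [hφ.eq_zero hx, mul_zero])]
      refine integral_congr_ae ?_
      filter_upwards [MemLp.coeFn_toLp hhA, hfφ] with x h1 h2
      rw [h1, h2, RCLike.inner_apply]
      simp [mul_comm]
    rw [mem_ofPred_eq, e1, Lp.norm_def, eLpNorm_congr_ae hfφ]
    exact hbd φ hφ
  have h1 := key h'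
  rw [real_inner_self_eq_norm_sq, abs_of_nonneg (by positivity)] at h1
  have h2 : ‖h'‖ ≤ M := by
    rcases (norm_nonneg h').eq_or_lt with h0 | h0
    · rw [← h0]; exact hM
    · nlinarith
  rw [← eLpNorm_two_sq, ← Lp.enorm_toLp (hf := hhA), enorm_norm_sq]
  exact ENNReal.ofReal_le_ofReal (by gcongr)

/-- Integrability for Fubini's theorem in the translation estimate: for t in (0,1] the translates of
w are supported in one common ball, on which u is integrable. -/
theorem integrable_mul_translate {d : ℕ} {u : E d → ℝ} (hu : MemLp u 2 volume) {w : E d → ℝ}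
    (hw : Continuous w) (hc : HasCompactSupport w) (e : E d) :
    Integrable (Function.uncurry fun (t : ℝ) (x : E d) => u x * w (x - t • e))
      ((volume.restrict (uIoc 0 1)).prod volume) := by
  obtain ⟨M, hM⟩ := hw.bounded_above_of_compact_support hc
  obtain ⟨r, hr⟩ := hc.isCompact.isBounded.subset_closedBall (0 : E d)
  set B := Metric.closedBall (0 : E d) (r + ‖e‖)
  have : IsFiniteMeasure ((volume : Measure (E d)).restrict B) :=
    ⟨by simpa using measure_closedBall_lt_top⟩
  have : IsFiniteMeasure ((volume : Measure ℝ).restrict (uIoc 0 1)) :=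
    ⟨by simp [uIoc_of_le]⟩
  have hB : IntegrableOn u B volume :=
    ((hu.restrict B).integrable one_le_two : Integrable u (volume.restrict B))
  have h1 : Integrable (B.indicator u) volume := hB.integrable_indicator measurableSet_closedBall
  have h2 := (h1.norm.const_mul M).comp_snd ((volume : Measure ℝ).restrict (uIoc 0 1))
  refine h2.mono' ?_ ?_
  · refine AEStronglyMeasurable.mul (hu.1.comp_snd) ?_
    exact Continuous.aestronglyMeasurable (by fun_prop)
  · have h3 : ∀ᵐ p ∂((volume : Measure ℝ).restrict (uIoc 0 1)).prod (volume : Measure (E d)),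
        p ∈ (uIoc (0 : ℝ) 1) ×ˢ (univ : Set (E d)) := by
      rw [← Measure.restrict_univ (μ := (volume : Measure (E d))), Measure.prod_restrict]
      exact ae_restrict_mem (measurableSet_uIoc.prod MeasurableSet.univ)
    filter_upwards [h3] with p hp
    obtain ⟨t, x⟩ := p
    have ht : t ∈ uIoc (0 : ℝ) 1 := hp.1
    rw [uIoc_of_le zero_le_one] at ht
    simp only [Function.uncurry_apply_pair, norm_mul]
    by_cases hx : x - t • e ∈ tsupport w
    · have hxB : x ∈ B := by
        have h4 := hr hx
        rw [mem_closedBall_zero_iff] at h4 ⊢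
        have h5 : ‖t • e‖ ≤ ‖e‖ := by
          rw [norm_smul, Real.norm_of_nonneg ht.1.le]
          exact mul_le_of_le_one_left (norm_nonneg _) ht.2
        calc ‖x‖ = ‖(x - t • e) + t • e‖ := by rw [sub_add_cancel]
          _ ≤ _ := (norm_add_le _ _).trans (add_le_add h4 h5)
      rw [indicator_of_mem hxB, mul_comm]
      gcongr
      exact hM _
    · rw [image_eq_zero_of_notMem_tsupport hx, norm_zero, mul_zero]
      have : 0 ≤ M := (norm_nonneg _).trans (hM 0)
      positivity

/-- If x - t e is in the support of φ, then both x - t e and x - t e + e are in O, and x lies on the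
segment between them. -/
theorem IsTest.translate {d : ℕ} {O : Set (E d)} (hO : Convex ℝ O) {e : E d} {φ : E d → ℝ}
    (hφ : IsTest (O ∩ (fun x => x + e) ⁻¹' O) φ) {t : ℝ} (ht : t ∈ Icc (0 : ℝ) 1) :
    IsTest O fun x => φ (x - t • e) := by
  refine ⟨hφ.smooth.comp (contDiff_id.sub contDiff_const),
    hφ.compact.comp_homeomorph (Homeomorph.subRight (t • e)), ?_⟩
  intro x hx
  have h1 : x - t • e ∈ tsupport φ := tsupport_comp_subset_preimage φ
    (f := fun x => x - t • e) (by fun_prop) hx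
  obtain ⟨h2, h3⟩ := hφ.support h1
  have := hO.add_smul_mem h2 h3 ht
  rwa [sub_add_cancel] at this

theorem abs_integral_inner_mul_le {d : ℕ} {O : Set (E d)} {g : E d → E d} (hg : MemLp g 2 volume)
    (e : E d) {φ : E d → ℝ} (hφ : IsTest O φ) :
    |∫ x, ⟪g x, e⟫ * φ x| ≤
      ‖e‖ * (eLpNorm g 2 (volume.restrict O)).toReal * (eLpNorm φ 2 volume).toReal := by
  have hm : AEStronglyMeasurable g (volume.restrict O) := hg.1.restrict
  have hφm := (hφ.memLp 2 volume)
  have e1 : ∫ x, ⟪g x, e⟫ * φ x = ∫ x in O, ⟪g x, e⟫ * φ x :=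
    (setIntegral_eq_integral_of_forall_compl_eq_zero
      (fun x hx => by rw [hφ.eq_zero hx, mul_zero])).symm
  have h1 : ‖∫ x, ⟪g x, e⟫ * φ x‖ₑ ≤ ∫⁻ x in O, (‖e‖ₑ * ‖g x‖ₑ) * ‖φ x‖ₑ := by
    rw [e1]
    refine (enorm_integral_le_lintegral_enorm _).trans (lintegral_mono fun x => ?_)
    rw [enorm_mul]
    gcongr
    rw [← ofReal_norm, ← ofReal_norm, ← ofReal_norm, ← ENNReal.ofReal_mul (norm_nonneg _)]
    refine ENNReal.ofReal_le_ofReal ?_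
    rw [mul_comm]
    exact norm_inner_le_norm _ _
  have h2 : ‖∫ x, ⟪g x, e⟫ * φ x‖ₑ ^ 2 ≤
      (‖e‖ₑ * eLpNorm g 2 (volume.restrict O) * eLpNorm φ 2 volume) ^ 2 := by
    calc _ ≤ _ := pow_le_pow_left₀ (by positivity) h1 2
      _ ≤ _ := sq_lintegral_mul_le _ (hm.enorm.const_mul _)
        (hφ.continuous.measurable.enorm.aemeasurable)
      _ ≤ (‖e‖ₑ ^ 2 * ∫⁻ x in O, ‖g x‖ₑ ^ 2) * ∫⁻ x, ‖φ x‖ₑ ^ 2 := by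
        gcongr ?_ * ?_
        · simp_rw [mul_pow]
          rw [lintegral_const_mul' _ _ (ENNReal.pow_ne_top enorm_ne_top)]
        · exact setLIntegral_le_lintegral _ _
      _ = _ := by rw [mul_pow, mul_pow, eLpNorm_two_sq, eLpNorm_two_sq]
  have h3 := (ENNReal.pow_le_pow_left_iff two_ne_zero).1 h2
  have h4 := ENNReal.toReal_mono (ENNReal.mul_ne_top (ENNReal.mul_ne_top enorm_ne_top
    (hg.restrict O).2.ne) hφm.2.ne) h3
  rw [ENNReal.toReal_mul, ENNReal.toReal_mul, toReal_enorm, toReal_enorm] at h4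
  exact h4

/-- The `L₂`-norm of a difference is bounded by the length of the translation times the norm of
the weak gradient. -/
theorem lintegral_translate_sub_sq_le {d : ℕ} {O : Set (E d)} (hO : IsOpen O)
    (hconv : Convex ℝ O) {u : E d → ℝ} {g : E d → E d} (hu : MemLp u 2 volume)
    (hg : MemLp g 2 volume) (h : LocalWeakGrad O u g) (e : E d) :
    ∫⁻ x in O ∩ (fun x => x + e) ⁻¹' O, ‖u (x + e) - u x‖ₑ ^ 2 ≤
      ENNReal.ofReal (‖e‖ ^ 2) * ∫⁻ x in O, ‖g x‖ₑ ^ 2 := by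
  set A := O ∩ (fun x => x + e) ⁻¹' O with hAdef
  have hA : IsOpen A := hO.inter (hO.preimage (by fun_prop))
  have hue : MemLp (fun x => u (x + e)) 2 volume :=
    hu.comp_measurePreserving (measurePreserving_add_right volume e)
  set G := (eLpNorm g 2 (volume.restrict O)).toReal with hG
  have hmain := lintegral_sq_le_of_test hA (hue.sub hu) (M := ‖e‖ * G) (by positivity) ?_
  · refine hmain.trans (le_of_eq ?_)
    rw [mul_pow, ENNReal.ofReal_mul (by positivity), hG, ← ENNReal.toReal_pow,
      ENNReal.ofReal_toReal (ENNReal.pow_ne_top (hg.restrict O).2.ne), eLpNorm_two_sq]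
  intro φ hφ
  have hi1 : Integrable fun x => u (x + e) * φ x :=
    MemLp.integrable_mul hue (hφ.memLp 2 volume)
  have hi2 : Integrable fun x => u x * φ x := MemLp.integrable_mul hu (hφ.memLp 2 volume)
  have hi3 : Integrable fun x => u x * φ (x - e) := by
    have := hi1.comp_sub_right e
    simpa using this
  -- Duality: the translation is moved to the test function, whose increment is the integral of its
  -- derivative along the segment.
  have e1 : ∫ x, ((fun x => u (x + e)) - u) x * φ x = ∫ x, u x * (φ (x - e) - φ x) := by
    simp_rw [Pi.sub_apply, sub_mul, mul_sub]
    rw [integral_sub hi1 hi2, integral_sub hi3 hi2,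
      ← integral_add_right_eq_self (fun x => u x * φ (x - e)) e]
    simp
  have hderiv : ∀ x, ∫ t in (0 : ℝ)..1, -fderiv ℝ φ (x - t • e) e = φ (x - e) - φ x := by
    intro x
    have hd : ∀ t ∈ uIcc (0 : ℝ) 1,
        HasDerivAt (fun t : ℝ => φ (x - t • e)) (-fderiv ℝ φ (x - t • e) e) t := by
      intro t _
      have h1 : HasDerivAt (fun t : ℝ => x - t • e) (-e) t := by
        simpa using ((hasDerivAt_id t).smul_const e).const_sub x
      have h2 := (hφ.smooth.differentiable (by simp) (x - t • e)).hasFDerivAt.comp_hasDerivAt t h1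
      rw [map_neg] at h2
      exact h2
    have hcont : Continuous fun t : ℝ => -fderiv ℝ φ (x - t • e) e :=
      ((continuous_fderiv_test hφ.smooth e).comp (by fun_prop)).neg
    rw [intervalIntegral.integral_eq_sub_of_hasDerivAt hd (hcont.intervalIntegrable _ _)]
    simp
  have hI := integrable_mul_translate hu (w := fun x => -fderiv ℝ φ x e)
    (continuous_fderiv_test hφ.smooth e).neg ((hasCompactSupport_fderiv_test hφ.compact e).comp_left (g := Neg.neg) neg_zero) e
  have e2 : ∫ x, u x * (φ (x - e) - φ x) =
      ∫ t in (0 : ℝ)..1, ∫ x, u x * -fderiv ℝ φ (x - t • e) e := by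
    rw [intervalIntegral_integral_swap hI]
    refine integral_congr_ae (Eventually.of_forall fun x => ?_)
    simp only
    rw [← hderiv x, intervalIntegral.integral_const_mul]
  rw [e1, e2, ← Real.norm_eq_abs]
  have e3 : eLpNorm φ 2 (mu A) = eLpNorm φ 2 volume := by
    refine eLpNorm_restrict_eq_of_support_subset fun x hx => ?_
    exact hφ.support (subset_tsupport φ hx)
  refine (intervalIntegral.norm_integral_le_of_norm_le_const (C := ‖e‖ * G *
    (eLpNorm φ 2 (mu A)).toReal) fun t ht => ?_).trans (by simp)
  rw [uIoc_of_le zero_le_one] at ht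
  -- For each t the translated test function is admissible on O, so its derivative can be exchanged
  -- for the weak gradient of u.
  have ht' := hφ.translate hconv (Ioc_subset_Icc_self ht)
  have h1 := h _ ht' e
  have h2 : ∀ x, fderiv ℝ (fun x => φ (x - t • e)) x e = fderiv ℝ φ (x - t • e) e := fun x => by
    simp_rw [sub_eq_add_neg]
    rw [fderiv_comp_add_right]
  simp_rw [h2] at h1
  simp_rw [mul_neg]
  rw [integral_neg, h1, neg_neg, e3]
  refine (abs_integral_inner_mul_le hg e ht').trans (le_of_eq ?_)
  congr 2
  exact eLpNorm_comp_measurePreserving (g := φ) hφ.continuous.aestronglyMeasurable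
    (measurePreserving_sub_right volume (t • e))

/-- Poincaré's inequality in the form of a bound on differences. -/
theorem poincare_pair {d : ℕ} {O : Set (E d)} (hO : IsOpen O)
    (hconv : Convex ℝ O) {u : E d → ℝ} {g : E d → E d} (hum : Measurable u)
    (hu : MemLp u 2 volume) (hg : MemLp g 2 volume) (h : LocalWeakGrad O u g)
    {X Y : Set (E d)} (hX : MeasurableSet X) (hY : MeasurableSet Y) (hXO : X ⊆ O) (hYO : Y ⊆ O)
    {ρ : ℝ} (hρ : 0 ≤ ρ) (hdist : ∀ x ∈ X, ∀ y ∈ Y, dist x y ≤ ρ) :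
    ∫⁻ x in X, ∫⁻ y in Y, ‖u x - u y‖ₑ ^ 2 ≤
      ENNReal.ofReal (ρ ^ (d + 2) * ballVol d) * ∫⁻ x in O, ‖g x‖ₑ ^ 2 := by
  -- In the variables x and e = y - x, the integral over x is controlled by the translation
  -- estimate, and only e in the ball of radius ρ occur: ρ² from the estimate and ρ ^ d from the
  -- volume of the ball.
  set F : E d → E d → ℝ≥0∞ := fun x e =>
    X.indicator (fun x => Y.indicator (fun _ => ‖u (x + e) - u x‖ₑ ^ 2) (x + e)) x with hF
  have e1 : ∫⁻ x in X, ∫⁻ y in Y, ‖u x - u y‖ₑ ^ 2 = ∫⁻ x, ∫⁻ e, F x e := by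
    rw [← lintegral_indicator hX]
    refine lintegral_congr fun x => ?_
    by_cases hx : x ∈ X
    · rw [indicator_of_mem hx, ← lintegral_indicator hY, ← lintegral_add_left_eq_self _ x]
      refine lintegral_congr fun e => ?_
      rw [hF]
      simp only [indicator_of_mem hx]
      by_cases hy : x + e ∈ Y
      · rw [indicator_of_mem hy, indicator_of_mem hy, ← enorm_neg, neg_sub]
      · rw [indicator_of_notMem hy, indicator_of_notMem hy]
    · rw [indicator_of_notMem hx, hF]
      simp only [indicator_of_notMem hx, lintegral_zero]
  have hFm : Measurable (Function.uncurry F) := by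
    have h1 : Function.uncurry F = ({p : E d × E d | p.1 ∈ X} ∩ {p | p.1 + p.2 ∈ Y}).indicator
        (fun p => ‖u (p.1 + p.2) - u p.1‖ₑ ^ 2) := by
      ext ⟨x, e⟩
      simp only [Function.uncurry_apply_pair, hF, indicator]
      by_cases hx : x ∈ X <;> by_cases hy : x + e ∈ Y <;> simp [hx, hy]
    rw [h1]
    refine Measurable.indicator ?_ ((measurable_fst hX).inter
      ((measurable_fst.add measurable_snd) hY))
    exact (((hum.comp (measurable_fst.add measurable_snd)).sub
      (hum.comp measurable_fst)).enorm).pow_const 2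
  rw [e1, lintegral_lintegral_swap hFm.aemeasurable]
  set K := ∫⁻ x in O, ‖g x‖ₑ ^ 2
  have h2 : ∀ e, ∫⁻ x, F x e ≤
      (Metric.closedBall (0 : E d) ρ).indicator (fun _ => ENNReal.ofReal (ρ ^ 2) * K) e := by
    intro e
    by_cases he : e ∈ Metric.closedBall (0 : E d) ρ
    · rw [indicator_of_mem he]
      have hA : MeasurableSet (O ∩ (fun x => x + e) ⁻¹' O) :=
        (hO.inter (hO.preimage (by fun_prop))).measurableSet
      calc ∫⁻ x, F x e ≤ ∫⁻ x in O ∩ (fun x => x + e) ⁻¹' O, ‖u (x + e) - u x‖ₑ ^ 2 := by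
            rw [← lintegral_indicator hA]
            refine lintegral_mono fun x => ?_
            rw [hF]
            by_cases hx : x ∈ X
            · by_cases hy : x + e ∈ Y
              · have : x ∈ O ∩ (fun x => x + e) ⁻¹' O := ⟨hXO hx, hYO hy⟩
                simp only [indicator_of_mem hx, indicator_of_mem hy, indicator_of_mem this, le_refl]
              · simp [indicator_of_notMem hy, indicator_of_mem hx]
            · simp [indicator_of_notMem hx]
        _ ≤ ENNReal.ofReal (‖e‖ ^ 2) * K := lintegral_translate_sub_sq_le hO hconv hu hg h e
        _ ≤ _ := by
          gcongr
          exact mem_closedBall_zero_iff.1 he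
    · rw [indicator_of_notMem he, nonpos_iff_eq_zero, ← lintegral_zero (α := E d) (μ := volume)]
      refine lintegral_congr fun x => ?_
      rw [hF]
      by_cases hx : x ∈ X
      · have hy : x + e ∉ Y := fun hy => he (by
          have := hdist x hx _ hy
          rw [dist_comm, dist_eq_norm, add_sub_cancel_left] at this
          exact mem_closedBall_zero_iff.2 this)
        simp [indicator_of_notMem hy]
      · simp [indicator_of_notMem hx]
  calc _ ≤ _ := lintegral_mono h2
    _ = ENNReal.ofReal (ρ ^ 2) * K * ENNReal.ofReal (ρ ^ d * ballVol d) := by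
      rw [lintegral_indicator_const measurableSet_closedBall, volume_closedBall _ hρ]
    _ = _ := by
      have := ballVol_pos d
      rw [mul_comm, ← mul_assoc, ← ENNReal.ofReal_mul (by positivity)]
      congr 2
      ring

theorem enorm_sub_sq_le_three (a b x y : ℝ) :
    ‖a - b‖ₑ ^ 2 ≤ 3 * (‖x - a‖ₑ ^ 2 + ‖x - y‖ₑ ^ 2 + ‖y - b‖ₑ ^ 2) := by
  rw [enorm_sq, enorm_sq, enorm_sq, enorm_sq, ← ENNReal.ofReal_add (by positivity) (by positivity),
    ← ENNReal.ofReal_add (by positivity) (by positivity), ← ENNReal.ofReal_ofNat 3,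
    ← ENNReal.ofReal_mul (by positivity)]
  refine ENNReal.ofReal_le_ofReal ?_
  nlinarith [sq_nonneg ((a - x) - (x - y)), sq_nonneg ((a - x) - (y - b)),
    sq_nonneg ((x - y) - (y - b))]

/-- Two constants that approximate a function on two sets are close if the function differs little
between the sets. -/
theorem volume_mul_enorm_sub_sq_le {d : ℕ} {u : E d → ℝ} (hum : Measurable u) (X Y : Set (E d))
    (a b : ℝ) :
    volume X * volume Y * ‖a - b‖ₑ ^ 2 ≤ 3 * (volume Y * (∫⁻ x in X, ‖u x - a‖ₑ ^ 2) +
      (∫⁻ x in X, ∫⁻ y in Y, ‖u x - u y‖ₑ ^ 2) + volume X * ∫⁻ y in Y, ‖u y - b‖ₑ ^ 2) := by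
  have hm1 : ∀ c : ℝ, Measurable fun x => ‖u x - c‖ₑ ^ 2 := fun c =>
    ((hum.sub_const c).enorm).pow_const 2
  have hm2 : Measurable (Function.uncurry fun x y => ‖u x - u y‖ₑ ^ 2) :=
    (((hum.comp measurable_fst).sub (hum.comp measurable_snd)).enorm).pow_const 2
  have hm3 : ∀ x, Measurable fun y => ‖u x - u y‖ₑ ^ 2 := fun x =>
    ((hum.const_sub (u x)).enorm).pow_const 2
  calc volume X * volume Y * ‖a - b‖ₑ ^ 2 = ∫⁻ _ in X, ∫⁻ _ in Y, ‖a - b‖ₑ ^ 2 := by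
        rw [setLIntegral_const, setLIntegral_const]; ring
    _ ≤ ∫⁻ x in X, ∫⁻ y in Y, 3 * (‖u x - a‖ₑ ^ 2 + ‖u x - u y‖ₑ ^ 2 + ‖u y - b‖ₑ ^ 2) :=
        lintegral_mono fun x => lintegral_mono fun y => enorm_sub_sq_le_three _ _ _ _
    _ = 3 * ∫⁻ x in X, ((‖u x - a‖ₑ ^ 2 * volume Y + ∫⁻ y in Y, ‖u x - u y‖ₑ ^ 2) +
          ∫⁻ y in Y, ‖u y - b‖ₑ ^ 2) := by
        rw [← lintegral_const_mul' _ _ (by simp)]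
        refine lintegral_congr fun x => ?_
        rw [lintegral_const_mul' _ _ (by simp), lintegral_add_right _ (hm1 b),
          lintegral_add_right _ (hm3 x), setLIntegral_const]
    _ = _ := by
        rw [lintegral_add_right _ measurable_const, lintegral_add_left ((hm1 a).mul_const _),
          lintegral_mul_const _ (hm1 a), setLIntegral_const]
        ring

/-- Some constant approximates a function as well as the mean difference permits. -/
theorem exists_lintegral_sub_sq_le {d : ℕ} {u : E d → ℝ} (hum : Measurable u) {X : Set (E d)}
    (hX0 : volume X ≠ 0) (hXt : volume X ≠ ⊤) :
    ∃ c : ℝ, volume X * ∫⁻ x in X, ‖u x - c‖ₑ ^ 2 ≤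
      ∫⁻ x in X, ∫⁻ y in X, ‖u x - u y‖ₑ ^ 2 := by
  have hm2 : Measurable (Function.uncurry fun x y => ‖u y - u x‖ₑ ^ 2) :=
    (((hum.comp measurable_snd).sub (hum.comp measurable_fst)).enorm).pow_const 2
  have : IsFiniteMeasure (volume.restrict X) := ⟨by simpa using hXt.lt_top⟩
  have : NeZero (volume.restrict X) := ⟨by simpa using hX0⟩
  -- The constant is a value of u itself, at a point where the inner integral does not exceed its
  -- average.
  obtain ⟨y, hy⟩ := exists_le_laverage (μ := volume.restrict X)
    (f := fun x => ∫⁻ y in X, ‖u y - u x‖ₑ ^ 2) (NeZero.ne _) hm2.lintegral_prod_right'.aemeasurable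
  refine ⟨u y, ?_⟩
  calc _ ≤ volume X * ⨍⁻ x in X, (∫⁻ y in X, ‖u y - u x‖ₑ ^ 2) ∂volume := by gcongr
    _ = _ := by
      rw [measure_mul_setLAverage _ hXt]
      refine lintegral_congr fun x => lintegral_congr fun y => ?_
      rw [← enorm_neg, neg_sub]

end OpPrec

namespace OpPrec

/-! ### Faces of simplices -/

/-- `f` is the face of the simplex `T` opposite to the vertex `a`. -/
structure IsFace {d : ℕ} (T f : Finset (E d)) (a : E d) : Prop where
  simplex : IsSimplex T
  card : f.card = d
  subset : f ⊆ T
  apex_mem : a ∈ T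
  apex_notMem : a ∉ f
  eq_or_mem : ∀ v ∈ T, v = a ∨ v ∈ f

theorem exists_isFace {d : ℕ} {T f : Finset (E d)} (hT : IsSimplex T) (hf : f ⊆ T)
    (hcard : f.card = d) : ∃ a, IsFace T f a := by
  classical
  have h1 : (T \ f).card = 1 := by
    rw [Finset.card_sdiff_of_subset hf, hT.1, hcard]; omega
  obtain ⟨a, ha⟩ := Finset.card_eq_one.1 h1
  have ha' : a ∈ T \ f := by rw [ha]; exact Finset.mem_singleton_self a
  rw [Finset.mem_sdiff] at ha'
  refine ⟨a, hT, hcard, hf, ha'.1, ha'.2, fun v hv => ?_⟩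
  by_cases hvf : v ∈ f
  · exact Or.inr hvf
  · left
    have : v ∈ T \ f := Finset.mem_sdiff.2 ⟨hv, hvf⟩
    rw [ha] at this
    exact Finset.mem_singleton.1 this

theorem IsFace.sum_eq {d : ℕ} {T f : Finset (E d)} {a : E d} (h : IsFace T f a) {M : Type*}
    [AddCommMonoid M] (F : E d → M) : ∑ v ∈ T, F v = F a + ∑ v ∈ f, F v := by
  classical
  rw [← Finset.sum_insert h.apex_notMem]
  congr 1
  ext v
  rw [Finset.mem_insert]
  constructor
  · exact h.eq_or_mem v
  · rintro (rfl | hv)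
    · exact h.apex_mem
    · exact h.subset hv

theorem IsFace.bary_apex {d : ℕ} {T f : Finset (E d)} {a : E d} (h : IsFace T f a) {x : E d}
    (hx : x ∈ conv f) : bary T a x = 0 :=
  bary_eq_zero_of_mem_face h.simplex (Finset.coe_subset.2 h.subset) hx
    (by simpa using h.apex_notMem)

theorem IsFace.conv_subset {d : ℕ} {T f : Finset (E d)} {a : E d} (h : IsFace T f a) :
    conv f ⊆ conv T := convexHull_mono (Finset.coe_subset.2 h.subset)

theorem IsFace.mem_conv_of_bary {d : ℕ} {T f : Finset (E d)} {a : E d} (h : IsFace T f a)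
    {x : E d} (hx : x ∈ conv T) (h0 : bary T a x = 0) : x ∈ conv f := by
  have h1 := sum_bary h.simplex x
  have h2 := sum_bary_smul h.simplex x
  rw [h.sum_eq, h0, zero_add] at h1
  rw [h.sum_eq, h0, zero_smul, zero_add] at h2
  rw [← h2]
  exact (convex_conv f).sum_mem (fun v _ => bary_nonneg h.simplex hx v) h1
    fun v hv => mem_conv_of_mem hv

/-- The barycenter of a face. -/
def faceCenter {d : ℕ} (f : Finset (E d)) : E d := ∑ v ∈ f, (d : ℝ)⁻¹ • v

theorem faceCenter_mem {d : ℕ} (hd : 1 ≤ d) {f : Finset (E d)} (hcard : f.card = d) :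
    faceCenter f ∈ conv f := by
  have hd0 : (d : ℝ) ≠ 0 := by exact_mod_cast (by omega : d ≠ 0)
  refine (convex_conv f).sum_mem (fun v _ => by positivity) ?_ fun v hv => mem_conv_of_mem hv
  rw [Finset.sum_const, hcard, nsmul_eq_mul, mul_inv_cancel₀ hd0]

theorem IsFace.bary_faceCenter {d : ℕ} (hd : 1 ≤ d) {T f : Finset (E d)} {a : E d}
    (h : IsFace T f a) {v : E d} (hv : v ∈ f) : bary T v (faceCenter f) = (d : ℝ)⁻¹ := by
  have hd0 : (d : ℝ) ≠ 0 := by exact_mod_cast (by omega : d ≠ 0)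
  rw [faceCenter, affineMap_combination (w := fun _ => (d : ℝ)⁻¹)
    (by rw [Finset.sum_const, h.card, nsmul_eq_mul, mul_inv_cancel₀ hd0]), Finset.sum_eq_single v]
  · rw [bary_self h.simplex (h.subset hv), mul_one]
  · intro u hu huv
    rw [bary_ne h.simplex (h.subset hu) huv.symm, mul_zero]
  · exact fun h => absurd hv h

/-- The simplices `S` and `T` lie on different sides of their common face `f`. -/
structure IsAdjacent {d : ℕ} (S T f : Finset (E d)) (a b : E d) : Prop where
  left : IsFace S f a
  right : IsFace T f b
  inter : conv S ∩ conv T ⊆ conv f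

theorem IsAdjacent.symm {d : ℕ} {S T f : Finset (E d)} {a b : E d} (h : IsAdjacent S T f a b) :
    IsAdjacent T S f b a := ⟨h.right, h.left, by rw [inter_comm]; exact h.inter⟩

theorem IsAdjacent.bary_eq {d : ℕ} {S T f : Finset (E d)} {a b : E d} (h : IsAdjacent S T f a b)
    {x : E d} (hx : x ∈ conv f) (v : E d) : bary S v x = bary T v x := by
  have h1 : conv f ⊆ (bary S v - bary T v) ⁻¹' {0} := by
    refine convexHull_min (fun w hw => ?_)
      ((convex_singleton (𝕜 := ℝ) (0 : ℝ)).affine_preimage (bary S v - bary T v))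
    rw [mem_preimage, mem_singleton_iff, AffineMap.coe_sub, Pi.sub_apply]
    by_cases hvw : v = w
    · subst hvw
      rw [bary_self h.left.simplex (h.left.subset hw), bary_self h.right.simplex
        (h.right.subset hw), sub_self]
    · rw [bary_ne h.left.simplex (h.left.subset hw) hvw,
        bary_ne h.right.simplex (h.right.subset hw) hvw, sub_self]
  have h2 := h1 hx
  rw [mem_preimage, mem_singleton_iff, AffineMap.coe_sub, Pi.sub_apply] at h2
  linarith

/-- Otherwise a small step from the center of f towards b would stay in S as well as in T, hence in
f, although the T-coordinate of b has become positive. -/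
theorem IsAdjacent.bary_apex_neg {d : ℕ} (hd : 1 ≤ d) {S T f : Finset (E d)} {a b : E d}
    (h : IsAdjacent S T f a b) : bary S a b < 0 := by
  by_contra hneg
  rw [not_lt] at hneg
  have hd0 : 0 < (d : ℝ)⁻¹ := by
    have : 0 < (d : ℝ) := by exact_mod_cast hd
    positivity
  set m := faceCenter f
  have hm : m ∈ conv f := faceCenter_mem hd h.left.card
  have hopen : ∀ᶠ ε in 𝓝 (0 : ℝ), ∀ v ∈ f, 0 < bary S v m + ε * (bary S v b - bary S v m) := by
    rw [Filter.eventually_all_finset]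
    intro v hv
    have hc : Continuous fun ε : ℝ => bary S v m + ε * (bary S v b - bary S v m) := by fun_prop
    refine hc.continuousAt.eventually_mem (Ioi_mem_nhds ?_)
    rw [zero_mul, add_zero, h.left.bary_faceCenter hd hv]
    exact hd0
  obtain ⟨ε, h1, h2, h3⟩ : ∃ ε : ℝ, (∀ v ∈ f, 0 < bary S v m + ε * (bary S v b - bary S v m)) ∧
      0 < ε ∧ ε ≤ 1 := by
    have e1 : ∀ᶠ ε in 𝓝[>] (0 : ℝ), 0 < ε ∧ ε ≤ 1 :=
      Ioc_mem_nhdsGT zero_lt_one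
    exact ((hopen.filter_mono nhdsWithin_le_nhds).and e1).exists
  set x := AffineMap.homothety m ε b
  have hxS : x ∈ conv S := by
    rw [mem_conv_iff h.left.simplex]
    intro v hv
    rw [affineMap_homothety]
    rcases h.left.eq_or_mem v hv with rfl | hvf
    · rw [h.left.bary_apex hm, zero_add, sub_zero]
      positivity
    · exact (h1 v hvf).le
  have hxT : x ∈ conv T := by
    rw [mem_conv_iff h.right.simplex]
    intro v hv
    rw [affineMap_homothety]
    have e1 := bary_nonneg h.right.simplex (h.right.conv_subset hm) v
    have e2 := bary_nonneg h.right.simplex (mem_conv_of_mem h.right.apex_mem) v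
    nlinarith
  have h4 := h.right.bary_apex (h.inter ⟨hxS, hxT⟩)
  rw [affineMap_homothety, h.right.bary_apex hm, bary_self h.right.simplex h.right.apex_mem] at h4
  linarith

/-- The open cone of the points that see the face `f` of `T` from either side. -/
def faceCone {d : ℕ} (T f : Finset (E d)) : Set (E d) := {x | ∀ v ∈ f, 0 < bary T v x}

theorem isOpen_faceCone {d : ℕ} (T f : Finset (E d)) : IsOpen (faceCone T f) := by
  have : faceCone T f = ⋂ v ∈ f, (bary T v) ⁻¹' Ioi 0 := by
    ext x; simp [faceCone]
  rw [this]
  exact isOpen_biInter_finset fun v _ => isOpen_Ioi.preimage (continuous_affineMap _)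

theorem convex_faceCone {d : ℕ} (T f : Finset (E d)) : Convex ℝ (faceCone T f) := by
  have : faceCone T f = ⋂ v ∈ f, (bary T v) ⁻¹' Ioi 0 := by
    ext x; simp [faceCone]
  rw [this]
  exact convex_iInter₂ fun v _ => (convex_Ioi (0 : ℝ)).affine_preimage _

/-- The S-coordinate of a vanishes on f, so it is the T-coordinate of b times the negative number
`bary S a b`; the two are never negative simultaneously. The union of two neighbouring cells need
not be convex; the intersection of the cones supplies an open convex set around the relative
interior of the common face. -/
theorem IsAdjacent.faceCone_inter_subset {d : ℕ} (hd : 1 ≤ d) {S T f : Finset (E d)} {a b : E d}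
    (h : IsAdjacent S T f a b) : faceCone S f ∩ faceCone T f ⊆ conv S ∪ conv T := by
  rintro x ⟨hxS, hxT⟩
  have h1 : bary S a x = bary T b x * bary S a b := by
    rw [affineMap_eq_sum_bary h.right.simplex (bary S a) x, h.right.sum_eq, Finset.sum_eq_zero,
      add_zero]
    intro v hv
    rw [bary_ne h.left.simplex (h.left.subset hv) (by rintro rfl; exact h.left.apex_notMem hv), mul_zero]
  have h2 := h.bary_apex_neg hd
  by_cases h3 : 0 ≤ bary S a x
  · left
    rw [mem_conv_iff h.left.simplex]
    intro v hv
    rcases h.left.eq_or_mem v hv with rfl | hvf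
    · exact h3
    · exact (hxS v hvf).le
  · right
    rw [mem_conv_iff h.right.simplex]
    intro v hv
    rcases h.right.eq_or_mem v hv with rfl | hvf
    · by_contra h4
      rw [not_le] at h3 h4
      nlinarith
    · exact (hxT v hvf).le

/-- The copy of the interior of `T` that is scaled with the factor `δ` about `m`. -/
def scaledCell {d : ℕ} (T : Finset (E d)) (m : E d) (δ : ℝ) : Set (E d) :=
  AffineMap.homothety m δ '' interior (conv T)

theorem volume_scaledCell {d : ℕ} (T : Finset (E d)) (m : E d) (δ : ℝ) :
    volume (scaledCell T m δ) = ENNReal.ofReal (|δ| ^ d * vol T) := by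
  rw [scaledCell, Measure.addHaar_image_homothety, finrank_euclideanSpace_fin, abs_pow,
    volume_interior_conv, ENNReal.ofReal_mul (by positivity), ofReal_vol]

theorem measurableSet_scaledCell {d : ℕ} (T : Finset (E d)) (m : E d) {δ : ℝ} (hδ : δ ≠ 0) :
    MeasurableSet (scaledCell T m δ) :=
  (AffineMap.homothety_isOpenMap m δ hδ _ isOpen_interior).measurableSet

theorem scaledCell_subset_interior {d : ℕ} {T : Finset (E d)} (hT : IsSimplex T) {m : E d}
    (hm : m ∈ conv T) {δ : ℝ} (hδ : 0 < δ) (hδ1 : δ ≤ 1) :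
    scaledCell T m δ ⊆ interior (conv T) := by
  rintro _ ⟨z, hz, rfl⟩
  rw [mem_interior_conv_iff hT] at hz ⊢
  intro v hv
  rw [affineMap_homothety]
  have h1 := bary_nonneg hT hm v
  have h2 := hz v hv
  have h3 : 0 ≤ (1 - δ) * bary T v m := mul_nonneg (by linarith) h1
  have h4 : 0 < δ * bary T v z := mul_pos hδ h2
  linarith

theorem IsFace.scaledCell_subset_faceCone {d : ℕ} {T f : Finset (E d)} {a : E d}
    (h : IsFace T f a) {m : E d} (hm : m ∈ conv T) {δ : ℝ} (hδ : 0 < δ) (hδ1 : δ ≤ 1) :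
    scaledCell T m δ ⊆ faceCone T f := fun _ hx v hv =>
  (mem_interior_conv_iff h.simplex).1 (scaledCell_subset_interior h.simplex hm hδ hδ1 hx) v
    (h.subset hv)

/-- Used for a cell on the other side of the face and, with negative δ, for the reflection of a cell
through m: the coordinates are positive at m and change little on a small copy. -/
theorem scaledCell_subset_faceCone {d : ℕ} {S T f : Finset (E d)} {m : E d} {δ M : ℝ}
    (hM : ∀ v ∈ f, ∀ z ∈ conv S, |bary T v z - bary T v m| ≤ M)
    (hδM : ∀ v ∈ f, |δ| * M < bary T v m) : scaledCell S m δ ⊆ faceCone T f := by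
  rintro _ ⟨z, hz, rfl⟩ v hv
  rw [affineMap_homothety]
  have h1 : |δ * (bary T v z - bary T v m)| ≤ |δ| * M := by
    rw [abs_mul]
    gcongr
    exact hM v hv z (interior_subset hz)
  have h2 := hδM v hv
  have h3 := neg_abs_le (δ * (bary T v z - bary T v m))
  linarith

theorem dist_homothety_self {d : ℕ} (m z : E d) (δ : ℝ) :
    dist (AffineMap.homothety m δ z) m = |δ| * dist z m := by
  rw [AffineMap.homothety_apply, vsub_eq_sub, vadd_eq_add, dist_eq_norm, add_sub_cancel_right,
    norm_smul, Real.norm_eq_abs, dist_eq_norm]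

theorem dist_scaledCell_le {d : ℕ} {T : Finset (E d)} {m : E d} (hm : m ∈ conv T) {δ : ℝ}
    {x : E d} (hx : x ∈ scaledCell T m δ) : dist x m ≤ |δ| * cellDiam T := by
  obtain ⟨z, hz, rfl⟩ := hx
  rw [dist_homothety_self]
  gcongr
  exact dist_le_cellDiam (interior_subset hz) hm

/-! ### Meshes -/

namespace Mesh

variable {d : ℕ} {Ω : Set (E d)} (𝒯 : Mesh Ω)

theorem isSimplex {T : Finset (E d)} (hT : T ∈ 𝒯.cells) : IsSimplex T :=
  ⟨𝒯.card_eq T hT, 𝒯.indep T hT⟩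

theorem conv_subset_closure {T : Finset (E d)} (hT : T ∈ 𝒯.cells) : conv T ⊆ closure Ω := by
  rw [← 𝒯.union_eq]
  exact subset_biUnion_of_mem (u := fun T => conv T) hT

theorem interior_conv_subset (hΩ : interior (closure Ω) = Ω) {T : Finset (E d)}
    (hT : T ∈ 𝒯.cells) : interior (conv T) ⊆ Ω := by
  rw [← hΩ]
  exact interior_mono (𝒯.conv_subset_closure hT)

theorem exists_mem_conv {x : E d} (hx : x ∈ closure Ω) : ∃ T ∈ 𝒯.cells, x ∈ conv T := by
  rw [← 𝒯.union_eq] at hx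
  simpa using hx

/-- A common point lies in the hull of the common vertices. There, coordinates of other vertices
vanish, and the two affine coordinates of a common vertex agree because they agree at all common
vertices. -/
theorem bary_eq_of_mem {S T : Finset (E d)} (hS : S ∈ 𝒯.cells) (hT : T ∈ 𝒯.cells) {x : E d}
    (hxS : x ∈ conv S) (hxT : x ∈ conv T) (v : E d) : bary S v x = bary T v x := by
  have hx := 𝒯.conforming S hS T hT ⟨hxS, hxT⟩
  have hSs := 𝒯.isSimplex hS
  have hTs := 𝒯.isSimplex hT
  by_cases hv : v ∈ (S ∩ T : Set (E d))
  · have h1 : convexHull ℝ (S ∩ T : Set (E d)) ⊆ (bary S v - bary T v) ⁻¹' {0} := by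
      refine convexHull_min (fun w hw => ?_)
        ((convex_singleton (𝕜 := ℝ) (0 : ℝ)).affine_preimage (bary S v - bary T v))
      rw [mem_preimage, mem_singleton_iff, AffineMap.coe_sub, Pi.sub_apply]
      by_cases hvw : v = w
      · subst hvw
        rw [bary_self hSs hw.1, bary_self hTs hw.2, sub_self]
      · rw [bary_ne hSs hw.1 hvw, bary_ne hTs hw.2 hvw, sub_self]
    have h2 := h1 hx
    rw [mem_preimage, mem_singleton_iff, AffineMap.coe_sub, Pi.sub_apply] at h2
    linarith
  · rw [bary_eq_zero_of_mem_face hSs inter_subset_left hx hv,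
      bary_eq_zero_of_mem_face hTs inter_subset_right hx hv]

/-- By conformity the cell that was chosen in the definition of `hat` does not matter. -/
theorem hat_eq_bary {T : Finset (E d)} (hT : T ∈ 𝒯.cells) {x : E d} (hx : x ∈ conv T) (ν : E d) :
    𝒯.hat ν x = bary T ν x := by
  have hTs := 𝒯.isSimplex hT
  have hex : ∃ w, 𝒯.IsBarycentric x w := by
    refine ⟨fun v => bary T v x, T, hT, bary_nonneg hTs hx, fun v hv => ?_, sum_bary hTs x,
      sum_bary_smul hTs x⟩
    simp only [bary_of_notMem hv]; rfl
  rw [hat, dif_pos hex]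
  obtain ⟨S, hS, h0, hout, hsum, hx'⟩ := hex.choose_spec
  have hSs := 𝒯.isSimplex hS
  have hb : ∀ v, bary S v x = hex.choose v := fun v => by
    by_cases hv : v ∈ S
    · exact bary_unique hSs hsum hx' hv
    · rw [bary_of_notMem hv, hout v hv]; rfl
  rw [← hb]
  exact 𝒯.bary_eq_of_mem hS hT ((mem_conv_iff hSs).2 fun v _ => by rw [hb]; exact h0 v) hx ν

theorem mem_of_mem_conv {S T : Finset (E d)} (hS : S ∈ 𝒯.cells) (hT : T ∈ 𝒯.cells) {ν : E d}
    (hν : ν ∈ S) (h : ν ∈ conv T) : ν ∈ T := by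
  by_contra hνT
  have h1 := 𝒯.bary_eq_of_mem hS hT (mem_conv_of_mem hν) h ν
  rw [bary_self (𝒯.isSimplex hS) hν, bary_of_notMem hνT] at h1
  exact one_ne_zero h1

theorem disjoint_interior {S T : Finset (E d)} (hS : S ∈ 𝒯.cells) (hT : T ∈ 𝒯.cells)
    (hne : S ≠ T) : Disjoint (interior (conv S)) (interior (conv T)) := by
  refine Set.disjoint_left.2 fun x hxS hxT => ?_
  obtain ⟨v, hv, hvT⟩ : ∃ v ∈ S, v ∉ T := by
    by_contra h
    push Not at h
    exact hne (Finset.eq_of_subset_of_card_le h (by rw [𝒯.card_eq S hS, 𝒯.card_eq T hT]))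
  have h1 := 𝒯.bary_eq_of_mem hS hT (interior_subset hxS) (interior_subset hxT) v
  have h2 := (mem_interior_conv_iff (𝒯.isSimplex hS)).1 hxS v hv
  rw [h1, bary_of_notMem hvT] at h2
  exact lt_irrefl _ h2

theorem ae_eq_biUnion (hΩ : interior (closure Ω) = Ω) :
    (Ω : Set (E d)) =ᵐ[volume] ⋃ T ∈ 𝒯.cells, interior (conv T) := by
  have h1 : (⋃ T ∈ 𝒯.cells, interior (conv T)) ⊆ Ω :=
    iUnion₂_subset fun T hT => 𝒯.interior_conv_subset hΩ hT
  refine EventuallyLE.antisymm ?_ h1.eventuallyLE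
  have h2 : volume (⋃ T ∈ 𝒯.cells, frontier (conv T)) = 0 := by
    exact (measure_biUnion_null_iff 𝒯.cells.countable_toSet).2
      fun T _ => (convex_conv T).addHaar_frontier volume
  have h3 : ∀ᵐ x ∂(volume : Measure (E d)), x ∉ ⋃ T ∈ 𝒯.cells, frontier (conv T) :=
    measure_eq_zero_iff_ae_notMem.1 h2
  filter_upwards [h3] with x hx hxΩ
  obtain ⟨T, hT, hxT⟩ := 𝒯.exists_mem_conv (subset_closure hxΩ)
  refine mem_biUnion hT ?_
  by_contra hint
  refine hx (mem_biUnion hT ⟨subset_closure hxT, hint⟩)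

theorem ae_mem_cells (hΩo : IsOpen Ω) (hΩ : interior (closure Ω) = Ω) :
    ∀ᵐ x ∂(mu Ω), ∃ T ∈ 𝒯.cells, x ∈ interior (conv T) := by
  rw [ae_restrict_iff' hΩo.measurableSet]
  filter_upwards [𝒯.ae_eq_biUnion hΩ] with x hx hxΩ
  have h1 : x ∈ ⋃ T ∈ 𝒯.cells, interior (conv T) := by
    have : Ω x = (⋃ T ∈ 𝒯.cells, interior (conv T)) x := hx
    exact this.mp hxΩ
  simpa using h1

theorem lintegral_eq_sum (hΩ : interior (closure Ω) = Ω) (F : E d → ℝ≥0∞) :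
    ∫⁻ x in Ω, F x = ∑ T ∈ 𝒯.cells, ∫⁻ x in interior (conv T), F x := by
  rw [setLIntegral_congr (𝒯.ae_eq_biUnion hΩ)]
  exact lintegral_biUnion_finset (fun S hS T hT hne => 𝒯.disjoint_interior hS hT hne)
    (fun T _ => isOpen_interior.measurableSet) F

end Mesh

end OpPrec

namespace OpPrec

theorem vol_pos_sigma {d : ℕ} (hd : 1 ≤ d) {T : Finset (E d)} (hT : IsSimplex T) {σ : ℝ}
    (hσ : cellDiam T ^ d ≤ σ * vol T) : 0 < σ := by
  have hD := cellDiam_pos hd hT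
  have hV := vol_pos hT
  by_contra h
  have : σ * vol T ≤ 0 := mul_nonpos_of_nonpos_of_nonneg (not_lt.1 h) hV.le
  have : 0 < cellDiam T ^ d := by positivity
  linarith

namespace Mesh

variable {d : ℕ} {Ω : Set (E d)} (𝒯 : Mesh Ω)

/-! ### Stars of vertices -/

open Classical in
/-- The simplices with vertex `ν`. -/
def star (ν : E d) : Finset (Finset (E d)) := {T ∈ 𝒯.cells | ν ∈ T}

theorem mem_star {ν : E d} {T : Finset (E d)} : T ∈ 𝒯.star ν ↔ T ∈ 𝒯.cells ∧ ν ∈ T := by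
  rw [star, Finset.mem_filter]

theorem exists_isAdjacent {S T : Finset (E d)} (hS : S ∈ 𝒯.cells) (hT : T ∈ 𝒯.cells)
    (h : (S ∩ T : Set (E d)).ncard = d) :
    ∃ f a b, IsAdjacent S T f a b ∧ ∀ v, v ∈ f ↔ v ∈ S ∧ v ∈ T := by
  classical
  have hf : ((S ∩ T : Finset (E d)) : Set (E d)) = (S ∩ T : Set (E d)) := Finset.coe_inter S T
  have hc : (S ∩ T : Finset (E d)).card = d := by
    rw [← Set.ncard_coe_finset, hf, h]
  obtain ⟨a, ha⟩ := exists_isFace (𝒯.isSimplex hS) Finset.inter_subset_left hc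
  obtain ⟨b, hb⟩ := exists_isFace (𝒯.isSimplex hT) Finset.inter_subset_right hc
  refine ⟨S ∩ T, a, b, ⟨ha, hb, ?_⟩, fun v => Finset.mem_inter⟩
  rw [conv, conv, conv, hf]
  exact 𝒯.conforming S hS T hT

/-- In the graph of the cells around ν, joined if they share a (d-1)-face, a path visits no cell
twice, so it has fewer than N edges. This carries neighbour estimates for diameters, nodal values
and approximating constants to the whole star. -/
theorem star_abs_sub_le {ν : E d} {N : ℕ} (hN : (𝒯.star ν).card ≤ N) {F : Finset (E d) → ℝ}
    {β : ℝ} (hβ : 0 ≤ β) (hF : ∀ A ∈ 𝒯.star ν, ∀ B ∈ 𝒯.star ν, (A ∩ B : Set (E d)).ncard = d →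
      |F A - F B| ≤ β) {S T : Finset (E d)} (hS : S ∈ 𝒯.star ν) (hT : T ∈ 𝒯.star ν) :
    |F S - F T| ≤ N * β := by
  let G : SimpleGraph (𝒯.star ν) :=
    { Adj := fun A B => ((A : Finset (E d)) ∩ (B : Finset (E d)) : Set (E d)).ncard = d
      symm := ⟨fun A B h => by rw [inter_comm]; exact h⟩
      loopless := ⟨fun A h => by
        rw [inter_self, Set.ncard_coe_finset, 𝒯.card_eq _ (𝒯.mem_star.1 A.2).1] at h
        omega⟩ }
  have hreach : ∀ hT : T ∈ 𝒯.star ν, G.Reachable ⟨S, hS⟩ ⟨T, hT⟩ := by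
    have hchain := 𝒯.star_connected ν S (𝒯.mem_star.1 hS).1 T (𝒯.mem_star.1 hT).1
      (𝒯.mem_star.1 hS).2 (𝒯.mem_star.1 hT).2
    clear hT
    induction hchain with
    | refl => exact fun _ => SimpleGraph.Reachable.refl _
    | tail _ hbc ih =>
      intro hC
      have hB := 𝒯.mem_star.2 ⟨hbc.1, hbc.2.2.1⟩
      exact (ih hB).trans (SimpleGraph.Adj.reachable (G := G) hbc.2.2.2.2)
  have hwalk : ∀ (A B : 𝒯.star ν) (p : G.Walk A B), |F A - F B| ≤ p.length * β := by
    intro A B p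
    induction p with
    | nil => simp
    | cons h p ih =>
      rename_i A B C
      have h1 := hF A A.2 B B.2 h
      rw [SimpleGraph.Walk.length_cons]
      push_cast
      calc |F A - F C| = |(F A - F B) + (F B - F C)| := by ring_nf
        _ ≤ |F A - F B| + |F B - F C| := abs_add_le _ _
        _ ≤ β + p.length * β := add_le_add h1 ih
        _ = _ := by ring
  obtain ⟨p⟩ := hreach hT
  classical
  have hlen := p.toPath.2.length_lt
  rw [Fintype.card_coe] at hlen
  refine (hwalk _ _ p.toPath.1).trans ?_
  gcongr
  omega

/-- The quantitative properties of a shape regular partition. -/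
structure Regular (σ κ : ℝ) (N : ℕ) : Prop where
  shape : ∀ T ∈ 𝒯.cells, cellDiam T ^ d ≤ σ * vol T
  comparable : ∀ ν, ∀ S ∈ 𝒯.star ν, ∀ T ∈ 𝒯.star ν, cellDiam S ≤ κ * cellDiam T
  valence : ∀ ν, (𝒯.star ν).card ≤ N

/-- Scaled about ν to diameter one, the cells around ν lie in the unit ball, have volume at least
1/σ, and still have disjoint interiors. -/
theorem card_star_le (hd : 1 ≤ d) {σ : ℝ} (h_nonneg : 0 ≤ σ)
    (hσ : ∀ T ∈ 𝒯.cells, cellDiam T ^ d ≤ σ * vol T) (ν : E d) :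
    ((𝒯.star ν).card : ℝ) ≤ σ * ballVol d := by
  rcases (𝒯.star ν).eq_empty_or_nonempty with h0 | ⟨T₀, hT₀⟩
  · rw [h0, Finset.card_empty, Nat.cast_zero]
    exact mul_nonneg h_nonneg (ballVol_pos d).le
  have hσ0 : 0 < σ := by
    have hT := (𝒯.mem_star.1 hT₀).1
    exact vol_pos_sigma hd (𝒯.isSimplex hT) (hσ T₀ hT)
  have hpos : ∀ T ∈ 𝒯.star ν, 0 < cellDiam T := fun T hT =>
    cellDiam_pos hd (𝒯.isSimplex (𝒯.mem_star.1 hT).1)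
  have h := card_mul_le_of_disjoint (x := ν) (r := 1) (m := σ⁻¹) (𝒯.star ν)
    (fun T => scaledCell T ν (cellDiam T)⁻¹)
    (fun T hT => measurableSet_scaledCell _ _ (inv_pos.2 (hpos T hT)).ne') ?_ zero_le_one ?_ ?_
  · rw [one_pow, one_mul, mul_inv_le_iff₀ hσ0, mul_comm] at h
    exact h
  · intro S hS T hT hne
    refine Set.disjoint_left.2 ?_
    rintro _ ⟨z, hz, rfl⟩ ⟨z', hz', hzz⟩
    have hS' := 𝒯.mem_star.1 hS
    have hT' := 𝒯.mem_star.1 hT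
    have hDS := hpos S hS
    have hDT := hpos T hT
    -- A common point of two rescaled cells, shrunk about ν by the smaller diameter, would lie in
    -- the interiors of both original cells.
    set ε := min (cellDiam S) (cellDiam T)
    have hε : 0 < ε := lt_min hDS hDT
    have key : ∀ R : Finset (E d), R ∈ 𝒯.star ν → ε ≤ cellDiam R → ∀ z ∈ interior (conv R),
        AffineMap.homothety ν ε (AffineMap.homothety ν (cellDiam R)⁻¹ z) ∈ interior (conv R) := by
      intro R hR hεR z hz
      have hDR := hpos R hR
      rw [← AffineMap.homothety_mul_apply]
      refine scaledCell_subset_interior (𝒯.isSimplex (𝒯.mem_star.1 hR).1)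
        (mem_conv_of_mem (𝒯.mem_star.1 hR).2) (by positivity) ?_ ⟨z, hz, rfl⟩
      rw [mul_inv_le_iff₀ hDR, one_mul]
      exact hεR
    refine Set.disjoint_left.1 (𝒯.disjoint_interior hS'.1 hT'.1 hne)
      (key S hS (min_le_left _ _) z hz) ?_
    rw [← hzz]
    exact key T hT (min_le_right _ _) z' hz'
  · intro T hT
    have hD := hpos T hT
    rw [volume_scaledCell]
    refine ENNReal.ofReal_le_ofReal ?_
    rw [abs_of_pos (by positivity), inv_pow, inv_mul_eq_div, le_div_iff₀ (by positivity),
      inv_mul_le_iff₀ hσ0]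
    exact hσ T (𝒯.mem_star.1 hT).1
  · intro T hT x hx
    have hD := hpos T hT
    have := dist_scaledCell_le (mem_conv_of_mem (𝒯.mem_star.1 hT).2) hx
    rwa [abs_of_pos (by positivity), inv_mul_cancel₀ hD.ne'] at this

/-- For d ≥ 2 the common face has two vertices p ≠ q. The S-coordinate of p drops from one to zero
between them, so by the gradient bound their distance is not small compared to diam S, while both
are in T. For d = 1 the common face is a single point, which gives no such comparison. -/
theorem cellDiam_le_of_adjacent (hd : 2 ≤ d) {σ : ℝ}
    (hσ : ∀ T ∈ 𝒯.cells, cellDiam T ^ d ≤ σ * vol T) {S T : Finset (E d)} (hS : S ∈ 𝒯.cells)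
    (hT : T ∈ 𝒯.cells) (h : (S ∩ T : Set (E d)).ncard = d) :
    cellDiam S ≤ (σ * (3 ^ d * ballVol d)) * cellDiam T := by
  obtain ⟨f, a, b, hadj, -⟩ := 𝒯.exists_isAdjacent hS hT h
  have hSs := 𝒯.isSimplex hS
  obtain ⟨p, hp, q, hq, hpq⟩ := Finset.one_lt_card.1 (by rw [hadj.left.card]; omega : 1 < f.card)
  have h1 := abs_bary_sub_mul_le (by omega) hSs (hσ S hS) p p q
  rw [bary_self hSs (hadj.left.subset hp), bary_ne hSs (hadj.left.subset hq) hpq, sub_zero, abs_one,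
    one_mul] at h1
  refine h1.trans ?_
  have hσ0 := vol_pos_sigma (by omega) hSs (hσ S hS)
  have := ballVol_pos d
  gcongr
  exact dist_le_cellDiam (mem_conv_of_mem (hadj.right.subset hp))
    (mem_conv_of_mem (hadj.right.subset hq))

/-- Ratios multiply along a chain; passing to logarithms makes the additive chain estimate
applicable. -/
theorem cellDiam_le_of_star {ν : E d} (hd : 1 ≤ d) {N : ℕ} (hN : (𝒯.star ν).card ≤ N) {K : ℝ}
    (hK : 1 ≤ K) (hadj : ∀ S ∈ 𝒯.star ν, ∀ T ∈ 𝒯.star ν, (S ∩ T : Set (E d)).ncard = d →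
      cellDiam S ≤ K * cellDiam T) {S T : Finset (E d)} (hS : S ∈ 𝒯.star ν) (hT : T ∈ 𝒯.star ν) :
    cellDiam S ≤ K ^ N * cellDiam T := by
  have hpos : ∀ T ∈ 𝒯.star ν, 0 < cellDiam T := fun T hT =>
    cellDiam_pos hd (𝒯.isSimplex (𝒯.mem_star.1 hT).1)
  have hlog : ∀ S ∈ 𝒯.star ν, ∀ T ∈ 𝒯.star ν, (S ∩ T : Set (E d)).ncard = d →
      Real.log (cellDiam S) - Real.log (cellDiam T) ≤ Real.log K := fun S hS T hT h => by
    have h1 := Real.log_le_log (hpos S hS) (hadj S hS T hT h)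
    rw [Real.log_mul (by positivity) (hpos T hT).ne'] at h1
    linarith
  have h1 := 𝒯.star_abs_sub_le hN (F := fun T => Real.log (cellDiam T)) (Real.log_nonneg hK)
    (fun A hA B hB h => abs_sub_le_iff.2 ⟨hlog A hA B hB h, hlog B hB A hA (by rwa [inter_comm])⟩)
    hS hT
  have h2 := (abs_sub_le_iff.1 h1).1
  have hK0 : 0 < K := by linarith
  have hT0 := hpos T hT
  rw [← Real.log_le_log_iff (hpos S hS) (by positivity), Real.log_mul (by positivity) hT0.ne',
    Real.log_pow]
  linarith

end Mesh

/-- Uniformly shape regular families have uniform constants. -/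
theorem exists_regular {d : ℕ} (hd : 1 ≤ d) {Ω : Set (E d)} {ι : Type*} (𝒯 : ι → Mesh Ω)
    (h_shape : UniformlyShapeRegular 𝒯) (h_kmesh : d = 1 → UniformKMesh 𝒯) :
    ∃ (σ κ : ℝ) (N : ℕ), 0 ≤ σ ∧ 1 ≤ κ ∧ ∀ i, (𝒯 i).Regular σ κ N := by
  obtain ⟨σ₀, hσ₀⟩ := h_shape
  set σ := |σ₀| ^ d with hσdef
  have hd0 : (d : ℝ) ≠ 0 := by exact_mod_cast (by omega : d ≠ 0)
  have hmesh : ∀ T : Finset (E d), 0 ≤ meshSize T := fun T =>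
    Real.rpow_nonneg ENNReal.toReal_nonneg _
  have hpow : ∀ T : Finset (E d), meshSize T ^ d = vol T := fun T => by
    have h0 : 0 ≤ vol T := ENNReal.toReal_nonneg
    rw [meshSize, one_div, ← Real.rpow_natCast, ← Real.rpow_mul h0,
      inv_mul_cancel₀ hd0, Real.rpow_one]
  have hshape : ∀ i, ∀ T ∈ (𝒯 i).cells, cellDiam T ^ d ≤ σ * vol T := by
    intro i T hT
    rw [hσdef, ← hpow, ← mul_pow]
    refine pow_le_pow_left₀ Metric.diam_nonneg ((hσ₀ i T hT).trans ?_) d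
    gcongr
    · exact hmesh T
    · exact le_abs_self _
  have hb := ballVol_pos d
  set N := ⌈σ * ballVol d⌉₊
  have hval : ∀ i ν, ((𝒯 i).star ν).card ≤ N := fun i ν => by
    have h1 := (𝒯 i).card_star_le hd (by positivity) (hshape i) ν
    exact_mod_cast h1.trans (Nat.le_ceil _)
  obtain ⟨K, hK1, hK⟩ : ∃ K : ℝ, 1 ≤ K ∧ ∀ i ν, ∀ S ∈ (𝒯 i).star ν, ∀ T ∈ (𝒯 i).star ν,
      (S ∩ T : Set (E d)).ncard = d → cellDiam S ≤ K * cellDiam T := by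
    rcases hd.eq_or_lt with h1 | h1
    -- In dimension one the comparability of `meshSize` is an assumption; it carries over to
    -- diameters by shape regularity and `vol_le`.
    · obtain ⟨κ, hκ⟩ := h_kmesh h1.symm
      refine ⟨max 1 (|σ₀| * (|κ| * ballVol d)), le_max_left _ _, fun i ν S hS T hT _ => ?_⟩
      rw [Mesh.mem_star] at hS hT
      have e1 := hσ₀ i S hS.1
      have e2 := hκ i S hS.1 T hT.1 ⟨ν, mem_conv_of_mem hS.2, mem_conv_of_mem hT.2⟩
      have e3 : meshSize T ≤ cellDiam T * ballVol d := by
        have h2 := vol_le ((𝒯 i).isSimplex hT.1)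
        subst h1
        rwa [← hpow, pow_one, pow_one] at h2
      have hDT : 0 ≤ cellDiam T := Metric.diam_nonneg
      calc cellDiam S ≤ |σ₀| * meshSize S := e1.trans (by
            gcongr
            · exact hmesh S
            · exact le_abs_self _)
        _ ≤ |σ₀| * (|κ| * meshSize T) := by
            gcongr
            refine e2.trans ?_
            gcongr
            · exact hmesh T
            · exact le_abs_self _
        _ ≤ |σ₀| * (|κ| * (cellDiam T * ballVol d)) := by gcongr
        _ = |σ₀| * (|κ| * ballVol d) * cellDiam T := by ring
        _ ≤ _ := by gcongr; exact le_max_right _ _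
    · refine ⟨max 1 (σ * (3 ^ d * ballVol d)), le_max_left _ _, fun i ν S hS T hT h => ?_⟩
      have hDT : 0 ≤ cellDiam T := Metric.diam_nonneg
      refine ((𝒯 i).cellDiam_le_of_adjacent (by omega) (hshape i) ((𝒯 i).mem_star.1 hS).1
        ((𝒯 i).mem_star.1 hT).1 h).trans ?_
      gcongr
      exact le_max_right _ _
  exact ⟨σ, K ^ N, N, by positivity, one_le_pow₀ hK1, fun i => ⟨hshape i, fun ν S hS T hT =>
    (𝒯 i).cellDiam_le_of_star hd (hval i ν) hK1 (hK i ν) hS hT, hval i⟩⟩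

end OpPrec

namespace OpPrec

/-! ### Gradients of affine functions -/

/-- The gradient of an affine function. -/
def affGrad {d : ℕ} (p : E d →ᵃ[ℝ] ℝ) : E d :=
  (InnerProductSpace.toDual ℝ (E d)).symm (LinearMap.toContinuousLinearMap p.linear)

theorem inner_affGrad {d : ℕ} (p : E d →ᵃ[ℝ] ℝ) (v : E d) : ⟪affGrad p, v⟫ = p.linear v := by
  rw [affGrad, InnerProductSpace.toDual_symm_apply]; rfl

theorem affineMap_sub {d : ℕ} (p : E d →ᵃ[ℝ] ℝ) (x y : E d) :
    p x - p y = ⟪affGrad p, x - y⟫ := by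
  rw [inner_affGrad]
  have := p.linearMap_vsub x y
  rw [vsub_eq_sub, vsub_eq_sub] at this
  exact this.symm

theorem abs_affineMap_sub_le {d : ℕ} (p : E d →ᵃ[ℝ] ℝ) (x y : E d) :
    |p x - p y| ≤ ‖affGrad p‖ * dist x y := by
  rw [affineMap_sub, dist_eq_norm]
  exact abs_real_inner_le_norm _ _

theorem hasFDerivAt_affineMap {d : ℕ} (p : E d →ᵃ[ℝ] ℝ) (x : E d) :
    HasFDerivAt p (innerSL ℝ (affGrad p)) x := by
  have h : (p : E d → ℝ) = fun x => innerSL ℝ (affGrad p) x + p 0 := by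
    ext x
    have := affineMap_sub p x 0
    rw [sub_zero] at this
    rw [innerSL_apply_apply, ← this]; ring
  rw [h]
  exact (innerSL ℝ (affGrad p)).hasFDerivAt.add_const _

theorem norm_affGrad_bary_mul_le {d : ℕ} (hd : 1 ≤ d) {T : Finset (E d)} (hT : IsSimplex T)
    {σ : ℝ} (hσ : cellDiam T ^ d ≤ σ * vol T) (v : E d) :
    ‖affGrad (bary T v)‖ * cellDiam T ≤ σ * (3 ^ d * ballVol d) := by
  -- Along the gradient itself, the increment of the coordinate is the squared norm of the gradient.
  have h := abs_bary_sub_mul_le hd hT hσ v (affGrad (bary T v)) 0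
  rw [affineMap_sub, sub_zero, real_inner_self_eq_norm_sq, abs_of_nonneg (by positivity),
    dist_zero_right] at h
  rcases (norm_nonneg (affGrad (bary T v))).eq_or_lt with h0 | h0
  · rw [← h0, zero_mul]
    have := vol_pos_sigma hd hT hσ
    have := ballVol_pos d
    positivity
  · refine le_of_mul_le_mul_right ?_ h0
    linarith

/-! ### Uniqueness of weak gradients -/

theorem integral_affineMap_mul_fderiv {d : ℕ} (p : E d →ᵃ[ℝ] ℝ) {O : Set (E d)} {φ : E d → ℝ}
    (hφ : IsTest O φ) (v : E d) :
    ∫ x, p x * fderiv ℝ φ x v = - ∫ x, ⟪affGrad p, v⟫ * φ x := by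
  have hp := continuous_affineMap p
  have hfd : ∀ x, fderiv ℝ p x v = ⟪affGrad p, v⟫ := fun x => by
    rw [(hasFDerivAt_affineMap p x).fderiv]; rfl
  have hcd := continuous_fderiv_test hφ.smooth v
  have hcs := hasCompactSupport_fderiv_test hφ.compact v
  rw [integral_mul_fderiv_eq_neg_fderiv_mul_of_integrable]
  · simp_rw [hfd]
  · simp_rw [hfd]
    exact (hφ.continuous.integrable_of_hasCompactSupport hφ.compact).const_mul _
  · exact (hp.mul hcd).integrable_of_hasCompactSupport hcs.mul_left
  · exact (hp.mul hφ.continuous).integrable_of_hasCompactSupport hφ.compact.mul_left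
  · exact fun x _ => (hasFDerivAt_affineMap p x).differentiableAt
  · exact fun x _ => hφ.smooth.differentiable (by simp) x

/-- Integration by parts shows that the constant `affGrad p` is a weak gradient too, so its
difference to g is orthogonal to all test functions on O. -/
theorem LocalWeakGrad.ae_eq_affGrad {d : ℕ} {O : Set (E d)} (hO : IsOpen O) {u : E d → ℝ}
    {g : E d → E d} (hg : MemLp g 2 volume) (h : LocalWeakGrad O u g) (p : E d →ᵃ[ℝ] ℝ)
    (hup : ∀ᵐ x, x ∈ O → u x = p x) : ∀ᵐ x, x ∈ O → g x = affGrad p := by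
  have hloc : LocallyIntegrable (fun x => g x - affGrad p) volume :=
    (hg.locallyIntegrable one_le_two).sub (locallyIntegrable_const _)
  have h0 := hO.ae_eq_zero_of_integral_contDiff_smul_eq_zero (hloc.locallyIntegrableOn O)
    fun φ h1 h2 h3 => by
      have ht : IsTest O φ := ⟨h1, h2, h3⟩
      have hi1 : Integrable fun x => φ x • g x := by
        have := hg.locallyIntegrable one_le_two
        exact this.integrable_smul_left_of_hasCompactSupport ht.continuous h2
      have hi2 : Integrable fun x => φ x • affGrad p :=
        (ht.continuous.integrable_of_hasCompactSupport h2).smul_const _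
      refine integral_eq_zero_of_forall_integral_inner_eq_zero ℝ _ ?_ fun v => ?_
      · simp_rw [smul_sub]
        exact hi1.sub hi2
      · have e1 : ∀ x, ⟪v, φ x • (g x - affGrad p)⟫ = ⟪g x, v⟫ * φ x - ⟪affGrad p, v⟫ * φ x := by
          intro x
          rw [real_inner_smul_right, inner_sub_right, real_inner_comm (g x) v,
            real_inner_comm (affGrad p) v]
          ring
        simp_rw [e1]
        have hj1 : Integrable fun x => ⟪g x, v⟫ * φ x := by
          refine (hi1.inner_const (𝕜 := ℝ) v).congr (Eventually.of_forall fun x => ?_)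
          simp only
          rw [real_inner_smul_left, mul_comm]
        have hj2 : Integrable fun x => ⟪affGrad p, v⟫ * φ x :=
          (ht.continuous.integrable_of_hasCompactSupport h2).const_mul _
        rw [integral_sub hj1 hj2]
        have e2 := h φ ht v
        have e3 := integral_affineMap_mul_fderiv p ht v
        have e4 : ∫ x, u x * fderiv ℝ φ x v = ∫ x, p x * fderiv ℝ φ x v := by
          refine integral_congr_ae ?_
          filter_upwards [hup] with x hx
          by_cases hxO : x ∈ O
          · rw [hx hxO]
          · have : fderiv ℝ φ x = 0 := by
              refine image_eq_zero_of_notMem_tsupport fun h' => hxO (h3 ?_)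
              exact tsupport_fderiv_subset ℝ h'
            rw [this, zero_apply, mul_zero, mul_zero]
        rw [e4] at e2
        linarith
  filter_upwards [h0] with x hx hxO
  exact sub_eq_zero.1 (hx hxO)

/-! ### Cut-off functions -/

theorem exists_cutoff {d : ℕ} {A W : Set (E d)} (hA : IsCompact A) (hW : IsOpen W) (hAW : A ⊆ W) :
    ∃ η, IsTest W η ∧ (∀ᶠ x in 𝓝ˢ A, η x = 1) ∧ ∀ x, η x ∈ Icc (0 : ℝ) 1 := by
  obtain ⟨L, hL, hAL, hLW⟩ := exists_compact_between hA hW hAW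
  obtain ⟨η, h1, h2, h3⟩ := exists_contMDiffMap_one_nhds_of_subset_interior
    (n := (⊤ : ℕ∞)) (modelWithCornersSelf ℝ (E d)) hA.isClosed hAL
  have hsupp : tsupport η ⊆ L :=
    closure_minimal (fun x hx => by
      by_contra hxL
      exact hx (h2 x hxL)) hL.isClosed
  exact ⟨η, ⟨η.contMDiff.contDiff, hL.of_isClosed_subset (isClosed_tsupport _) hsupp,
    hsupp.trans hLW⟩, h1, h3⟩

/-! ### Extension by zero of functions on `Ω` -/

section Extension

variable {d : ℕ} {Ω γ : Set (E d)} {F : Type*} [NormedAddCommGroup F]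

theorem memLp_indicator {S : Set (E d)} (hS : MeasurableSet S) (hSΩ : S ⊆ Ω)
    (u : Lp F 2 (mu Ω)) : MemLp (S.indicator u) 2 volume :=
  (memLp_indicator_iff_restrict hS).2
    ((Lp.memLp u).mono_measure (Measure.restrict_mono hSΩ le_rfl))

theorem measurable_indicator_Lp [MeasurableSpace F] [BorelSpace F] {S : Set (E d)}
    (hS : MeasurableSet S) (u : Lp F 2 (mu Ω)) : Measurable (S.indicator u) :=
  (Lp.stronglyMeasurable u).measurable.indicator hS

theorem integral_indicator_mul {S : Set (E d)} (hS : MeasurableSet S) (u f : E d → ℝ) :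
    ∫ x, S.indicator u x * f x = ∫ x in S, u x * f x := by
  rw [← integral_indicator hS]
  refine integral_congr_ae (Eventually.of_forall fun x => ?_)
  by_cases hx : x ∈ S <;> simp [hx]

theorem integral_inner_indicator_mul {S : Set (E d)} (hS : MeasurableSet S) (g : E d → E d)
    (v : E d) (f : E d → ℝ) :
    ∫ x, ⟪S.indicator g x, v⟫ * f x = ∫ x in S, ⟪g x, v⟫ * f x := by
  rw [← integral_indicator hS]
  refine integral_congr_ae (Eventually.of_forall fun x => ?_)
  by_cases hx : x ∈ S <;> simp [hx]

theorem continuous_setIntegral_inner [InnerProductSpace ℝ F] {S : Set (E d)}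
    (hS : MeasurableSet S) (hSΩ : S ⊆ Ω) {w : E d → F} (hw : MemLp w 2 (mu Ω)) :
    Continuous fun u : Lp F 2 (mu Ω) => ∫ x in S, ⟪u x, w x⟫ := by
  have hw' : MemLp (S.indicator w) 2 (mu Ω) := hw.indicator hS
  have h : ∀ u : Lp F 2 (mu Ω), ∫ x in S, ⟪u x, w x⟫ = inner ℝ u (hw'.toLp _) := fun u => by
    rw [L2.inner_def]
    have e1 : ∫ x, ⟪u x, hw'.toLp _ x⟫ ∂(mu Ω) =
        ∫ x in Ω, S.indicator (fun x => ⟪u x, w x⟫) x := by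
      refine integral_congr_ae ?_
      filter_upwards [MemLp.coeFn_toLp hw'] with x hx
      rw [hx]
      by_cases hxS : x ∈ S <;> simp [hxS]
    rw [e1, setIntegral_indicator hS, inter_eq_right.2 hSΩ]
  simp_rw [h]
  fun_prop

theorem continuous_fst_L2pair : Continuous fun z : L2pair Ω => z.fst :=
  WithLp.prod_continuous_ofLp 2 _ _ |>.fst

theorem continuous_snd_L2pair : Continuous fun z : L2pair Ω => z.snd :=
  WithLp.prod_continuous_ofLp 2 _ _ |>.snd

/-- Both sides are L₂-inner products with fixed functions, hence continuous. This lets weak gradient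
identities, also over a single cell S, pass from functions vanishing near γ to their H¹-closure. -/
theorem isClosed_weakGrad {S : Set (E d)} (hS : MeasurableSet S) (hSΩ : S ⊆ Ω) {f φ : E d → ℝ}
    (hf : MemLp f 2 (mu Ω)) (hφ : MemLp φ 2 (mu Ω)) (v : E d) :
    IsClosed {z : L2pair Ω | ∫ x in S, z.fst x * f x = -∫ x in S, ⟪z.snd x, v⟫ * φ x} := by
  have h1 := (continuous_setIntegral_inner hS hSΩ hf).comp (continuous_fst_L2pair (Ω := Ω))
  have hφv : MemLp (fun x => φ x • v) 2 (mu Ω) := by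
    have := (ContinuousLinearMap.toSpanSingleton ℝ v).comp_memLp' hφ
    exact this
  have h2 := (continuous_setIntegral_inner hS hSΩ hφv).comp (continuous_snd_L2pair (Ω := Ω))
  have e : {z : L2pair Ω | ∫ x in S, z.fst x * f x = -∫ x in S, ⟪z.snd x, v⟫ * φ x} =
      {z : L2pair Ω | ∫ x in S, ⟪z.fst x, f x⟫ = -∫ x in S, ⟪z.snd x, φ x • v⟫} := by
    ext z
    simp only [mem_ofPred_eq]
    have e1 : ∀ x, ⟪z.fst x, f x⟫ = z.fst x * f x := fun x => by
      rw [RCLike.inner_apply]; simp [mul_comm]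
    have e2 : ∀ x, ⟪z.snd x, φ x • v⟫ = ⟪z.snd x, v⟫ * φ x := fun x => by
      rw [real_inner_smul_right, mul_comm]
    simp_rw [e1, e2]
  rw [e]
  exact isClosed_eq h1 h2.neg

theorem mem_H1_of_mem_H10 (hΩ : IsOpen Ω) {z : L2pair Ω} (hz : z ∈ H10 Ω γ) : z ∈ H1 Ω := by
  have hcl : IsClosed (H1 Ω : Set (L2pair Ω)) := by
    have e : (H1 Ω : Set (L2pair Ω)) = ⋂ (φ : E d → ℝ) (_ : IsTest Ω φ) (v : E d),
        {z : L2pair Ω | ∫ x in Ω, z.fst x * fderiv ℝ φ x v = -∫ x in Ω, ⟪z.snd x, v⟫ * φ x} := by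
      ext z
      simp only [mem_iInter, mem_ofPred_eq]
      exact ⟨fun h φ hφ v => h φ hφ.smooth hφ.compact hφ.support v,
        fun h φ h1 h2 h3 v => h φ ⟨h1, h2, h3⟩ v⟩
    rw [e]
    refine isClosed_iInter fun φ => isClosed_iInter fun hφ => isClosed_iInter fun v => ?_
    exact isClosed_weakGrad hΩ.measurableSet le_rfl
      ((continuous_fderiv_test hφ.smooth v).memLp_of_hasCompactSupport
        (hasCompactSupport_fderiv_test hφ.compact v)) (hφ.memLp 2 _) v
  exact closure_minimal (fun z hz => hz.1) hcl hz

theorem localWeakGrad_of_mem_H10 (hΩ : IsOpen Ω) {z : L2pair Ω} (hz : z ∈ H10 Ω γ) :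
    LocalWeakGrad Ω (Ω.indicator z.fst) (Ω.indicator z.snd) := by
  intro φ hφ v
  rw [integral_indicator_mul hΩ.measurableSet, integral_inner_indicator_mul hΩ.measurableSet]
  exact mem_H1_of_mem_H10 hΩ hz φ hφ.smooth hφ.compact hφ.support v

theorem LocalWeakGrad.mono {O O' : Set (E d)} {u : E d → ℝ} {g : E d → E d}
    (h : LocalWeakGrad O u g) (hO : O' ⊆ O) : LocalWeakGrad O' u g :=
  fun φ hφ v => h φ (hφ.mono hO) v

/-- Inside the cone the boundary of T is met only on f ⊆ γ. So, off the neighbourhood U of γ, the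
support of φ meets T in a compact part of the interior. With a cut-off η that is one near this part,
η φ is a test function on the interior of T, and replacing φ by η φ does not change the integrals
over T, because the function and its weak gradient vanish on U. -/
theorem localWeakGrad_faceCone_of_mem_H1near (hΩo : IsOpen Ω)
    {T f : Finset (E d)} {a : E d} (hf : IsFace T f a) (hTΩ : interior (conv T) ⊆ Ω)
    (hfγ : conv f ⊆ γ) {z : L2pair Ω} (hz : z ∈ H1near Ω γ) :
    LocalWeakGrad (faceCone T f) ((interior (conv T)).indicator z.fst)
      ((interior (conv T)).indicator z.snd) := by
  obtain ⟨hz1, U, hU, hγU, hzU⟩ := hz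
  intro φ hφ v
  set I := interior (conv T) with hI
  have hIo : IsOpen I := isOpen_interior
  rw [integral_indicator_mul hIo.measurableSet, integral_inner_indicator_mul hIo.measurableSet]
  set A := (tsupport φ ∩ conv T) \ U
  have hA : IsCompact A := (hφ.compact.isCompact.inter (isCompact_conv T)).diff hU
  have hAI : A ⊆ I := by
    rintro x ⟨⟨hx1, hx2⟩, hx3⟩
    rw [hI, mem_interior_conv_iff hf.simplex]
    intro w hw
    rcases hf.eq_or_mem w hw with rfl | hwf
    · refine (bary_nonneg hf.simplex hx2 w).lt_of_ne fun h0 => hx3 (hγU (hfγ ?_))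
      exact hf.mem_conv_of_bary hx2 h0.symm
    · exact hφ.support hx1 w hwf
  obtain ⟨η, hη, hη1, -⟩ := exists_cutoff hA hIo hAI
  have hWG : LocalWeakGrad Ω (Ω.indicator z.fst) (Ω.indicator z.snd) := by
    intro φ hφ v
    rw [integral_indicator_mul hΩo.measurableSet, integral_inner_indicator_mul hΩo.measurableSet]
    exact hz1 φ hφ.smooth hφ.compact hφ.support v
  have hzU' : ∀ᵐ x, x ∈ Ω ∩ U → Ω.indicator z.fst x = (0 : E d →ᵃ[ℝ] ℝ) x := by
    have := (ae_restrict_iff' hΩo.measurableSet).1 hzU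
    filter_upwards [this] with x hx hxU
    rw [indicator_of_mem hxU.1, hx hxU.1 hxU.2]
    rfl
  -- Uniqueness of weak gradients with p = 0: the gradient vanishes wherever the function does on an
  -- open set.
  have hgU : ∀ᵐ x, x ∈ Ω ∩ U → Ω.indicator z.snd x = affGrad 0 :=
    (hWG.mono inter_subset_left).ae_eq_affGrad (hΩo.inter hU)
      (memLp_indicator hΩo.measurableSet le_rfl _) 0 hzU'
  have hg0 : affGrad (0 : E d →ᵃ[ℝ] ℝ) = 0 := by
    rw [affGrad]
    simp
  have hψ : IsTest I fun x => η x * φ x :=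
    ⟨hη.smooth.mul hφ.smooth, hη.compact.mul_right, (tsupport_mul_subset_left).trans hη.support⟩
  have hmain := hWG _ (hψ.mono hTΩ) v
  rw [integral_indicator_mul hΩo.measurableSet, integral_inner_indicator_mul hΩo.measurableSet]
    at hmain
  have hψ0 : ∀ x ∈ Ω \ I, η x * φ x = 0 := fun x hx => hψ.eq_zero hx.2
  have hψ0' : ∀ x ∈ Ω \ I, fderiv ℝ (fun x => η x * φ x) x v = 0 := fun x hx => by
    have : fderiv ℝ (fun x => η x * φ x) x = 0 :=
      image_eq_zero_of_notMem_tsupport fun h' => hx.2 (hψ.support (tsupport_fderiv_subset ℝ h'))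
    rw [this]; rfl
  have e1 : ∫ x in Ω, z.fst x * fderiv ℝ (fun x => η x * φ x) x v =
      ∫ x in I, z.fst x * fderiv ℝ φ x v := by
    rw [setIntegral_eq_of_subset_of_forall_sdiff_eq_zero hΩo.measurableSet hTΩ
      fun x hx => by rw [hψ0' x hx, mul_zero]]
    refine setIntegral_congr_ae hIo.measurableSet ?_
    filter_upwards [hzU'] with x hx hxI
    by_cases hxU : x ∈ U
    · have := hx ⟨hTΩ hxI, hxU⟩
      rw [indicator_of_mem (hTΩ hxI)] at this
      rw [this]; simp
    · congr 1
      by_cases hxφ : x ∈ tsupport φ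
      · have hxA : x ∈ A := ⟨⟨hxφ, interior_subset hxI⟩, hxU⟩
        have h1 : (fun x => η x * φ x) =ᶠ[𝓝 x] φ := by
          filter_upwards [hη1.filter_mono (nhds_le_nhdsSet hxA)] with y hy
          rw [hy, one_mul]
        rw [h1.fderiv_eq]
      · have h1 : fderiv ℝ φ x = 0 :=
          image_eq_zero_of_notMem_tsupport fun h' => hxφ (tsupport_fderiv_subset ℝ h')
        have h2 : fderiv ℝ (fun x => η x * φ x) x = 0 :=
          image_eq_zero_of_notMem_tsupport fun h' => hxφ
            (tsupport_mul_subset_right (tsupport_fderiv_subset ℝ h'))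
        rw [h1, h2]
  have e2 : ∫ x in Ω, ⟪z.snd x, v⟫ * (η x * φ x) = ∫ x in I, ⟪z.snd x, v⟫ * φ x := by
    rw [setIntegral_eq_of_subset_of_forall_sdiff_eq_zero hΩo.measurableSet hTΩ
      fun x hx => by rw [hψ0 x hx, mul_zero]]
    refine setIntegral_congr_ae hIo.measurableSet ?_
    filter_upwards [hgU] with x hx hxI
    by_cases hxU : x ∈ U
    · have := hx ⟨hTΩ hxI, hxU⟩
      rw [indicator_of_mem (hTΩ hxI), hg0] at this
      rw [this]; simp
    · congr 1
      by_cases hxφ : x ∈ tsupport φ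
      · have hxA : x ∈ A := ⟨⟨hxφ, interior_subset hxI⟩, hxU⟩
        rw [(hη1.filter_mono (nhds_le_nhdsSet hxA)).self_of_nhds, one_mul]
      · rw [image_eq_zero_of_notMem_tsupport hxφ, mul_zero]
  rw [← e1, ← e2]
  exact hmain

/-- Functions that vanish on a boundary face have weakly differentiable zero extensions. -/
theorem localWeakGrad_faceCone (hΩo : IsOpen Ω)
    {T f : Finset (E d)} {a : E d} (hf : IsFace T f a) (hTΩ : interior (conv T) ⊆ Ω)
    (hfγ : conv f ⊆ γ) {z : L2pair Ω} (hz : z ∈ H10 Ω γ) :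
    LocalWeakGrad (faceCone T f) ((interior (conv T)).indicator z.fst)
      ((interior (conv T)).indicator z.snd) := by
  intro φ hφ v
  have hI : MeasurableSet (interior (conv T)) := isOpen_interior.measurableSet
  rw [integral_indicator_mul hI, integral_inner_indicator_mul hI]
  have hcl := isClosed_weakGrad (Ω := Ω) hI hTΩ
      ((continuous_fderiv_test hφ.smooth v).memLp_of_hasCompactSupport
        (hasCompactSupport_fderiv_test hφ.compact v)) (hφ.memLp 2 _) v
  refine closure_minimal (s := (H1near Ω γ : Set (L2pair Ω))) (fun z hz => ?_) hcl hz
  have := localWeakGrad_faceCone_of_mem_H1near hΩo hf hTΩ hfγ hz φ hφ v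
  rwa [integral_indicator_mul hI, integral_inner_indicator_mul hI] at this

end Extension

end OpPrec

namespace OpPrec

/-! ### Pointwise Lipschitz functions have bounded weak gradients -/

/-- Increments add up along segments: this is the mean value inequality for right slopes, where ε >
0 provides the strict inequality that the comparison principle needs. -/
theorem lipschitzWith_of_pointwise {d : ℕ} {f : E d → ℝ} {L : ℝ} (hL : 0 ≤ L)
    (h : ∀ z, ∀ᶠ x in 𝓝 z, |f x - f z| ≤ L * dist x z) : LipschitzWith L.toNNReal f := by
  have hcont : Continuous f := by
    rw [continuous_iff_continuousAt]
    intro z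
    rw [ContinuousAt, tendsto_iff_dist_tendsto_zero]
    have h1 : Tendsto (fun x => L * dist x z) (𝓝 z) (𝓝 0) := by
      have : Continuous fun x => L * dist x z := by fun_prop
      simpa using this.tendsto z
    exact squeeze_zero' (Eventually.of_forall fun _ => dist_nonneg) (h z) h1
  refine LipschitzWith.of_dist_le_mul fun y x => ?_
  rw [Real.coe_toNNReal L hL, dist_eq_norm, dist_eq_norm]
  refine le_of_forall_pos_le_add fun ε hε => ?_
  set γ : ℝ → E d := fun t => x + t • (y - x)
  have hγ : Continuous γ := by fun_prop
  set G : ℝ → ℝ := fun t => f (γ t) - f x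
  set c := L * ‖y - x‖ with hc
  have key := image_norm_le_of_liminf_right_slope_norm_lt_deriv_boundary (a := 0) (b := 1)
    (f := G) (f' := fun _ => c) (B := fun t => (c + ε) * t) (B' := fun _ => c + ε)
    (by fun_prop) ?_ ?_ (by fun_prop) ?_ ?_ (right_mem_Icc.2 zero_le_one)
  · simpa [G, γ] using key
  · intro t _ r hr
    refine Eventually.frequently ?_
    have h1 : ∀ᶠ z in 𝓝[>] t, |f (γ z) - f (γ t)| ≤ L * dist (γ z) (γ t) :=
      ((hγ.tendsto t).eventually (h (γ t))).filter_mono nhdsWithin_le_nhds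
    filter_upwards [h1, self_mem_nhdsWithin] with z hz htz
    have htz' : 0 < z - t := sub_pos.2 htz
    have h2 : dist (γ z) (γ t) = (z - t) * ‖y - x‖ := by
      rw [dist_eq_norm, show γ z - γ t = (z - t) • (y - x) by simp only [γ]; module, norm_smul,
        Real.norm_of_nonneg htz'.le]
    rw [h2] at hz
    refine lt_of_le_of_lt ?_ hr
    rw [slope_def_field, div_le_iff₀ htz', Function.comp, Function.comp]
    have h3 : ‖G z‖ - ‖G t‖ ≤ |f (γ z) - f (γ t)| := by
      refine (norm_sub_norm_le _ _).trans (le_of_eq ?_)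
      rw [Real.norm_eq_abs]
      simp only [G]
      congr 1; ring
    calc _ ≤ _ := h3
      _ ≤ _ := hz
      _ = _ := by rw [hc]; ring
  · simp [G, γ]
  · intro t _
    simpa using ((hasDerivAt_id t).const_mul (c + ε)).hasDerivWithinAt
  · intro t _ _
    linarith

/-- `f` is Lipschitz at every point of `Ω`, with a uniform constant. -/
def PtLip {d : ℕ} (Ω : Set (E d)) (L : ℝ) (f : E d → ℝ) : Prop :=
  ∀ z ∈ Ω, ∀ᶠ x in 𝓝 z, |f x - f z| ≤ L * dist x z

theorem PtLip.continuousOn {d : ℕ} {Ω : Set (E d)} {L : ℝ} {f : E d → ℝ} (h : PtLip Ω L f) :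
    ContinuousOn f Ω := by
  intro z hz
  refine ContinuousAt.continuousWithinAt ?_
  rw [ContinuousAt, tendsto_iff_dist_tendsto_zero]
  have h1 : Tendsto (fun x => L * dist x z) (𝓝 z) (𝓝 0) := by
    have : Continuous fun x => L * dist x z := by fun_prop
    simpa using this.tendsto z
  exact squeeze_zero' (Eventually.of_forall fun _ => dist_nonneg) (h z hz) h1

theorem norm_gradient_le {d : ℕ} {Ω : Set (E d)} {L : ℝ} (hL : 0 ≤ L) {f : E d → ℝ}
    (h : PtLip Ω L f) {x : E d} (hx : x ∈ Ω) : ‖gradient f x‖ ≤ L := by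
  rw [gradient, LinearIsometryEquiv.norm_map]
  refine norm_fderiv_le_of_lip' ℝ hL ?_
  filter_upwards [h x hx] with y hy
  rwa [← dist_eq_norm]

theorem inner_gradient {d : ℕ} (f : E d → ℝ) (x v : E d) : ⟪gradient f x, v⟫ = fderiv ℝ f x v := by
  rw [gradient, InnerProductSpace.toDual_symm_apply]

/-- Multiplication by a cut-off that is one near the support of φ gives a globally Lipschitz
function, to which Rademacher's theorem and integration by parts apply. Hence regularity of the
boundary of Ω plays no role. -/
theorem PtLip.weakGrad {d : ℕ} {Ω : Set (E d)} {L M : ℝ} (hL : 0 ≤ L)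
    {f : E d → ℝ} (h : PtLip Ω L f) (hM : ∀ x ∈ Ω, |f x| ≤ M) {φ : E d → ℝ} (hφ : IsTest Ω φ)
    (hΩ : IsOpen Ω) (v : E d) :
    ∫ x in Ω, f x * fderiv ℝ φ x v = - ∫ x in Ω, ⟪gradient f x, v⟫ * φ x := by
  obtain ⟨η, hη, hη1, hη2⟩ := exists_cutoff hφ.compact.isCompact hΩ hφ.support
  obtain ⟨C, hC⟩ := hη.smooth.lipschitzWith_of_hasCompactSupport hη.compact (by simp)
  obtain ⟨C', hC'⟩ := hφ.smooth.lipschitzWith_of_hasCompactSupport hφ.compact (by simp)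
  by_cases hne : Ω.Nonempty
  swap
  · rw [not_nonempty_iff_eq_empty.1 hne]; simp
  have hM0 : 0 ≤ M := by
    obtain ⟨x, hx⟩ := hne
    exact (abs_nonneg _).trans (hM x hx)
  set F : E d → ℝ := fun x => η x * f x
  have hF : LipschitzWith (L + M * C).toNNReal F := by
    refine lipschitzWith_of_pointwise (by positivity) fun z => ?_
    by_cases hz : z ∈ Ω
    · filter_upwards [h z hz] with x hx
      have h1 : F x - F z = η x * (f x - f z) + f z * (η x - η z) := by simp only [F]; ring
      have h2 : |η x - η z| ≤ C * dist x z := by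
        have := hC.dist_le_mul x z
        rwa [Real.dist_eq] at this
      have h3 : |η x| ≤ 1 := by
        rw [abs_of_nonneg (hη2 x).1]; exact (hη2 x).2
      rw [h1]
      calc _ ≤ |η x| * |f x - f z| + |f z| * |η x - η z| := by
            rw [← abs_mul, ← abs_mul]; exact abs_add_le _ _
        _ ≤ 1 * (L * dist x z) + M * (C * dist x z) := by
            gcongr
            exact hM z hz
        _ = _ := by ring
    · have hz' : z ∉ tsupport η := fun h' => hz (hη.support h')
      have h0 : ∀ᶠ x in 𝓝 z, η x = 0 := notMem_tsupport_iff_eventuallyEq.1 hz'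
      filter_upwards [h0] with x hx
      simp only [F]
      rw [hx, h0.self_of_nhds]
      simp only [zero_mul, sub_zero, abs_zero]
      positivity
  have hloc : ∀ x ∈ tsupport φ, F =ᶠ[𝓝 x] f := fun x hx => by
    filter_upwards [hη1.filter_mono (nhds_le_nhdsSet hx)] with y hy
    simp only [F]
    rw [hy, one_mul]
  have hmain := hF.integral_lineDeriv_mul_eq (μ := volume) hC' hφ.compact v
  have e1 : ∫ x, lineDeriv ℝ F x v * φ x = ∫ x in Ω, ⟪gradient f x, v⟫ * φ x := by
    rw [← setIntegral_eq_integral_of_forall_compl_eq_zero (s := Ω)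
      (fun x hx => by rw [hφ.eq_zero hx, mul_zero])]
    refine integral_congr_ae (ae_restrict_of_ae ?_)
    filter_upwards [hF.ae_differentiableAt (μ := volume)] with x hx
    by_cases hxφ : x ∈ tsupport φ
    · rw [hx.lineDeriv_eq_fderiv, (hloc x hxφ).fderiv_eq, inner_gradient]
    · rw [image_eq_zero_of_notMem_tsupport hxφ, mul_zero, mul_zero]
  have e2 : ∫ x, lineDeriv ℝ φ x (-v) * F x = -∫ x in Ω, f x * fderiv ℝ φ x v := by
    have h0 : ∀ x, x ∉ tsupport φ → fderiv ℝ φ x v = 0 := fun x hx => by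
      have : fderiv ℝ φ x = 0 :=
        image_eq_zero_of_notMem_tsupport fun h' => hx (tsupport_fderiv_subset ℝ h')
      rw [this]; rfl
    rw [← integral_neg, ← setIntegral_eq_integral_of_forall_compl_eq_zero (s := Ω) (fun x hx => by
      rw [(hφ.smooth.differentiable (by simp) x).lineDeriv_eq_fderiv, map_neg,
        h0 x (fun h' => hx (hφ.support h')), neg_zero, zero_mul])]
    refine integral_congr_ae (Eventually.of_forall fun x => ?_)
    simp only
    rw [(hφ.smooth.differentiable (by simp) x).lineDeriv_eq_fderiv, map_neg]
    by_cases hxφ : x ∈ tsupport φ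
    · rw [(hloc x hxφ).self_of_nhds]; ring
    · rw [h0 x hxφ]; ring
  rw [e1, e2] at hmain
  rw [hmain, neg_neg]

theorem PtLip.exists_mem_H1 {d : ℕ} {Ω : Set (E d)} (hΩ : IsOpen Ω) (hΩb : Bornology.IsBounded Ω)
    {L M : ℝ} (hL : 0 ≤ L) {f : E d → ℝ} (h : PtLip Ω L f) (hM : ∀ x ∈ Ω, |f x| ≤ M) :
    ∃ z ∈ H1 Ω, z.fst =ᵐ[mu Ω] f ∧ z.snd =ᵐ[mu Ω] gradient f := by
  have hfin : IsFiniteMeasure (mu Ω) := ⟨by simpa using hΩb.measure_lt_top⟩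
  have hf : MemLp f 2 (mu Ω) :=
    MemLp.of_bound (h.continuousOn.aestronglyMeasurable hΩ.measurableSet) M
      ((ae_restrict_iff' hΩ.measurableSet).2 (Eventually.of_forall fun x hx => hM x hx))
  have hgm : Measurable (gradient f) :=
    (InnerProductSpace.toDual ℝ (E d)).symm.continuous.measurable.comp (measurable_fderiv ℝ f)
  have hg : MemLp (gradient f) 2 (mu Ω) :=
    MemLp.of_bound hgm.aestronglyMeasurable L
      ((ae_restrict_iff' hΩ.measurableSet).2
        (Eventually.of_forall fun x hx => norm_gradient_le hL h hx))
  refine ⟨WithLp.toLp 2 (hf.toLp f, hg.toLp _), ?_, MemLp.coeFn_toLp hf, MemLp.coeFn_toLp hg⟩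
  intro φ h1 h2 h3 v
  have e1 : ∫ x in Ω, (hf.toLp f) x * fderiv ℝ φ x v = ∫ x in Ω, f x * fderiv ℝ φ x v := by
    refine integral_congr_ae ?_
    filter_upwards [MemLp.coeFn_toLp hf] with x hx
    rw [hx]
  have e2 : ∫ x in Ω, ⟪(hg.toLp (gradient f)) x, v⟫ * φ x =
      ∫ x in Ω, ⟪gradient f x, v⟫ * φ x := by
    refine integral_congr_ae ?_
    filter_upwards [MemLp.coeFn_toLp hg] with x hx
    rw [hx]
  exact e1.trans ((h.weakGrad hL hM ⟨h1, h2, h3⟩ hΩ v).trans (congrArg Neg.neg e2.symm))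

theorem tendsto_Lp_of_bounded {d : ℕ} {Ω : Set (E d)} (hΩb : Bornology.IsBounded Ω) {F : Type*}
    [NormedAddCommGroup F] [InnerProductSpace ℝ F] {u : ℕ → Lp F 2 (mu Ω)} {w : Lp F 2 (mu Ω)}
    {C : ℝ} (hC : ∀ n, ∀ᵐ x ∂(mu Ω), ‖u n x - w x‖ ≤ C)
    (hlim : ∀ᵐ x ∂(mu Ω), Tendsto (fun n => u n x) atTop (𝓝 (w x))) :
    Tendsto u atTop (𝓝 w) := by
  have hfin : IsFiniteMeasure (mu Ω) := ⟨by simpa using hΩb.measure_lt_top⟩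
  have hsq : ∀ n, ‖u n - w‖ ^ 2 = ∫ x, ‖u n x - w x‖ ^ 2 ∂(mu Ω) := fun n => by
    rw [← real_inner_self_eq_norm_sq, L2.inner_def]
    refine integral_congr_ae ?_
    filter_upwards [Lp.coeFn_sub (u n) w] with x hx
    rw [hx, Pi.sub_apply, real_inner_self_eq_norm_sq]
  have h1 : Tendsto (fun n => ‖u n - w‖ ^ 2) atTop (𝓝 0) := by
    simp_rw [hsq]
    rw [← integral_zero (E d) ℝ (μ := mu Ω)]
    refine tendsto_integral_of_dominated_convergence (fun _ => C ^ 2) (fun n => ?_)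
      (integrable_const _) (fun n => ?_) ?_
    · exact (((Lp.aestronglyMeasurable (u n)).sub (Lp.aestronglyMeasurable w)).norm.pow 2)
    · filter_upwards [hC n] with x hx
      rw [norm_pow, norm_norm]
      gcongr
    · filter_upwards [hlim] with x hx
      have := ((tendsto_iff_norm_sub_tendsto_zero.1 hx).pow 2)
      simpa using this
  rw [tendsto_iff_norm_sub_tendsto_zero]
  have h2 := h1.sqrt
  rw [Real.sqrt_zero] at h2
  exact h2.congr fun n => Real.sqrt_sq (norm_nonneg _)

theorem tendsto_L2pair {d : ℕ} {Ω : Set (E d)} {z : ℕ → L2pair Ω} {w : L2pair Ω}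
    (h1 : Tendsto (fun n => (z n).fst) atTop (𝓝 w.fst))
    (h2 : Tendsto (fun n => (z n).snd) atTop (𝓝 w.snd)) : Tendsto z atTop (𝓝 w) := by
  rw [tendsto_iff_norm_sub_tendsto_zero] at h1 h2 ⊢
  have h3 : Tendsto (fun n => ‖z n - w‖ ^ 2) atTop (𝓝 0) := by
    simp_rw [WithLp.prod_norm_sq_eq_of_L2, WithLp.sub_fst, WithLp.sub_snd]
    simpa using (h1.pow 2).add (h2.pow 2)
  have h4 := h3.sqrt
  rw [Real.sqrt_zero] at h4
  exact h4.congr fun n => Real.sqrt_sq (norm_nonneg _)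

/-! ### The hat functions -/

namespace Mesh

variable {d : ℕ} {Ω γ : Set (E d)} (𝒯 : Mesh Ω)

theorem hat_mem_Icc {x : E d} (hx : x ∈ closure Ω) (ν : E d) : 𝒯.hat ν x ∈ Icc (0 : ℝ) 1 := by
  obtain ⟨T, hT, hxT⟩ := 𝒯.exists_mem_conv hx
  rw [𝒯.hat_eq_bary hT hxT]
  exact ⟨bary_nonneg (𝒯.isSimplex hT) hxT ν, bary_le_one (𝒯.isSimplex hT) hxT ν⟩

/-- Cells that avoid z have positive distance to it, so each x near z shares a cell with z, and
there the function is affine. The sum over all cells is a crude bound for the largest gradient; this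
L serves only qualitative purposes and need not be uniform in the mesh. -/
theorem hat_eventually (ν : E d) : ∃ L : ℝ, 0 ≤ L ∧ ∀ z ∈ closure Ω, ∀ᶠ x in 𝓝 z,
    x ∈ closure Ω → |𝒯.hat ν x - 𝒯.hat ν z| ≤ L * dist x z := by
  refine ⟨∑ T ∈ 𝒯.cells, ‖affGrad (bary T ν)‖, Finset.sum_nonneg fun _ _ => norm_nonneg _,
    fun z _ => ?_⟩
  have h1 : ∀ᶠ x in 𝓝 z, ∀ T ∈ 𝒯.cells, x ∈ conv T → z ∈ conv T := by
    rw [Filter.eventually_all_finset]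
    intro T _
    by_cases hz : z ∈ conv T
    · exact Eventually.of_forall fun _ _ => hz
    · filter_upwards [(isCompact_conv T).isClosed.isOpen_compl.mem_nhds hz] with x hx hx'
      exact absurd hx' hx
  filter_upwards [h1] with x hx hxΩ
  obtain ⟨T, hT, hxT⟩ := 𝒯.exists_mem_conv hxΩ
  rw [𝒯.hat_eq_bary hT hxT, 𝒯.hat_eq_bary hT (hx T hT hxT)]
  refine (abs_affineMap_sub_le _ _ _).trans ?_
  gcongr
  exact Finset.single_le_sum (f := fun T => ‖affGrad (bary T ν)‖) (fun _ _ => norm_nonneg _) hT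

theorem hat_eq_zero_of_mem (hγ : 𝒯.IsUnionOfFaces γ) {ν : E d} (hν : ν ∉ γ) {z : E d}
    (hz : z ∈ γ) : 𝒯.hat ν z = 0 := by
  obtain ⟨F, hF, rfl⟩ := hγ
  obtain ⟨f, hf, hzf⟩ := mem_iUnion₂.1 hz
  obtain ⟨-, T, hT, hfT⟩ := hF f hf
  rw [𝒯.hat_eq_bary hT (convexHull_mono (Finset.coe_subset.2 hfT) hzf)]
  refine bary_eq_zero_of_mem_face (𝒯.isSimplex hT) (Finset.coe_subset.2 hfT) hzf fun hνf => hν ?_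
  exact mem_biUnion hf (mem_conv_of_mem hνf)

theorem gradient_hat {T : Finset (E d)} (hT : T ∈ 𝒯.cells) {x : E d}
    (hx : x ∈ interior (conv T)) (ν : E d) : gradient (𝒯.hat ν) x = affGrad (bary T ν) := by
  have h1 : 𝒯.hat ν =ᶠ[𝓝 x] bary T ν := by
    filter_upwards [isOpen_interior.mem_nhds hx] with y hy
    exact 𝒯.hat_eq_bary hT (interior_subset hy) ν
  refine ext_inner_right ℝ fun v => ?_
  rw [inner_gradient, h1.fderiv_eq, (hasFDerivAt_affineMap _ x).fderiv]
  rfl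

/-- In the interior of a cell, either φ_ν is positive and the truncation is a mere shift for large
n, or φ_ν vanishes identically. -/
theorem eventually_gradient_truncated_hat {T : Finset (E d)} (hT : T ∈ 𝒯.cells) {x : E d}
    (hx : x ∈ interior (conv T)) (ν : E d) :
    ∀ᶠ n : ℕ in atTop, gradient (fun y => max (𝒯.hat ν y - 1 / ((n : ℝ) + 1)) 0) x =
      gradient (𝒯.hat ν) x := by
  have hTs := 𝒯.isSimplex hT
  have hpos : ∀ n : ℕ, 0 < 1 / ((n : ℝ) + 1) := fun n => by positivity
  by_cases hν : ν ∈ T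
  · have h0 := (mem_interior_conv_iff hTs).1 hx ν hν
    have h1 : ∀ᶠ n : ℕ in atTop, 1 / ((n : ℝ) + 1) < bary T ν x :=
      tendsto_one_div_add_atTop_nhds_zero_nat.eventually_lt_const h0
    filter_upwards [h1] with n hn
    have h2 : (fun y => max (𝒯.hat ν y - 1 / ((n : ℝ) + 1)) 0) =ᶠ[𝓝 x]
        fun y => 𝒯.hat ν y - 1 / ((n : ℝ) + 1) := by
      filter_upwards [isOpen_interior.mem_nhds hx,
        (continuous_affineMap (bary T ν)).continuousAt.eventually_const_lt hn] with y hy hy'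
      rw [𝒯.hat_eq_bary hT (interior_subset hy), max_eq_left (by linarith)]
    rw [gradient, gradient, h2.fderiv_eq, fderiv_sub_const]
  · refine Eventually.of_forall fun n => ?_
    have h1 : 𝒯.hat ν =ᶠ[𝓝 x] fun _ => 0 := by
      filter_upwards [isOpen_interior.mem_nhds hx] with y hy
      rw [𝒯.hat_eq_bary hT (interior_subset hy), bary_of_notMem hν]; rfl
    have h2 : (fun y => max (𝒯.hat ν y - 1 / ((n : ℝ) + 1)) 0) =ᶠ[𝓝 x] fun _ => 0 := by
      filter_upwards [h1] with y hy
      rw [hy, max_eq_right (by have := hpos n; linarith)]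
    rw [gradient, gradient, h2.fderiv_eq, h1.fderiv_eq]

/-- The truncations max(φ_ν - 1/(n+1), 0) vanish near γ, because φ_ν is zero on γ and continuous on
the closure of Ω. They converge uniformly, and their gradients are bounded and almost everywhere
eventually equal to that of φ_ν, so they converge in H¹ by dominated convergence. -/
theorem exists_hat_mem_H10 (hΩo : IsOpen Ω) (hΩb : Bornology.IsBounded Ω)
    (hΩ : interior (closure Ω) = Ω) (hγΩ : γ ⊆ frontier Ω) (hγ : 𝒯.IsUnionOfFaces γ) {ν : E d}
    (hν : ν ∉ γ) : ∃ z ∈ H10 Ω γ, z.fst =ᵐ[mu Ω] 𝒯.hat ν ∧ ∀ T ∈ 𝒯.cells,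
      ∀ᵐ x ∂(mu Ω), x ∈ interior (conv T) → z.snd x = affGrad (bary T ν) := by
  obtain ⟨L, hL, hlip⟩ := 𝒯.hat_eventually ν
  have hbd : ∀ x ∈ Ω, |𝒯.hat ν x| ≤ 1 := fun x hx => by
    have := 𝒯.hat_mem_Icc (subset_closure hx) ν
    rw [abs_of_nonneg this.1]; exact this.2
  have hP : PtLip Ω L (𝒯.hat ν) := fun z hz => by
    filter_upwards [hlip z (subset_closure hz), hΩo.mem_nhds hz] with x hx hxΩ
    exact hx (subset_closure hxΩ)
  set ε : ℕ → ℝ := fun n => 1 / ((n : ℝ) + 1) with hεdef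
  have hε : ∀ n, 0 < ε n := fun n => by simp only [hεdef]; positivity
  set f : ℕ → E d → ℝ := fun n y => max (𝒯.hat ν y - ε n) 0 with hf
  have hPn : ∀ n, PtLip Ω L (f n) := fun n z hz => by
    filter_upwards [hP z hz] with x hx
    refine (abs_max_sub_max_le_abs _ _ _).trans ?_
    rwa [sub_sub_sub_cancel_right]
  have hclose : ∀ n, ∀ x ∈ Ω, |f n x - 𝒯.hat ν x| ≤ ε n := fun n x hx => by
    have h0 := (𝒯.hat_mem_Icc (subset_closure hx) ν).1
    have h1 := hε n
    simp only [hf]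
    rw [abs_le]
    constructor
    · have := le_max_left (𝒯.hat ν x - ε n) 0
      linarith
    · have : max (𝒯.hat ν x - ε n) 0 ≤ 𝒯.hat ν x + ε n := max_le (by linarith) (by linarith)
      linarith
  have hbdn : ∀ n, ∀ x ∈ Ω, |f n x| ≤ 1 := fun n x hx => by
    have h0 := 𝒯.hat_mem_Icc (subset_closure hx) ν
    have h1 := hε n
    simp only [hf]
    rw [abs_of_nonneg (le_max_right _ _)]
    exact max_le (by linarith [h0.2]) zero_le_one
  obtain ⟨z, hz, hz1, hz2⟩ := hP.exists_mem_H1 hΩo hΩb hL hbd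
  choose w hw hw1 hw2 using fun n => (hPn n).exists_mem_H1 hΩo hΩb hL (hbdn n)
  refine ⟨z, ?_, hz1, fun T hT => ?_⟩
  swap
  · filter_upwards [hz2] with x hx hxT
    rw [hx, 𝒯.gradient_hat hT hxT]
  have hwnear : ∀ n, w n ∈ H1near Ω γ := fun n => by
    -- Nothing is required outside the closure of Ω, where the nodal function is extended by zero.
    refine ⟨hw n, interior {x | x ∈ closure Ω → 𝒯.hat ν x < ε n}, isOpen_interior, ?_, ?_⟩
    · intro y hy
      have hyΩ : y ∈ closure Ω := frontier_subset_closure (hγΩ hy)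
      rw [mem_interior_iff_mem_nhds]
      have h1 : ∀ᶠ x in 𝓝 y, L * dist x y < ε n := by
        have hc : Continuous fun x => L * dist x y := by fun_prop
        refine hc.continuousAt.eventually_lt_const ?_
        show L * dist y y < ε n
        rw [dist_self, mul_zero]; exact hε n
      filter_upwards [hlip y hyΩ, h1] with x hx hx1 hxΩ
      have h2 := hx hxΩ
      rw [𝒯.hat_eq_zero_of_mem hγ hν hy, sub_zero] at h2
      exact (le_abs_self _).trans_lt (h2.trans_lt hx1)
    · filter_upwards [hw1 n, ae_restrict_mem hΩo.measurableSet] with x hx hxΩ hxU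
      have h1 : 𝒯.hat ν x < ε n := interior_subset hxU (subset_closure hxΩ)
      rw [hx]
      simp only [hf]
      exact max_eq_right (by linarith)
  have hlim : Tendsto w atTop (𝓝 z) := by
    refine tendsto_L2pair (tendsto_Lp_of_bounded hΩb (C := 1) (fun n => ?_) ?_)
      (tendsto_Lp_of_bounded hΩb (C := L + L) (fun n => ?_) ?_)
    · filter_upwards [hw1 n, hz1, ae_restrict_mem hΩo.measurableSet] with x h1 h2 hxΩ
      rw [h1, h2, Real.norm_eq_abs]
      refine (hclose n x hxΩ).trans ?_
      simp only [hεdef]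
      rw [div_le_one (by positivity)]
      have : (0 : ℝ) ≤ n := Nat.cast_nonneg n
      linarith
    · filter_upwards [ae_all_iff.2 hw1, hz1, ae_restrict_mem hΩo.measurableSet] with x h1 h2 hxΩ
      rw [h2, tendsto_iff_dist_tendsto_zero]
      refine squeeze_zero (fun _ => dist_nonneg) (fun n => ?_)
        tendsto_one_div_add_atTop_nhds_zero_nat
      rw [h1 n, Real.dist_eq]
      exact hclose n x hxΩ
    · filter_upwards [hw2 n, hz2, ae_restrict_mem hΩo.measurableSet] with x h1 h2 hxΩ
      rw [h1, h2]
      exact (norm_sub_le _ _).trans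
        (add_le_add (norm_gradient_le hL (hPn n) hxΩ) (norm_gradient_le hL hP hxΩ))
    · filter_upwards [ae_all_iff.2 hw2, hz2, 𝒯.ae_mem_cells hΩo hΩ] with x h1 h2 hxT
      obtain ⟨T, hT, hxT⟩ := hxT
      rw [h2]
      refine tendsto_const_nhds.congr' ?_
      filter_upwards [𝒯.eventually_gradient_truncated_hat hT hxT ν] with n hn
      rw [h1 n, ← hn]
  exact mem_closure_of_tendsto hlim (Eventually.of_forall hwnear)

end Mesh

end OpPrec

/-! ### Interelement continuity and boundary values of piecewise affine functions -/

namespace OpPrec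

/-- The difference a - b is split as (a - u(x)) + (u(x) - u(y)) + (u(y) - b) and averaged over X ×
Y; the middle term is the Poincaré bound. -/
theorem jump_le {d : ℕ} {O : Set (E d)} (hO : IsOpen O) (hconv : Convex ℝ O) {u : E d → ℝ}
    {g : E d → E d} (hum : Measurable u) (hu : MemLp u 2 volume) (hg : MemLp g 2 volume)
    (h : LocalWeakGrad O u g) {X Y : Set (E d)} (hX : MeasurableSet X) (hY : MeasurableSet Y)
    (hXO : X ⊆ O) (hYO : Y ⊆ O) {ρ : ℝ} (hρ : 0 ≤ ρ) (hdist : ∀ x ∈ X, ∀ y ∈ Y, dist x y ≤ ρ)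
    {x y a b A B G : ℝ} (hx : 0 ≤ x) (hy : 0 ≤ y) (hA : 0 ≤ A) (hB : 0 ≤ B) (hG : 0 ≤ G)
    (hvX : volume X = ENNReal.ofReal x) (hvY : volume Y = ENNReal.ofReal y)
    (hXA : ∫⁻ z in X, ‖u z - a‖ₑ ^ 2 ≤ ENNReal.ofReal A)
    (hYB : ∫⁻ z in Y, ‖u z - b‖ₑ ^ 2 ≤ ENNReal.ofReal B)
    (hgG : ∫⁻ z in O, ‖g z‖ₑ ^ 2 ≤ ENNReal.ofReal G) :
    x * y * (a - b) ^ 2 ≤ 3 * (y * A + ρ ^ (d + 2) * ballVol d * G + x * B) := by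
  have hβ := (ballVol_pos d).le
  have h1 := poincare_pair hO hconv hum hu hg h hX hY hXO hYO hρ hdist
  have h2 := volume_mul_enorm_sub_sq_le hum X Y a b
  have h3 : ENNReal.ofReal (x * y * (a - b) ^ 2) ≤
      ENNReal.ofReal (3 * (y * A + ρ ^ (d + 2) * ballVol d * G + x * B)) := by
    rw [ENNReal.ofReal_mul (by positivity), ENNReal.ofReal_mul hx, ← enorm_sq, ← hvX, ← hvY]
    refine h2.trans ?_
    rw [ENNReal.ofReal_mul (by norm_num), ENNReal.ofReal_add (by positivity) (by positivity),
      ENNReal.ofReal_add (by positivity) (by positivity), ENNReal.ofReal_mul hy,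
      ENNReal.ofReal_mul hx, ENNReal.ofReal_mul (by positivity), ← hvX, ← hvY,
      show ENNReal.ofReal 3 = 3 by norm_num]
    gcongr
    exact h1.trans (by gcongr)
  rwa [ENNReal.ofReal_le_ofReal_iff (by positivity)] at h3

theorem lintegral_sub_sq_le_of_lipschitz {d : ℕ} {u : E d → ℝ} (p : E d →ᵃ[ℝ] ℝ) {X : Set (E d)}
    (hX : MeasurableSet X) {x : E d} {r v L : ℝ}
    (hL : ‖affGrad p‖ ≤ L) (hvX : volume X = ENNReal.ofReal v) (hXr : ∀ y ∈ X, dist y x ≤ r)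
    (hp : ∀ᵐ y, y ∈ X → u y = p y) :
    ∫⁻ y in X, ‖u y - p x‖ₑ ^ 2 ≤ ENNReal.ofReal ((L * r) ^ 2 * v) := by
  rw [ENNReal.ofReal_mul (by positivity), ← hvX, ← setLIntegral_const]
  refine setLIntegral_mono_ae' hX ?_
  filter_upwards [hp] with y hy hyX
  rw [hy hyX, enorm_sq]
  refine ENNReal.ofReal_le_ofReal (sq_le_sq' ?_ ?_) <;>
  · have h1 := abs_le.1 (abs_affineMap_sub_le p y x)
    have h2 : ‖affGrad p‖ * dist y x ≤ L * r := by
      have := hXr y hyX; gcongr; exact (norm_nonneg _).trans hL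
    linarith

/-- Blow-up at x: on copies of S and T scaled by δ, the jump bound has δ^(2d) on the left and
δ^(2d+2) on the right, so p x - q x vanishes as δ → 0. The sign e = -1 admits the reflection of T
through x, on which an extension by zero vanishes. -/
theorem eq_of_weakGrad_bounded {d : ℕ} (hd : 1 ≤ d) {O : Set (E d)} (hO : IsOpen O)
    {u : E d → ℝ} {g : E d → E d} (hum : Measurable u) (hu : MemLp u 2 volume)
    (hg : MemLp g 2 volume) (h : LocalWeakGrad O u g) {M : ℝ} (hgM : ∀ᵐ y, y ∈ O → ‖g y‖ ≤ M)
    {S T : Finset (E d)} (hS : IsSimplex S) (hT : IsSimplex T) {x : E d} (hxO : x ∈ O)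
    (hxS : x ∈ conv S) (hxT : x ∈ conv T) {e : ℝ} (he : |e| = 1) {p q : E d →ᵃ[ℝ] ℝ}
    (hp : ∀ᶠ δ in 𝓝[>] (0 : ℝ), ∀ᵐ y, y ∈ scaledCell S x δ → u y = p y)
    (hq : ∀ᶠ δ in 𝓝[>] (0 : ℝ), ∀ᵐ y, y ∈ scaledCell T x (e * δ) → u y = q y) :
    p x = q x := by
  obtain ⟨r, hr, hrO⟩ := Metric.isOpen_iff.1 hO x hxO
  set R := cellDiam S + cellDiam T with hR
  have hS0 := cellDiam_pos hd hS
  have hT0 := cellDiam_pos hd hT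
  have hR0 : 0 < R := add_pos hS0 hT0
  set L := ‖affGrad p‖ + ‖affGrad q‖ with hL
  have hβ := ballVol_pos d
  have hvS := vol_pos hS
  have hvT := vol_pos hT
  -- The right-hand side of `jump_le` at δ = 1.
  set C := 3 * (vol T * ((L * (2 * R)) ^ 2 * vol S) +
    (2 * R) ^ (d + 2) * ballVol d * (M ^ 2 * ((2 * R) ^ d * ballVol d)) +
    vol S * ((L * (2 * R)) ^ 2 * vol T)) with hC
  have key : ∀ᶠ δ in 𝓝[>] (0 : ℝ), vol S * vol T * (p x - q x) ^ 2 ≤ C * δ ^ 2 := by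
    have hsmall : ∀ᶠ δ in 𝓝[>] (0 : ℝ), 2 * R * δ < r := by
      have hc : Continuous fun δ : ℝ => 2 * R * δ := by fun_prop
      exact (hc.continuousAt.eventually_lt_const (show 2 * R * 0 < r by simpa using hr)).filter_mono
        nhdsWithin_le_nhds
    filter_upwards [hp, hq, hsmall, self_mem_nhdsWithin] with δ hpδ hqδ hδr hδ
    have hδ0 : 0 < δ := hδ
    have heδ : |e * δ| = δ := by rw [abs_mul, he, one_mul, abs_of_pos hδ0]
    have hX : ∀ y ∈ scaledCell S x δ, dist y x ≤ δ * cellDiam S := fun y hy => by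
      simpa [abs_of_pos hδ0] using dist_scaledCell_le hxS hy
    have hY : ∀ y ∈ scaledCell T x (e * δ), dist y x ≤ δ * cellDiam T := fun y hy => by
      simpa only [heδ] using dist_scaledCell_le hxT hy
    have hX' : ∀ y ∈ scaledCell S x δ, dist y x < 2 * R * δ := fun y hy =>
      (hX y hy).trans_lt (by nlinarith [mul_pos hδ0 hS0, mul_pos hδ0 hT0])
    have hY' : ∀ y ∈ scaledCell T x (e * δ), dist y x < 2 * R * δ := fun y hy =>
      (hY y hy).trans_lt (by nlinarith [mul_pos hδ0 hS0, mul_pos hδ0 hT0])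
    have hBO : Metric.ball x (2 * R * δ) ⊆ O := (Metric.ball_subset_ball hδr.le).trans hrO
    have hne : e * δ ≠ 0 := fun h0 => by rw [h0, abs_zero] at heδ; exact hδ0.ne heδ
    have hmX := measurableSet_scaledCell S x hδ0.ne'
    have hmY := measurableSet_scaledCell T x hne
    have hvX : volume (scaledCell S x δ) = ENNReal.ofReal (δ ^ d * vol S) := by
      rw [volume_scaledCell, abs_of_pos hδ0]
    have hvY : volume (scaledCell T x (e * δ)) = ENNReal.ofReal (δ ^ d * vol T) := by
      rw [volume_scaledCell, heδ]
    have hgG : ∫⁻ z in Metric.ball x (2 * R * δ), ‖g z‖ₑ ^ 2 ≤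
        ENNReal.ofReal (M ^ 2 * ((2 * R * δ) ^ d * ballVol d)) := by
      rw [ENNReal.ofReal_mul (by positivity), ← volume_closedBall x (by positivity)]
      calc _ ≤ ∫⁻ _ in Metric.ball x (2 * R * δ), ENNReal.ofReal (M ^ 2) := by
            refine setLIntegral_mono_ae' measurableSet_ball ?_
            filter_upwards [hgM] with y hy hyB
            rw [enorm_norm_sq]
            have := hy (hBO hyB)
            gcongr
        _ ≤ _ := by
            rw [setLIntegral_const]
            gcongr
            exact Metric.ball_subset_closedBall
    have := jump_le Metric.isOpen_ball (convex_ball x _) hum hu hg (h.mono hBO) hmX hmY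
      (fun y hy => Metric.mem_ball.2 (hX' y hy)) (fun y hy => Metric.mem_ball.2 (hY' y hy))
      (ρ := 2 * R * δ) (by positivity)
      (fun y hy z hz => (dist_triangle_right y z x).trans (by
        have h1 := hX y hy
        have h2 := hY z hz
        nlinarith [mul_pos hδ0 hS0, mul_pos hδ0 hT0]))
      (by positivity) (by positivity) (by positivity) (by positivity) (by positivity) hvX hvY
      (lintegral_sub_sq_le_of_lipschitz p hmX (L := L)
        (le_add_of_nonneg_right (norm_nonneg _)) hvX (fun y hy => (hX' y hy).le) hpδ)
      (lintegral_sub_sq_le_of_lipschitz q hmY (L := L)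
        (le_add_of_nonneg_left (norm_nonneg _)) hvY (fun y hy => (hY' y hy).le) hqδ) hgG
    have hpow : 0 < δ ^ d * δ ^ d := by positivity
    refine le_of_mul_le_mul_left ?_ hpow
    calc _ = _ := ?_
      _ ≤ _ := this
      _ = _ := ?_
    · ring
    · simp only [hC]; ring_nf
  have hlim : Tendsto (fun δ : ℝ => C * δ ^ 2) (𝓝[>] 0) (𝓝 (C * 0 ^ 2)) := by
    have hc : Continuous fun δ : ℝ => C * δ ^ 2 := by fun_prop
    exact (hc.tendsto 0).mono_left nhdsWithin_le_nhds
  have h0 := ge_of_tendsto hlim key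
  have h1 : (p x - q x) ^ 2 ≤ 0 := by
    have : 0 < vol S * vol T := by positivity
    nlinarith
  nlinarith [sq_nonneg (p x - q x)]

theorem IsFace.notMem_interior_of_mem_scaledCell {d : ℕ} {T f : Finset (E d)} {a : E d}
    (h : IsFace T f a) {x : E d} (hx : x ∈ conv f) {δ : ℝ} (hδ : δ < 0) {y : E d}
    (hy : y ∈ scaledCell T x δ) : y ∉ interior (conv T) := by
  obtain ⟨w, hw, rfl⟩ := hy
  intro hy
  have h1 := (mem_interior_conv_iff h.simplex).1 hy a h.apex_mem
  have h2 := (mem_interior_conv_iff h.simplex).1 hw a h.apex_mem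
  rw [affineMap_homothety, h.bary_apex hx] at h1
  nlinarith

namespace Mesh

variable {d : ℕ} {Ω γ : Set (E d)} (𝒯 : Mesh Ω)

theorem ae_snd_eq_affGrad (hΩo : IsOpen Ω) (hΩ : interior (closure Ω) = Ω) {z : L2pair Ω}
    (hz : z ∈ H10 Ω γ) {T : Finset (E d)} (hT : T ∈ 𝒯.cells) {p : E d →ᵃ[ℝ] ℝ}
    (hp : ∀ᵐ x ∂(mu Ω), x ∈ conv T → z.fst x = p x) :
    ∀ᵐ x, x ∈ interior (conv T) → z.snd x = affGrad p := by
  have hTΩ := 𝒯.interior_conv_subset hΩ hT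
  have h := ((localWeakGrad_of_mem_H10 hΩo hz).mono hTΩ).ae_eq_affGrad isOpen_interior
    (memLp_indicator hΩo.measurableSet subset_rfl _) p ?_
  · filter_upwards [h] with x hx hxT
    rw [← hx hxT, indicator_of_mem (hTΩ hxT)]
  · filter_upwards [(ae_restrict_iff' hΩo.measurableSet).1 hp] with x hx hxT
    rw [indicator_of_mem (hTΩ hxT), hx (hTΩ hxT) (interior_subset hxT)]

theorem adjacent_subset {S T f : Finset (E d)} {a b : E d} (hd : 1 ≤ d)
    (hΩ : interior (closure Ω) = Ω) (hS : S ∈ 𝒯.cells) (hT : T ∈ 𝒯.cells)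
    (h : IsAdjacent S T f a b) : faceCone S f ∩ faceCone T f ⊆ Ω := by
  rw [← hΩ]
  refine interior_maximal ((h.faceCone_inter_subset hd).trans
    (union_subset (𝒯.conv_subset_closure hS) (𝒯.conv_subset_closure hT)))
    ((isOpen_faceCone S f).inter (isOpen_faceCone T f))

theorem eq_of_isAdjacent (hd : 1 ≤ d) (hΩo : IsOpen Ω) (hΩ : interior (closure Ω) = Ω)
    {z : L2pair Ω} (hz : z ∈ H10 Ω γ) {S T f : Finset (E d)} {a b : E d} (hS : S ∈ 𝒯.cells)
    (hT : T ∈ 𝒯.cells) (h : IsAdjacent S T f a b) {p q : E d →ᵃ[ℝ] ℝ}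
    (hp : ∀ᵐ x ∂(mu Ω), x ∈ conv S → z.fst x = p x)
    (hq : ∀ᵐ x ∂(mu Ω), x ∈ conv T → z.fst x = q x) {x : E d} (hx : x ∈ conv f)
    (hx0 : ∀ v ∈ f, 0 < bary S v x) : p x = q x := by
  have hm := hΩo.measurableSet
  have hsub := 𝒯.adjacent_subset hd hΩ hS hT h
  have hxS := h.left.conv_subset hx
  have hxT := h.right.conv_subset hx
  have aux : ∀ {A : Finset (E d)} (_ : A ∈ 𝒯.cells) (_ : x ∈ conv A) {r : E d →ᵃ[ℝ] ℝ}
      (_ : ∀ᵐ x ∂(mu Ω), x ∈ conv A → z.fst x = r x), ∀ᶠ δ in 𝓝[>] (0 : ℝ),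
      ∀ᵐ y, y ∈ scaledCell A x δ → Ω.indicator z.fst y = r y := by
    intro A hA hxA r hr
    filter_upwards [Ioc_mem_nhdsGT (zero_lt_one' ℝ)] with δ hδ
    filter_upwards [(ae_restrict_iff' hm).1 hr] with y hy hyA
    have hyA' := scaledCell_subset_interior (𝒯.isSimplex hA) hxA hδ.1 hδ.2 hyA
    have hyΩ := 𝒯.interior_conv_subset hΩ hA hyA'
    rw [indicator_of_mem hyΩ, hy hyΩ (interior_subset hyA')]
  refine eq_of_weakGrad_bounded hd ((isOpen_faceCone S f).inter (isOpen_faceCone T f))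
    (measurable_indicator_Lp hm z.fst) (memLp_indicator hm subset_rfl z.fst)
    (memLp_indicator hm subset_rfl z.snd) ((localWeakGrad_of_mem_H10 hΩo hz).mono hsub)
    (M := ‖affGrad p‖ + ‖affGrad q‖) ?_ (𝒯.isSimplex hS) (𝒯.isSimplex hT)
    ⟨hx0, fun v hv => h.bary_eq hx v ▸ hx0 v hv⟩ hxS hxT (abs_one) (aux hS hxS hp)
    (by simpa only [one_mul] using aux hT hxT hq)
  filter_upwards [𝒯.ae_snd_eq_affGrad hΩo hΩ hz hS hp, 𝒯.ae_snd_eq_affGrad hΩo hΩ hz hT hq,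
    (interior_conv_ae_eq S).mem_iff, (interior_conv_ae_eq T).mem_iff] with y h1 h2 h3 h4 hy
  rw [indicator_of_mem (hsub hy)]
  rcases h.faceCone_inter_subset hd hy with hyS | hyT
  · rw [h1 (h3.2 hyS)]; exact le_add_of_nonneg_right (norm_nonneg _)
  · rw [h2 (h4.2 hyT)]; exact le_add_of_nonneg_left (norm_nonneg _)

/-- The extension of z from T by zero is weakly differentiable across f. Comparing T with its
reflection through x, which is outside the interior of T, compares p with zero. -/
theorem eq_zero_of_isFace (hd : 1 ≤ d) (hΩo : IsOpen Ω) (hΩ : interior (closure Ω) = Ω)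
    {z : L2pair Ω} (hz : z ∈ H10 Ω γ) {T f : Finset (E d)} {a : E d} (hT : T ∈ 𝒯.cells)
    (h : IsFace T f a) (hfγ : conv f ⊆ γ) {p : E d →ᵃ[ℝ] ℝ}
    (hp : ∀ᵐ x ∂(mu Ω), x ∈ conv T → z.fst x = p x) {x : E d} (hx : x ∈ conv f)
    (hx0 : ∀ v ∈ f, 0 < bary T v x) : p x = 0 := by
  have hTΩ := 𝒯.interior_conv_subset hΩ hT
  have hm : MeasurableSet (interior (conv T)) := measurableSet_interior
  have hxT := h.conv_subset hx
  refine eq_of_weakGrad_bounded hd (isOpen_faceCone T f)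
    (measurable_indicator_Lp hm z.fst) (memLp_indicator hm hTΩ z.fst)
    (memLp_indicator hm hTΩ z.snd) (localWeakGrad_faceCone hΩo h hTΩ hfγ hz)
    (M := ‖affGrad p‖) ?_ (𝒯.isSimplex hT) (𝒯.isSimplex hT)
    hx0 hxT hxT (e := -1) (by simp) (q := 0) ?_ ?_
  · filter_upwards [𝒯.ae_snd_eq_affGrad hΩo hΩ hz hT hp] with y hy _
    by_cases hyT : y ∈ interior (conv T)
    · rw [indicator_of_mem hyT, hy hyT]
    · rw [indicator_of_notMem hyT, norm_zero]; exact norm_nonneg _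
  · filter_upwards [Ioc_mem_nhdsGT (zero_lt_one' ℝ)] with δ hδ
    filter_upwards [(ae_restrict_iff' hΩo.measurableSet).1 hp] with y hy hyA
    have hyA' := scaledCell_subset_interior (𝒯.isSimplex hT) hxT hδ.1 hδ.2 hyA
    rw [indicator_of_mem hyA', hy (hTΩ hyA') (interior_subset hyA')]
  · filter_upwards [self_mem_nhdsWithin] with δ hδ
    refine Eventually.of_forall fun y hy => ?_
    rw [indicator_of_notMem (h.notMem_interior_of_mem_scaledCell hx (δ := -1 * δ) ?_ hy)]
    · rfl
    · simpa using hδ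

end Mesh

end OpPrec

/-! ### Finiteness of the interpolation norm, and nodal expansions -/

namespace OpPrec

theorem K_le_enorm {d : ℕ} (Ω γ : Set (E d)) (t : ℝ) (u : L2 Ω) : K Ω γ t u ≤ ‖u‖ₑ := by
  refine (iInf_le _ (0 : H10 Ω γ)).trans ?_
  rw [enorm_zero (E := H10 Ω γ)]
  simp

theorem K_le_mul_enorm {d : ℕ} {Ω γ : Set (E d)} (t : ℝ) (y : H10 Ω γ) :
    K Ω γ t (y : L2pair Ω).fst ≤ ENNReal.ofReal t * ‖y‖ₑ :=
  (iInf_le _ y).trans (by simp)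

/-- K(t, u) is at most t ‖y‖ and at most ‖u‖. Using the first for t ≤ 1 and the second for t > 1,
the integrand is dominated by multiples of t^(1-2s) and t^(-1-2s), both integrable for 0 < s < 1. -/
theorem interpNorm_fst_lt_top {d : ℕ} {Ω γ : Set (E d)} {s : ℝ} (hs : s ∈ Icc (0 : ℝ) 1)
    (y : H10 Ω γ) : interpNorm Ω γ s (y : L2pair Ω).fst < ⊤ := by
  unfold interpNorm
  split_ifs with h0 h1
  · exact enorm_lt_top
  · exact lt_of_le_of_lt ((iInf_le _ y).trans (iInf_le _ rfl)) (enorm_lt_top (x := y))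
  have hs0 : 0 < s := lt_of_le_of_ne hs.1 (Ne.symm h0)
  have hs1 : s < 1 := lt_of_le_of_ne hs.2 h1
  refine ENNReal.rpow_lt_top_of_nonneg (by norm_num) (ne_of_lt ?_)
  set u := (y : L2pair Ω).fst
  have hmeas : Measurable fun t : ℝ => ENNReal.ofReal t⁻¹ := by fun_prop
  refine (lintegral_withDensity_le_lintegral_mul _ hmeas _).trans_lt ?_
  have hsplit : (Ioi (0 : ℝ)) = Ioc 0 1 ∪ Ioi 1 := (Ioc_union_Ioi_eq_Ioi zero_le_one).symm
  rw [hsplit]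
  refine (lintegral_union_le _ _ _).trans_lt (ENNReal.add_lt_top.2 ⟨?_, ?_⟩)
  · have hint : IntegrableOn (fun t : ℝ => t ^ (1 - 2 * s)) (Ioc 0 1) :=
      (intervalIntegrable_iff_integrableOn_Ioc_of_le zero_le_one).1
        (intervalIntegral.intervalIntegrable_rpow' (by linarith))
    calc _ ≤ ∫⁻ t in Ioc (0 : ℝ) 1, ‖y‖ₑ ^ 2 * ENNReal.ofReal (t ^ (1 - 2 * s)) := by
          refine setLIntegral_mono (by fun_prop) fun t ht => ?_
          have ht0 : 0 < t := ht.1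
          simp only [Pi.mul_apply, ENNReal.rpow_ofNat]
          calc _ ≤ ENNReal.ofReal t⁻¹ * (ENNReal.ofReal (t ^ (-s)) *
                (ENNReal.ofReal t * ‖y‖ₑ)) ^ 2 := by gcongr; exact K_le_mul_enorm t y
            _ = ‖y‖ₑ ^ 2 * (ENNReal.ofReal t⁻¹ * (ENNReal.ofReal (t ^ (-s)) *
                ENNReal.ofReal t) ^ 2) := by ring
            _ = _ := by
              rw [← ENNReal.ofReal_mul (by positivity), ← ENNReal.ofReal_pow (by positivity),
                ← ENNReal.ofReal_mul (by positivity)]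
              congr 2
              have e1 : t ^ (1 - 2 * s) = t * (t ^ (-s)) ^ 2 := by
                rw [← Real.rpow_natCast, ← Real.rpow_mul ht0.le, sub_eq_add_neg,
                  Real.rpow_add ht0, Real.rpow_one]
                congr 2; push_cast; ring
              rw [e1]; field_simp
      _ = ‖y‖ₑ ^ 2 * ∫⁻ t in Ioc (0 : ℝ) 1, ENNReal.ofReal (t ^ (1 - 2 * s)) :=
          lintegral_const_mul' _ _ (by simp)
      _ < ⊤ := ENNReal.mul_lt_top (by simp) (by
          rw [← ofReal_integral_eq_lintegral_ofReal hint]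
          · exact ENNReal.ofReal_lt_top
          · filter_upwards [ae_restrict_mem measurableSet_Ioc] with t ht
            exact Real.rpow_nonneg ht.1.le _)
  · have hint : IntegrableOn (fun t : ℝ => t ^ (-1 - 2 * s)) (Ioi 1) :=
      integrableOn_Ioi_rpow_of_lt (by linarith) zero_lt_one
    calc _ ≤ ∫⁻ t in Ioi (1 : ℝ), ‖u‖ₑ ^ 2 * ENNReal.ofReal (t ^ (-1 - 2 * s)) := by
          refine setLIntegral_mono (by fun_prop) fun t ht => ?_
          have ht0 : 0 < t := zero_lt_one.trans ht
          simp only [Pi.mul_apply, ENNReal.rpow_ofNat]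
          calc _ ≤ ENNReal.ofReal t⁻¹ * (ENNReal.ofReal (t ^ (-s)) * ‖u‖ₑ) ^ 2 := by
                gcongr; exact K_le_enorm Ω γ t u
            _ = ‖u‖ₑ ^ 2 * (ENNReal.ofReal t⁻¹ * (ENNReal.ofReal (t ^ (-s))) ^ 2) := by ring
            _ = _ := by
              rw [← ENNReal.ofReal_pow (by positivity), ← ENNReal.ofReal_mul (by positivity)]
              congr 2
              have e1 : t ^ (-1 - 2 * s) = t⁻¹ * (t ^ (-s)) ^ 2 := by
                rw [← Real.rpow_natCast, ← Real.rpow_mul ht0.le, sub_eq_add_neg,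
                  Real.rpow_add ht0, Real.rpow_neg_one]
                congr 2; push_cast; ring
              rw [e1]
      _ = ‖u‖ₑ ^ 2 * ∫⁻ t in Ioi (1 : ℝ), ENNReal.ofReal (t ^ (-1 - 2 * s)) :=
          lintegral_const_mul' _ _ (by simp)
      _ < ⊤ := ENNReal.mul_lt_top (by simp) (by
          rw [← ofReal_integral_eq_lintegral_ofReal hint]
          · exact ENNReal.ofReal_lt_top
          · filter_upwards [ae_restrict_mem measurableSet_Ioi] with t ht
            exact Real.rpow_nonneg (zero_lt_one.trans ht).le _)

/-- The face equations hold only in the relative interior; two of its points, the center and the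
midpoint between the center and v, determine the value at v by affinity. -/
theorem IsFace.eq_zero_of_mem {d : ℕ} (hd : 1 ≤ d) {T f : Finset (E d)} {a : E d}
    (h : IsFace T f a) {q : E d →ᵃ[ℝ] ℝ}
    (hq : ∀ x ∈ conv f, (∀ v ∈ f, 0 < bary T v x) → q x = 0) {v : E d} (hv : v ∈ f) :
    q v = 0 := by
  have hd0 : (0 : ℝ) < (d : ℝ)⁻¹ := by positivity
  have hm := faceCenter_mem hd h.card
  have h1 := hq _ hm fun w hw => by rw [h.bary_faceCenter hd hw]; exact hd0
  have h2 := hq (AffineMap.homothety v (1 / 2 : ℝ) (faceCenter f)) ?_ ?_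
  · rw [affineMap_homothety, h1] at h2
    linarith
  · rw [AffineMap.homothety_eq_lineMap]
    exact (convex_conv f).lineMap_mem (mem_conv_of_mem hv) hm ⟨by norm_num, by norm_num⟩
  · intro w hw
    rw [affineMap_homothety, h.bary_faceCenter hd hw]
    have := bary_nonneg h.simplex (h.conv_subset (mem_conv_of_mem hv)) w
    linarith

namespace Mesh

variable {d : ℕ} {Ω γ : Set (E d)} (𝒯 : Mesh Ω)

theorem exists_isFace_of_mem (hγ : 𝒯.IsUnionOfFaces γ) {ν : E d} (hν : ν ∈ γ)
    {T : Finset (E d)} (hT : T ∈ 𝒯.cells) (hνT : ν ∈ T) :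
    ∃ S ∈ 𝒯.cells, ∃ f a, IsFace S f a ∧ ν ∈ f ∧ conv f ⊆ γ := by
  obtain ⟨F, hF, rfl⟩ := hγ
  obtain ⟨f, hf, hνf⟩ := mem_iUnion₂.1 hν
  obtain ⟨hcard, S, hS, hfS⟩ := hF f hf
  obtain ⟨a, ha⟩ := exists_isFace (𝒯.isSimplex hS) hfS hcard
  refine ⟨S, hS, f, a, ha, ?_, fun x hx => mem_iUnion₂.2 ⟨f, hf, hx⟩⟩
  have hνS := 𝒯.mem_of_mem_conv hT hS hνT (ha.conv_subset hνf)
  by_contra hcon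
  have h0 := bary_eq_zero_of_mem_face (𝒯.isSimplex hS) (Finset.coe_subset.2 hfS) hνf
    (v := ν) (by simpa using hcon)
  rw [bary_self (𝒯.isSimplex hS) hνS] at h0
  exact one_ne_zero h0

/-- Across each common face the affine pieces agree at ν, so the chain estimate applies with β = 0.
-/
theorem nodal_value_eq (hd : 1 ≤ d) (hΩo : IsOpen Ω) (hΩ : interior (closure Ω) = Ω)
    {z : L2pair Ω} (hz : z ∈ H10 Ω γ) {p : Finset (E d) → E d →ᵃ[ℝ] ℝ}
    (hp : ∀ T ∈ 𝒯.cells, ∀ᵐ x ∂(mu Ω), x ∈ conv T → z.fst x = p T x) {ν : E d}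
    {S T : Finset (E d)} (hS : S ∈ 𝒯.star ν) (hT : T ∈ 𝒯.star ν) : p S ν = p T ν := by
  have h := 𝒯.star_abs_sub_le (ν := ν) le_rfl (F := fun A => p A ν) le_rfl ?_ hS hT
  · rw [mul_zero] at h
    exact sub_eq_zero.1 (abs_nonpos_iff.1 h)
  · intro A hA B hB hAB
    obtain ⟨hA, hνA⟩ := 𝒯.mem_star.1 hA
    obtain ⟨hB, hνB⟩ := 𝒯.mem_star.1 hB
    obtain ⟨f, a, b, hadj, hf⟩ := 𝒯.exists_isAdjacent hA hB hAB
    have h0 : (p A - p B) ν = 0 :=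
      hadj.left.eq_zero_of_mem hd (fun x hx hx0 => sub_eq_zero.2
        (𝒯.eq_of_isAdjacent hd hΩo hΩ hz hA hB hadj (hp A hA) (hp B hB) hx hx0))
        ((hf ν).2 ⟨hνA, hνB⟩)
    rw [show p A ν - p B ν = 0 from h0, abs_zero]

theorem nodal_value_eq_zero (hd : 1 ≤ d) (hΩo : IsOpen Ω) (hΩ : interior (closure Ω) = Ω)
    (hγ : 𝒯.IsUnionOfFaces γ)
    {z : L2pair Ω} (hz : z ∈ H10 Ω γ) {p : Finset (E d) → E d →ᵃ[ℝ] ℝ}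
    (hp : ∀ T ∈ 𝒯.cells, ∀ᵐ x ∂(mu Ω), x ∈ conv T → z.fst x = p T x) {ν : E d} (hν : ν ∈ γ)
    {T : Finset (E d)} (hT : T ∈ 𝒯.star ν) : p T ν = 0 := by
  obtain ⟨hTc, hνT⟩ := 𝒯.mem_star.1 hT
  obtain ⟨S, hS, f, a, hf, hνf, hfγ⟩ := 𝒯.exists_isFace_of_mem hγ hν hTc hνT
  rw [𝒯.nodal_value_eq hd hΩo hΩ hz hp hT (𝒯.mem_star.2 ⟨hS, hf.subset hνf⟩)]
  exact hf.eq_zero_of_mem hd (fun x hx hx0 =>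
    𝒯.eq_zero_of_isFace hd hΩo hΩ hz hS hf hfγ (hp S hS) hx hx0) hνf

theorem finite_freeVertices : (𝒯.freeVertices γ).Finite := by
  classical
  refine (𝒯.cells.biUnion id).finite_toSet.subset fun ν hν => ?_
  obtain ⟨⟨T, hT, hνT⟩, -⟩ := hν
  exact Finset.mem_coe.2 (Finset.mem_biUnion.2 ⟨T, hT, hνT⟩)

instance : Finite (𝒯.freeVertices γ) := 𝒯.finite_freeVertices

instance : Fintype (𝒯.freeVertices γ) := Fintype.ofFinite _

theorem sum_freeVertices_eq {T : Finset (E d)} (hT : T ∈ 𝒯.cells) (F : E d → ℝ)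
    (hF : ∀ v, v ∉ T ∨ v ∈ γ → F v = 0) :
    ∑ ν : 𝒯.freeVertices γ, F ν = ∑ v ∈ T, F v := by
  classical
  rw [Finset.sum_set_coe (𝒯.freeVertices γ) (f := F)]
  refine Finset.sum_congr_of_eq_on_inter (fun v _ hv => hF v (Or.inl hv))
    (fun v hv hv' => ?_) fun _ _ _ => rfl
  by_cases hvγ : v ∈ γ
  · exact hF v (Or.inr hvγ)
  · have hmem : v ∈ 𝒯.freeVertices γ := ⟨⟨T, hT, hv⟩, hvγ⟩
    exact absurd (mem_toFinset.2 hmem) hv'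

/-- The affine pieces have a single value at each vertex, which is zero on γ; on each cell the
function is then its barycentric interpolant. -/
theorem exists_nodal_values (hd : 1 ≤ d) (hΩo : IsOpen Ω) (hΩ : interior (closure Ω) = Ω)
    (hγ : 𝒯.IsUnionOfFaces γ) {z : L2pair Ω} (hz : z ∈ H10 Ω γ)
    (hp : ∀ T ∈ 𝒯.cells, ∃ p : E d →ᵃ[ℝ] ℝ, ∀ᵐ x ∂(mu Ω), x ∈ conv T → z.fst x = p x) :
    ∃ c : 𝒯.freeVertices γ → ℝ, z.fst =ᵐ[mu Ω] fun x => ∑ ν, c ν * 𝒯.hat ν x := by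
  classical
  choose! p hp using hp
  have hsel : ∀ ν, ∃ c : ℝ, (ν ∈ γ → c = 0) ∧ ∀ T ∈ 𝒯.star ν, p T ν = c := by
    intro ν
    by_cases hν : ν ∈ γ
    · exact ⟨0, fun _ => rfl, fun T hT => 𝒯.nodal_value_eq_zero hd hΩo hΩ hγ hz hp hν hT⟩
    · rcases (𝒯.star ν).eq_empty_or_nonempty with h | ⟨S, hS⟩
      · exact ⟨0, fun _ => rfl, fun T hT => by simp [h] at hT⟩
      · exact ⟨p S ν, fun h => absurd h hν,
          fun T hT => 𝒯.nodal_value_eq hd hΩo hΩ hz hp hT hS⟩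
  choose c hc0 hc using hsel
  refine ⟨fun ν => c ν, ?_⟩
  have hall : ∀ᵐ x ∂(mu Ω), ∀ T ∈ 𝒯.cells, x ∈ conv T → z.fst x = p T x :=
    (ae_ball_iff 𝒯.cells.countable_toSet).2 hp
  filter_upwards [hall, 𝒯.ae_mem_cells hΩo hΩ] with x hx hxc
  obtain ⟨T, hT, hxT⟩ := hxc
  have hxT' := interior_subset hxT
  rw [hx T hT hxT', affineMap_eq_sum_bary (𝒯.isSimplex hT),
    𝒯.sum_freeVertices_eq hT (fun v => c v * 𝒯.hat v x)]
  · refine Finset.sum_congr rfl fun v hv => ?_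
    rw [𝒯.hat_eq_bary hT hxT', hc v T (𝒯.mem_star.2 ⟨hT, hv⟩), mul_comm]
  · rintro v (hv | hv)
    · rw [𝒯.hat_eq_bary hT hxT', bary_of_notMem hv]; exact mul_zero _
    · rw [hc0 v hv, zero_mul]

end Mesh

end OpPrec

/-! ### Jump estimates with uniform constants -/

namespace OpPrec

/-- `∫_X |f|²`. -/
def sqInt {d : ℕ} {F : Type*} [NormedAddCommGroup F] (X : Set (E d)) (f : E d → F) : ℝ :=
  (∫⁻ x in X, ‖f x‖ₑ ^ 2).toReal

section sqInt

variable {d : ℕ} {F : Type*} [NormedAddCommGroup F] {X Y : Set (E d)} {f : E d → F}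

theorem sqInt_nonneg (X : Set (E d)) (f : E d → F) : 0 ≤ sqInt X f := ENNReal.toReal_nonneg

theorem ofReal_sqInt (hf : MemLp f 2 (volume.restrict X)) :
    ENNReal.ofReal (sqInt X f) = ∫⁻ x in X, ‖f x‖ₑ ^ 2 :=
  ENNReal.ofReal_toReal (MemLp.lintegral_sq_lt_top hf).ne

theorem sqInt_le_of_le {B : ℝ} (hB : 0 ≤ B) (h : ∫⁻ x in X, ‖f x‖ₑ ^ 2 ≤ ENNReal.ofReal B) :
    sqInt X f ≤ B :=
  ENNReal.toReal_le_of_le_ofReal hB h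

theorem sqInt_mono (hf : MemLp f 2 (volume.restrict Y)) (h : X ⊆ Y) : sqInt X f ≤ sqInt Y f :=
  ENNReal.toReal_mono (MemLp.lintegral_sq_lt_top hf).ne (lintegral_mono_set h)

theorem memLp_sub_const {u : E d → ℝ} (hX : volume X ≠ ⊤) (hu : MemLp u 2 (volume.restrict X))
    (a : ℝ) : MemLp (fun x => u x - a) 2 (volume.restrict X) := by
  have : IsFiniteMeasure (volume.restrict X) := ⟨by simpa using hX.lt_top⟩
  exact hu.sub (memLp_const a)

theorem sqInt_sub_const_le {u : E d → ℝ} {v : ℝ} (hv : 0 ≤ v)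
    (hX : volume X = ENNReal.ofReal v) (hu : MemLp u 2 (volume.restrict X)) (a b : ℝ) :
    sqInt X (fun x => u x - a) ≤ 2 * (sqInt X (fun x => u x - b) + v * (b - a) ^ 2) := by
  have hXt : volume X ≠ ⊤ := by rw [hX]; exact ENNReal.ofReal_ne_top
  have h0 := sqInt_nonneg X (fun x => u x - b)
  refine sqInt_le_of_le (by positivity) ?_
  rw [ENNReal.ofReal_mul (by norm_num), ENNReal.ofReal_add h0 (by positivity),
    ofReal_sqInt (memLp_sub_const hXt hu b), ENNReal.ofReal_mul hv, ← hX,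
    show ENNReal.ofReal 2 = 2 by norm_num, mul_comm (volume X), ← setLIntegral_const,
    ← lintegral_add_right _ measurable_const, ← lintegral_const_mul' _ _ (by norm_num)]
  refine lintegral_mono fun x => ?_
  dsimp only
  rw [enorm_sq, enorm_sq, ← ENNReal.ofReal_add (by positivity) (by positivity),
    show (2 : ℝ≥0∞) = ENNReal.ofReal 2 by norm_num, ← ENNReal.ofReal_mul (by norm_num)]
  refine ENNReal.ofReal_le_ofReal ?_
  nlinarith [sq_nonneg (u x - b - (b - a))]

theorem sqInt_congr (hX : MeasurableSet X) {g : E d → F} (h : ∀ x ∈ X, f x = g x) :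
    sqInt X f = sqInt X g := by
  unfold sqInt
  rw [setLIntegral_congr_fun hX fun x hx => by rw [h x hx]]

theorem sqInt_indicator_le {Y : Set (E d)} (hY : MeasurableSet Y)
    (hf : MemLp f 2 (volume.restrict Y)) : sqInt X (Y.indicator f) ≤ sqInt Y f := by
  refine ENNReal.toReal_mono (MemLp.lintegral_sq_lt_top hf).ne ?_
  calc _ ≤ ∫⁻ x, ‖Y.indicator f x‖ₑ ^ 2 := setLIntegral_le_lintegral _ _
    _ = ∫⁻ x, Y.indicator (fun x => ‖f x‖ₑ ^ 2) x := by
      refine lintegral_congr fun x => ?_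
      by_cases hx : x ∈ Y <;> simp [hx]
    _ = _ := lintegral_indicator hY _

end sqInt

/-- In the applications w is diam T ^ d, x and y are volumes of cells, e is the volume factor of the
scaled copies, J is the squared jump, and K is diam T ^ 2 times the gradient energy around the
vertex. -/
theorem jump_arith {w e x y J A B R L M p r K : ℝ} (hw : 0 < w) (he : 0 < e) (he1 : e ≤ 1)
    (hL : 0 ≤ L) (hK : 0 ≤ K) (hp : 0 ≤ p) (hJ : 0 ≤ J) (hx0 : 0 ≤ x) (hy0 : 0 ≤ y)
    (hx : w ≤ L * x) (hy : w ≤ L * y) (hxM : x ≤ M * w) (hyM : y ≤ M * w) (hA : A ≤ p * K)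
    (hB : B ≤ p * K) (hR : R ≤ r * (w * K))
    (h : (e * x) * (e * y) * J ≤ 3 * (e * y * A + R + e * x * B)) :
    w * J ≤ 3 * (L / e) ^ 2 * (2 * M * p + r) * K := by
  have h1 : e * y * A ≤ M * w * (p * K) := by
    calc _ ≤ e * y * (p * K) := by gcongr
      _ ≤ 1 * (M * w) * (p * K) := by gcongr
      _ = _ := by ring
  have h2 : e * x * B ≤ M * w * (p * K) := by
    calc _ ≤ e * x * (p * K) := by gcongr
      _ ≤ 1 * (M * w) * (p * K) := by gcongr
      _ = _ := by ring
  refine le_of_mul_le_mul_left ?_ hw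
  calc w * (w * J) = w * w * J := by ring
    _ ≤ (L * x) * (L * y) * J := by gcongr
    _ = (L / e) ^ 2 * ((e * x) * (e * y) * J) := by field_simp
    _ ≤ (L / e) ^ 2 * (3 * (M * w * (p * K) + r * (w * K) + M * w * (p * K))) :=
        mul_le_mul_of_nonneg_left (h.trans (mul_le_mul_of_nonneg_left
          (add_le_add (add_le_add h1 hR) h2) (by norm_num))) (sq_nonneg _)
    _ = _ := by ring

theorem jump_sqInt_le {d : ℕ} {O : Set (E d)} (hO : IsOpen O) (hconv : Convex ℝ O) {u : E d → ℝ}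
    {g : E d → E d} (hum : Measurable u) (hu : MemLp u 2 volume) (hg : MemLp g 2 volume)
    (h : LocalWeakGrad O u g) {X Y : Set (E d)} (hX : MeasurableSet X) (hY : MeasurableSet Y)
    (hXO : X ⊆ O) (hYO : Y ⊆ O) {ρ : ℝ} (hρ : 0 ≤ ρ) (hdist : ∀ x ∈ X, ∀ y ∈ Y, dist x y ≤ ρ)
    {x y : ℝ} (hx : 0 ≤ x) (hy : 0 ≤ y) (a b : ℝ)
    (hvX : volume X = ENNReal.ofReal x) (hvY : volume Y = ENNReal.ofReal y) :
    x * y * (a - b) ^ 2 ≤ 3 * (y * sqInt X (fun z => u z - a) +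
      ρ ^ (d + 2) * ballVol d * sqInt O g + x * sqInt Y (fun z => u z - b)) := by
  have hXt : volume X ≠ ⊤ := by rw [hvX]; exact ENNReal.ofReal_ne_top
  have hYt : volume Y ≠ ⊤ := by rw [hvY]; exact ENNReal.ofReal_ne_top
  exact jump_le hO hconv hum hu hg h hX hY hXO hYO hρ hdist hx hy (sqInt_nonneg _ _)
    (sqInt_nonneg _ _) (sqInt_nonneg _ _) hvX hvY
    (ofReal_sqInt (memLp_sub_const hXt (hu.restrict _) a)).ge
    (ofReal_sqInt (memLp_sub_const hYt (hu.restrict _) b)).ge (ofReal_sqInt (hg.restrict _)).ge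

theorem volume_interior_eq {d : ℕ} (T : Finset (E d)) :
    volume (interior (conv T)) = ENNReal.ofReal (vol T) := by
  rw [volume_interior_conv, ofReal_vol]

/-- The Poincaré bound for pairs on the convex set T, divided by |T|; shape regularity turns diam T
^ d / |T| into σ. -/
theorem exists_poincare_const {d : ℕ} {T : Finset (E d)} (hT : IsSimplex T)
    {σ : ℝ} (hσ : cellDiam T ^ d ≤ σ * vol T) {u : E d → ℝ} {g : E d → E d} (hum : Measurable u)
    (hu : MemLp u 2 volume) (hg : MemLp g 2 volume)
    (h : LocalWeakGrad (interior (conv T)) u g) :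
    ∃ c : ℝ, sqInt (interior (conv T)) (fun x => u x - c) ≤
      σ * ballVol d * cellDiam T ^ 2 * sqInt (interior (conv T)) g := by
  have hv := vol_pos hT
  have hV := volume_interior_eq T
  have hXt : volume (interior (conv T)) ≠ ⊤ := by rw [hV]; exact ENNReal.ofReal_ne_top
  have hX0 : volume (interior (conv T)) ≠ 0 := by
    rw [hV]; exact (ENNReal.ofReal_pos.2 hv).ne'
  have hD : 0 ≤ cellDiam T := Metric.diam_nonneg
  obtain ⟨c, hc⟩ := exists_lintegral_sub_sq_le hum hX0 hXt
  refine ⟨c, ?_⟩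
  have h1 := hc.trans (poincare_pair isOpen_interior (convex_conv T).interior hum hu hg h
    measurableSet_interior measurableSet_interior subset_rfl subset_rfl hD
    fun x hx y hy => dist_le_cellDiam (interior_subset hx) (interior_subset hy))
  rw [hV, ← ofReal_sqInt (memLp_sub_const hXt (hu.restrict _) c), ← ofReal_sqInt (hg.restrict _),
    ← ENNReal.ofReal_mul hv.le, ← ENNReal.ofReal_mul
      (mul_nonneg (pow_nonneg hD _) (ballVol_pos d).le), ENNReal.ofReal_le_ofReal_iff
      (mul_nonneg (mul_nonneg (pow_nonneg hD _) (ballVol_pos d).le) (sqInt_nonneg _ _))] at h1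
  refine le_of_mul_le_mul_left (h1.trans ?_) hv
  have h2 : 0 ≤ cellDiam T ^ 2 * ballVol d * sqInt (interior (conv T)) g :=
    mul_nonneg (mul_nonneg (sq_nonneg _) (ballVol_pos d).le) (sqInt_nonneg _ _)
  calc _ = cellDiam T ^ d * (cellDiam T ^ 2 * ballVol d * sqInt (interior (conv T)) g) := by ring
    _ ≤ σ * vol T * (cellDiam T ^ 2 * ballVol d * sqInt (interior (conv T)) g) := by gcongr
    _ = _ := by ring

namespace Mesh

variable {d : ℕ} {Ω γ : Set (E d)} {𝒯 : Mesh Ω} {σ κ : ℝ} {N : ℕ}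

theorem Regular.pow_cellDiam_le (h : 𝒯.Regular σ κ N) (hκ : 0 ≤ κ) {ν : E d}
    {S T : Finset (E d)} (hS : S ∈ 𝒯.star ν) (hT : T ∈ 𝒯.star ν) :
    cellDiam T ^ d ≤ κ ^ d * σ * vol S := by
  have hS0 : 0 ≤ cellDiam T := Metric.diam_nonneg
  calc _ ≤ (κ * cellDiam S) ^ d := pow_le_pow_left₀ hS0 (h.comparable ν T hT S hS) d
    _ = κ ^ d * cellDiam S ^ d := mul_pow _ _ _
    _ ≤ κ ^ d * (σ * vol S) := by gcongr; exact h.shape S (𝒯.mem_star.1 hS).1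
    _ = _ := by ring

theorem Regular.vol_le (h : 𝒯.Regular σ κ N) {ν : E d}
    {S T : Finset (E d)} (hS : S ∈ 𝒯.star ν) (hT : T ∈ 𝒯.star ν) :
    vol S ≤ κ ^ d * ballVol d * cellDiam T ^ d := by
  have hS0 : 0 ≤ cellDiam S := Metric.diam_nonneg
  have hβ := (ballVol_pos d).le
  calc _ ≤ cellDiam S ^ d * ballVol d := OpPrec.vol_le (𝒯.isSimplex (𝒯.mem_star.1 hS).1)
    _ ≤ (κ * cellDiam T) ^ d * ballVol d := by gcongr; exact h.comparable ν S hS T hT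
    _ = _ := by ring

/-- The scaling factor of the cells next to a common face in the estimate of jumps. -/
def jumpScale (d : ℕ) (σ κ : ℝ) : ℝ := 1 / (2 * d * (σ * (3 ^ d * ballVol d) * κ + 1))

/-- The constant in the estimate of jumps. -/
def jumpConst (d : ℕ) (σ κ : ℝ) : ℝ :=
  3 * (κ ^ d * σ / jumpScale d σ κ ^ d) ^ 2 * (2 * (κ ^ d * ballVol d) *
    (σ * ballVol d * κ ^ 2) + 2 * ((2 * κ) ^ (d + 2) * ballVol d))

theorem jumpScale_mem (hd : 1 ≤ d) (hσ : 0 ≤ σ) (hκ : 0 ≤ κ) :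
    0 < jumpScale d σ κ ∧ jumpScale d σ κ ≤ 1 ∧
      jumpScale d σ κ * (σ * (3 ^ d * ballVol d) * κ) < (d : ℝ)⁻¹ := by
  have hβ := ballVol_pos d
  have hd' : (1 : ℝ) ≤ d := by exact_mod_cast hd
  have hΛ : 0 ≤ σ * (3 ^ d * ballVol d) * κ := by positivity
  unfold jumpScale
  set Λ := σ * (3 ^ d * ballVol d) * κ
  refine ⟨by positivity, ?_, ?_⟩
  · rw [div_le_one (by positivity)]
    nlinarith
  · rw [div_mul_eq_mul_div, one_mul, div_lt_iff₀ (by positivity)]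
    field_simp
    linarith

/-- `∑ ∫_T |g|²` over the cells `T` with vertex `ν`. -/
def starInt {F : Type*} [NormedAddCommGroup F] (𝒯 : Mesh Ω) (g : E d → F) (ν : E d) : ℝ :=
  ∑ T ∈ 𝒯.star ν, sqInt (interior (conv T)) g

theorem starInt_nonneg {F : Type*} [NormedAddCommGroup F] (𝒯 : Mesh Ω) (g : E d → F) (ν : E d) :
    0 ≤ 𝒯.starInt g ν :=
  Finset.sum_nonneg fun _ _ => sqInt_nonneg _ _

theorem sqInt_le_starInt {F : Type*} [NormedAddCommGroup F] (g : E d → F) {ν : E d}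
    {T : Finset (E d)} (hT : T ∈ 𝒯.star ν) : sqInt (interior (conv T)) g ≤ 𝒯.starInt g ν :=
  Finset.single_le_sum (f := fun T => sqInt (interior (conv T)) g)
    (fun _ _ => sqInt_nonneg _ _) hT

/-- Small copies of A and B about the center of their common face lie in the convex set O ⊆ Ω, where
the jump estimate applies. T is a reference cell of the star, which gives all jumps around ν the
same scaling. -/
theorem Regular.mul_sq_le_of_isAdjacent (h : 𝒯.Regular σ κ N) (hd : 1 ≤ d) (hσ : 0 ≤ σ)
    (hκ : 0 ≤ κ) (hΩ : interior (closure Ω) = Ω) {u : E d → ℝ} {g : E d → E d}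
    (hum : Measurable u) (hu : MemLp u 2 volume) (hg : MemLp g 2 volume)
    (hug : LocalWeakGrad Ω u g) {c : Finset (E d) → ℝ}
    (hc : ∀ T ∈ 𝒯.cells, sqInt (interior (conv T)) (fun x => u x - c T) ≤
      σ * ballVol d * cellDiam T ^ 2 * sqInt (interior (conv T)) g) {ν : E d}
    {A B T : Finset (E d)} (hA : A ∈ 𝒯.star ν) (hB : B ∈ 𝒯.star ν) (hT : T ∈ 𝒯.star ν)
    (hAB : (A ∩ B : Set (E d)).ncard = d) :
    cellDiam T ^ d * (c A - c B) ^ 2 ≤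
      jumpConst d σ κ * (cellDiam T ^ 2 * 𝒯.starInt g ν) := by
  obtain ⟨hAc, -⟩ := 𝒯.mem_star.1 hA
  obtain ⟨hBc, -⟩ := 𝒯.mem_star.1 hB
  obtain ⟨f, a, b, hadj, -⟩ := 𝒯.exists_isAdjacent hAc hBc hAB
  obtain ⟨hδ, hδ1, hδM⟩ := jumpScale_mem hd hσ hκ
  set δ := jumpScale d σ κ with hδdef
  set m := faceCenter f
  have hm : m ∈ conv f := faceCenter_mem hd hadj.left.card
  have hmA := hadj.left.conv_subset hm
  have hmB := hadj.right.conv_subset hm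
  have hD : 0 < cellDiam T := cellDiam_pos hd (𝒯.isSimplex (𝒯.mem_star.1 hT).1)
  have hβ := ballVol_pos d
  set O := faceCone A f ∩ faceCone B f
  have hOΩ : O ⊆ Ω := 𝒯.adjacent_subset hd hΩ hAc hBc hadj
  have hO : IsOpen O := (isOpen_faceCone A f).inter (isOpen_faceCone B f)
  have hOc : Convex ℝ O := (convex_faceCone A f).inter (convex_faceCone B f)
  -- The S'-coordinates of the vertices of f equal 1/d at m and vary by at most M on S, as the
  -- diameters are comparable; `jumpScale` is so small that they remain positive on the copy of S.
  have aux : ∀ {S S' : Finset (E d)} {a' b' : E d}, S ∈ 𝒯.star ν → S' ∈ 𝒯.star ν →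
      IsAdjacent S S' f a' b' → scaledCell S m δ ⊆ faceCone S f ∩ faceCone S' f := by
    intro S S' a' b' hS hS' hSS
    have hmS := hSS.left.conv_subset hm
    refine subset_inter (hSS.left.scaledCell_subset_faceCone hmS hδ hδ1)
      (scaledCell_subset_faceCone (M := σ * (3 ^ d * ballVol d) * κ) ?_ ?_)
    · intro v _ x hx
      obtain ⟨hSc', -⟩ := 𝒯.mem_star.1 hS'
      have hD' := cellDiam_pos hd (𝒯.isSimplex hSc')
      refine le_of_mul_le_mul_right ((abs_bary_sub_mul_le hd (𝒯.isSimplex hSc')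
        (h.shape S' hSc') v x m).trans ?_) hD'
      rw [mul_assoc _ κ]
      gcongr
      exact (dist_le_cellDiam hx hmS).trans (h.comparable ν S hS S' hS')
    · intro v hv
      rw [abs_of_pos hδ, hSS.right.bary_faceCenter hd hv]
      exact hδM
  have hXO : scaledCell A m δ ⊆ O := aux hA hB hadj
  have hYO : scaledCell B m δ ⊆ O := (aux hB hA hadj.symm).trans (inter_comm _ _).subset
  have hvol : ∀ S : Finset (E d), volume (scaledCell S m δ) = ENNReal.ofReal (δ ^ d * vol S) :=
    fun S => by rw [volume_scaledCell, abs_of_pos hδ]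
  have hdist : ∀ x ∈ scaledCell A m δ, ∀ y ∈ scaledCell B m δ,
      dist x y ≤ 2 * κ * cellDiam T := by
    intro x hx y hy
    have h1 := dist_scaledCell_le hmA hx
    have h2 := dist_scaledCell_le hmB hy
    rw [abs_of_pos hδ] at h1 h2
    have h3 : δ * cellDiam A ≤ 1 * (κ * cellDiam T) :=
      mul_le_mul hδ1 (h.comparable ν A hA T hT) Metric.diam_nonneg zero_le_one
    have h4 : δ * cellDiam B ≤ 1 * (κ * cellDiam T) :=
      mul_le_mul hδ1 (h.comparable ν B hB T hT) Metric.diam_nonneg zero_le_one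
    linarith [dist_triangle_right x y m]
  have hvA := (vol_pos (𝒯.isSimplex hAc)).le
  have hvB := (vol_pos (𝒯.isSimplex hBc)).le
  have hΓ := 𝒯.starInt_nonneg g ν
  have hdev : ∀ S ∈ 𝒯.star ν, m ∈ conv S → sqInt (scaledCell S m δ) (fun x => u x - c S) ≤
      σ * ballVol d * κ ^ 2 * (cellDiam T ^ 2 * 𝒯.starInt g ν) := by
    intro S hS hmS
    obtain ⟨hSc, -⟩ := 𝒯.mem_star.1 hS
    have hDS : 0 ≤ cellDiam S := Metric.diam_nonneg
    have hSt : volume (interior (conv S)) ≠ ⊤ := by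
      rw [volume_interior_eq]; exact ENNReal.ofReal_ne_top
    calc _ ≤ _ := sqInt_mono (memLp_sub_const hSt (hu.restrict _) _)
          (scaledCell_subset_interior (𝒯.isSimplex hSc) hmS hδ hδ1)
      _ ≤ _ := hc S hSc
      _ ≤ σ * ballVol d * (κ * cellDiam T) ^ 2 * 𝒯.starInt g ν := by
        have := h.comparable ν S hS T hT
        have := sqInt_le_starInt g hS
        have := sqInt_nonneg (interior (conv S)) g
        gcongr
      _ = _ := by ring
  -- O is covered by A and B, so only the energy of cells in the star enters.
  have hOg : sqInt O g ≤ 2 * 𝒯.starInt g ν := by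
    refine sqInt_le_of_le (by positivity) ?_
    calc _ ≤ ∫⁻ x in interior (conv A) ∪ interior (conv B), ‖g x‖ₑ ^ 2 := by
          refine lintegral_mono' (Measure.restrict_mono_ae ?_) le_rfl
          filter_upwards [(interior_conv_ae_eq A).mem_iff, (interior_conv_ae_eq B).mem_iff]
            with x h1 h2 hx
          rcases hadj.faceCone_inter_subset hd hx with hx | hx
          · exact Or.inl (h1.2 hx)
          · exact Or.inr (h2.2 hx)
      _ ≤ _ := lintegral_union_le _ _ _
      _ = ENNReal.ofReal (sqInt (interior (conv A)) g + sqInt (interior (conv B)) g) := by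
          rw [ENNReal.ofReal_add (sqInt_nonneg _ _) (sqInt_nonneg _ _),
            ofReal_sqInt (hg.restrict _), ofReal_sqInt (hg.restrict _)]
      _ ≤ _ := ENNReal.ofReal_le_ofReal (by
          linarith [sqInt_le_starInt g hA, sqInt_le_starInt g hB])
  have key := jump_sqInt_le hO hOc hum hu hg (hug.mono hOΩ) (measurableSet_scaledCell A m hδ.ne')
    (measurableSet_scaledCell B m hδ.ne') hXO hYO (ρ := 2 * κ * cellDiam T) (by positivity) hdist
    (by positivity) (by positivity) (c A) (c B) (hvol A) (hvol B)
  -- `jumpConst` is the constant of `jump_arith` for L = κ^d σ, e = δ^d, M = κ^d `ballVol d`, p = σ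
  -- `ballVol d` κ² and r = 2 (2κ)^(d+2) `ballVol d`.
  exact jump_arith (by positivity) (by positivity) (pow_le_one₀ hδ.le hδ1) (by positivity)
    (by positivity) (by positivity) (sq_nonneg _) hvA hvB
    (h.pow_cellDiam_le hκ hA hT) (h.pow_cellDiam_le hκ hB hT) (h.vol_le hA hT) (h.vol_le hB hT)
    (hdev A hA hmA) (hdev B hB hmB) (R := (2 * κ * cellDiam T) ^ (d + 2) * ballVol d * sqInt O g)
    (by
      calc _ ≤ (2 * κ * cellDiam T) ^ (d + 2) * ballVol d * (2 * 𝒯.starInt g ν) := by gcongr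
        _ = _ := by ring) key

/-- The missing neighbour across f is replaced by the copy of S with factor -δ. It lies outside the
interior of S, where the extension by zero vanishes, so the jump is c - 0. -/
theorem Regular.mul_sq_le_of_isFace (h : 𝒯.Regular σ κ N) (hd : 1 ≤ d) (hσ : 0 ≤ σ)
    (hκ : 1 ≤ κ) {S f : Finset (E d)} {a : E d}
    (hf : IsFace S f a) {u : E d → ℝ} {g : E d → E d}
    (hum : Measurable u) (hu : MemLp u 2 volume) (hg : MemLp g 2 volume)
    (hug : LocalWeakGrad (faceCone S f) ((interior (conv S)).indicator u)
      ((interior (conv S)).indicator g)) {c : ℝ}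
    (hc : sqInt (interior (conv S)) (fun x => u x - c) ≤
      σ * ballVol d * cellDiam S ^ 2 * sqInt (interior (conv S)) g) {ν : E d}
    {T : Finset (E d)} (hS : S ∈ 𝒯.star ν) (hT : T ∈ 𝒯.star ν) :
    cellDiam T ^ d * c ^ 2 ≤ jumpConst d σ κ * (cellDiam T ^ 2 * 𝒯.starInt g ν) := by
  have hκ0 : 0 ≤ κ := zero_le_one.trans hκ
  obtain ⟨hδ, hδ1, hδM⟩ := jumpScale_mem hd hσ hκ0
  set δ := jumpScale d σ κ with hδdef
  set m := faceCenter f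
  have hm : m ∈ conv f := faceCenter_mem hd hf.card
  have hmS := hf.conv_subset hm
  have hD : 0 < cellDiam T := cellDiam_pos hd (𝒯.isSimplex (𝒯.mem_star.1 hT).1)
  have hDS : 0 < cellDiam S := cellDiam_pos hd hf.simplex
  have hβ := ballVol_pos d
  have hΓ := 𝒯.starInt_nonneg g ν
  have hvS := (vol_pos hf.simplex).le
  have hmeas : MeasurableSet (interior (conv S)) := measurableSet_interior
  have hXS := scaledCell_subset_interior hf.simplex hmS hδ hδ1
  have hYO : scaledCell S m (-δ) ⊆ faceCone S f := by
    refine scaledCell_subset_faceCone (M := σ * (3 ^ d * ballVol d) * κ) ?_ ?_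
    · intro v _ x hx
      refine le_of_mul_le_mul_right ((abs_bary_sub_mul_le hd hf.simplex
        (h.shape S (𝒯.mem_star.1 hS).1) v x m).trans ?_) hDS
      rw [mul_assoc _ κ]
      gcongr
      have := dist_le_cellDiam hx hmS
      nlinarith
    · intro v hv
      rw [abs_neg, abs_of_pos hδ, hf.bary_faceCenter hd hv]
      exact hδM
  have hvX : volume (scaledCell S m δ) = ENNReal.ofReal (δ ^ d * vol S) := by
    rw [volume_scaledCell, abs_of_pos hδ]
  have hvY : volume (scaledCell S m (-δ)) = ENNReal.ofReal (δ ^ d * vol S) := by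
    rw [volume_scaledCell, abs_neg, abs_of_pos hδ]
  have hmY := measurableSet_scaledCell S m (neg_ne_zero.2 hδ.ne')
  have hdist : ∀ x ∈ scaledCell S m δ, ∀ y ∈ scaledCell S m (-δ),
      dist x y ≤ 2 * κ * cellDiam T := by
    intro x hx y hy
    have h1 := dist_scaledCell_le hmS hx
    have h2 := dist_scaledCell_le hmS hy
    rw [abs_neg] at h2
    rw [abs_of_pos hδ] at h1 h2
    have h3 : δ * cellDiam S ≤ 1 * (κ * cellDiam T) :=
      mul_le_mul hδ1 (h.comparable ν S hS T hT) Metric.diam_nonneg zero_le_one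
    linarith [dist_triangle_right x y m]
  have key := jump_sqInt_le (isOpen_faceCone S f) (convex_faceCone S f)
    (hum.indicator hmeas) (hu.indicator hmeas) (hg.indicator hmeas) hug
    (measurableSet_scaledCell S m hδ.ne') hmY
    (hf.scaledCell_subset_faceCone hmS hδ hδ1) hYO (ρ := 2 * κ * cellDiam T) (by positivity) hdist
    (by positivity) (by positivity) c 0 hvX hvY
  have h0 : sqInt (scaledCell S m (-δ)) (fun z => (interior (conv S)).indicator u z - 0) = 0 := by
    rw [sqInt_congr hmY (g := fun _ => (0 : ℝ))]
    · simp [sqInt]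
    · intro x hx
      rw [indicator_of_notMem (hf.notMem_interior_of_mem_scaledCell hm (neg_lt_zero.2 hδ) hx),
        sub_zero]
  have hSt : volume (interior (conv S)) ≠ ⊤ := by
    rw [volume_interior_eq]; exact ENNReal.ofReal_ne_top
  have hdev : sqInt (scaledCell S m δ) (fun z => (interior (conv S)).indicator u z - c) ≤
      σ * ballVol d * κ ^ 2 * (cellDiam T ^ 2 * 𝒯.starInt g ν) := by
    rw [sqInt_congr (g := fun x => u x - c) (measurableSet_scaledCell S m hδ.ne')
      fun x hx => by rw [indicator_of_mem (hXS hx)]]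
    calc _ ≤ _ := sqInt_mono (memLp_sub_const hSt (hu.restrict _) _) hXS
      _ ≤ _ := hc
      _ ≤ σ * ballVol d * (κ * cellDiam T) ^ 2 * 𝒯.starInt g ν := by
        have := h.comparable ν S hS T hT
        have := sqInt_le_starInt g hS
        have := sqInt_nonneg (interior (conv S)) g
        gcongr
      _ = _ := by ring
  rw [← sub_zero c]
  refine jump_arith (by positivity) (by positivity) (pow_le_one₀ hδ.le hδ1) (by positivity)
    (by positivity) (by positivity) (sq_nonneg _) hvS hvS
    (h.pow_cellDiam_le hκ0 hS hT) (h.pow_cellDiam_le hκ0 hS hT) (h.vol_le hS hT) (h.vol_le hS hT)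
    hdev (h0.le.trans (by positivity)) ?_ key
  calc _ ≤ (2 * κ * cellDiam T) ^ (d + 2) * ballVol d * (2 * 𝒯.starInt g ν) := by
        gcongr
        refine (sqInt_indicator_le hmeas (hg.restrict _)).trans ?_
        linarith [sqInt_le_starInt g hS]
    _ = _ := by ring

end Mesh

end OpPrec

/-! ### Local approximation by constants -/

namespace OpPrec

namespace Mesh

variable {d : ℕ} {Ω γ : Set (E d)} {𝒯 : Mesh Ω} {σ κ : ℝ} {N : ℕ}

/-- The sum of `F` over the neighbours of a cell `T`, counted once for each common vertex. -/
def neighborSum (𝒯 : Mesh Ω) (F : Finset (E d) → ℝ) (T : Finset (E d)) : ℝ :=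
  ∑ ν ∈ T, ∑ S ∈ 𝒯.star ν, F S

theorem neighborSum_nonneg {F : Finset (E d) → ℝ} (hF : ∀ T, 0 ≤ F T) (T : Finset (E d)) :
    0 ≤ 𝒯.neighborSum F T :=
  Finset.sum_nonneg fun _ _ => Finset.sum_nonneg fun _ _ => hF _

theorem le_neighborSum {F : Finset (E d) → ℝ} (hF : ∀ T, 0 ≤ F T) {T S : Finset (E d)} {ν : E d}
    (hν : ν ∈ T) (hS : S ∈ 𝒯.star ν) : F S ≤ 𝒯.neighborSum F T :=
  (Finset.single_le_sum (f := F) (fun _ _ => hF _) hS).trans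
    (Finset.single_le_sum (f := fun ν => ∑ S ∈ 𝒯.star ν, F S)
      (fun _ _ => Finset.sum_nonneg fun _ _ => hF _) hν)

theorem starInt_le_neighborSum {F : Type*} [NormedAddCommGroup F] (g : E d → F) {T : Finset (E d)}
    {ν : E d} (hν : ν ∈ T) :
    𝒯.starInt g ν ≤ 𝒯.neighborSum (fun S => sqInt (interior (conv S)) g) T :=
  Finset.single_le_sum (f := fun ν => 𝒯.starInt g ν) (fun _ _ => 𝒯.starInt_nonneg g _) hν

/-- Double counting: summed vertex by vertex, each star is repeated at most N times, and each cell
belongs to d + 1 stars. -/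
theorem Regular.sum_neighborSum_le (h : 𝒯.Regular σ κ N) {F : Finset (E d) → ℝ}
    (hF : ∀ T, 0 ≤ F T) :
    ∑ T ∈ 𝒯.cells, 𝒯.neighborSum F T ≤ N * (d + 1) * ∑ T ∈ 𝒯.cells, F T := by
  classical
  have hswap : ∀ f : Finset (E d) → E d → ℝ, ∑ T ∈ 𝒯.cells, ∑ ν ∈ T, f T ν =
      ∑ ν ∈ 𝒯.cells.biUnion id, ∑ T ∈ 𝒯.star ν, f T ν := fun f =>
    Finset.sum_comm' fun T ν => by
      simp only [𝒯.mem_star, Finset.mem_biUnion, id]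
      exact ⟨fun h => ⟨h, T, h⟩, fun h => h.1⟩
  calc _ = ∑ ν ∈ 𝒯.cells.biUnion id, ∑ T ∈ 𝒯.star ν, ∑ S ∈ 𝒯.star ν, F S :=
        hswap fun _ ν => ∑ S ∈ 𝒯.star ν, F S
    _ ≤ ∑ ν ∈ 𝒯.cells.biUnion id, N * ∑ S ∈ 𝒯.star ν, F S := by
        refine Finset.sum_le_sum fun ν _ => ?_
        rw [Finset.sum_const, nsmul_eq_mul]
        have : ((𝒯.star ν).card : ℝ) ≤ N := by exact_mod_cast h.valence ν
        have : 0 ≤ ∑ S ∈ 𝒯.star ν, F S := Finset.sum_nonneg fun _ _ => hF _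
        gcongr
    _ = N * ∑ T ∈ 𝒯.cells, ∑ ν ∈ T, F T := by
        rw [← Finset.mul_sum, hswap fun T _ => F T]
    _ = _ := by
        rw [mul_assoc, Finset.mul_sum (a := (d : ℝ) + 1)]
        congr 1
        refine Finset.sum_congr rfl fun T hT => ?_
        rw [Finset.sum_const, nsmul_eq_mul, 𝒯.card_eq T hT]
        push_cast; ring

/-- The chain estimate, with β the square root of the bound for a single jump; squaring the number
of steps gives N². -/
theorem Regular.mul_sq_le_of_star (h : 𝒯.Regular σ κ N) (hd : 1 ≤ d) (hσ : 0 ≤ σ)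
    (hκ : 0 ≤ κ) (hΩ : interior (closure Ω) = Ω) {u : E d → ℝ} {g : E d → E d}
    (hum : Measurable u) (hu : MemLp u 2 volume) (hg : MemLp g 2 volume)
    (hug : LocalWeakGrad Ω u g) {c : Finset (E d) → ℝ}
    (hc : ∀ T ∈ 𝒯.cells, sqInt (interior (conv T)) (fun x => u x - c T) ≤
      σ * ballVol d * cellDiam T ^ 2 * sqInt (interior (conv T)) g) {ν : E d}
    {S T : Finset (E d)} (hS : S ∈ 𝒯.star ν) (hT : T ∈ 𝒯.star ν) :
    cellDiam T ^ d * (c S - c T) ^ 2 ≤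
      N ^ 2 * jumpConst d σ κ * (cellDiam T ^ 2 * 𝒯.starInt g ν) := by
  have hD : 0 < cellDiam T := cellDiam_pos hd (𝒯.isSimplex (𝒯.mem_star.1 hT).1)
  set Q := jumpConst d σ κ * (cellDiam T ^ 2 * 𝒯.starInt g ν) with hQ
  have h1 := 𝒯.star_abs_sub_le (h.valence ν) (F := c)
    (β := √(Q / cellDiam T ^ d)) (Real.sqrt_nonneg _) ?_ hS hT
  · have hQ0 : 0 ≤ Q / cellDiam T ^ d := by
      have hJ : 0 ≤ jumpConst d σ κ := by
        have := ballVol_pos d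
        unfold jumpConst; positivity
      have := 𝒯.starInt_nonneg g ν
      positivity
    have h2 : (c S - c T) ^ 2 ≤ (N * √(Q / cellDiam T ^ d)) ^ 2 := by
      rw [← sq_abs (c S - c T)]
      gcongr
    rw [mul_pow, Real.sq_sqrt hQ0] at h2
    calc _ ≤ cellDiam T ^ d * (N ^ 2 * (Q / cellDiam T ^ d)) := by gcongr
      _ = N ^ 2 * Q := by field_simp
      _ = _ := by rw [hQ, mul_assoc]
  · intro A hA B hB hAB
    refine Real.abs_le_sqrt ?_
    rw [le_div_iff₀ (by positivity), mul_comm]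
    exact h.mul_sq_le_of_isAdjacent hd hσ hκ hΩ hum hu hg hug hc hA hB hT hAB

/-- The constant in the estimate of the mean value on a cell near `γ`. -/
def traceConst (d : ℕ) (σ κ : ℝ) (N : ℕ) : ℝ :=
  2 * (2 * κ ^ (d + 2) * (1 + N ^ 2) * jumpConst d σ κ + N ^ 2 * jumpConst d σ κ)

/-- The constant in the estimate of the deviation of a function from a constant near a cell. -/
def oscConst (d : ℕ) (σ κ : ℝ) (N : ℕ) : ℝ :=
  2 * (σ * ballVol d * κ ^ 2 +
    κ ^ d * ballVol d * (2 * (N ^ 2 * jumpConst d σ κ + traceConst d σ κ N)))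

theorem jumpConst_nonneg (d : ℕ) (hσ : 0 ≤ σ) (hκ : 0 ≤ κ) : 0 ≤ jumpConst d σ κ := by
  have := ballVol_pos d
  unfold jumpConst; positivity

/-- If a cell T₁ touching T in ν has a vertex v on γ, the constants are compared along T, T₁, S,
through ν and then v, where S has a face on γ and hence a small constant; so a = 0 is admissible.
Otherwise a is the Poincaré constant of T. The two steps explain the nested neighbour sum. The
alternative for a is what makes it invisible to the gradient of the projection. -/
theorem Regular.exists_const (h : 𝒯.Regular σ κ N) (hd : 1 ≤ d) (hσ : 0 ≤ σ)
    (hκ : 1 ≤ κ) (hΩo : IsOpen Ω) (hΩ : interior (closure Ω) = Ω) (hγ : 𝒯.IsUnionOfFaces γ)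
    {z : L2pair Ω} (hz : z ∈ H10 Ω γ) {T : Finset (E d)} (hT : T ∈ 𝒯.cells) :
    ∃ a : ℝ, (a = 0 ∨ ∀ ν ∈ T, ∀ S ∈ 𝒯.star ν, ∀ v ∈ S, v ∉ γ) ∧
      ∀ ν ∈ T, ∀ S ∈ 𝒯.star ν,
        sqInt (interior (conv S)) (fun x => Ω.indicator z.fst x - a) ≤
        oscConst d σ κ N * (cellDiam T ^ 2 * 𝒯.neighborSum (𝒯.neighborSum
          fun S => sqInt (interior (conv S)) (Ω.indicator z.snd)) T) := by
  have hκ0 : 0 ≤ κ := zero_le_one.trans hκ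
  have hβ := ballVol_pos d
  have hm := hΩo.measurableSet
  set u := Ω.indicator z.fst with hudef
  set g := Ω.indicator z.snd with hgdef
  have hum : Measurable u := measurable_indicator_Lp hm z.fst
  have hu : MemLp u 2 volume := memLp_indicator hm subset_rfl z.fst
  have hg : MemLp g 2 volume := memLp_indicator hm subset_rfl z.snd
  have hug : LocalWeakGrad Ω u g := localWeakGrad_of_mem_H10 hΩo hz
  have hJ := jumpConst_nonneg d hσ hκ0
  have hc : ∀ T ∈ 𝒯.cells, ∃ c, sqInt (interior (conv T)) (fun x => u x - c) ≤
      σ * ballVol d * cellDiam T ^ 2 * sqInt (interior (conv T)) g := fun T hT =>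
    exists_poincare_const (𝒯.isSimplex hT) (h.shape T hT) hum hu hg
      (hug.mono (𝒯.interior_conv_subset hΩ hT))
  choose! c hc using hc
  set G : Finset (E d) → ℝ := fun S => sqInt (interior (conv S)) g
  have hG : ∀ S, 0 ≤ G S := fun S => sqInt_nonneg _ _
  set A := 𝒯.neighborSum (𝒯.neighborSum G) T
  have hA0 : 0 ≤ A := neighborSum_nonneg (neighborSum_nonneg hG) T
  have hstarA : ∀ ν ∈ T, ∀ S ∈ 𝒯.star ν, ∀ v ∈ S, 𝒯.starInt g v ≤ A := fun ν hν S hS v hv =>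
    (starInt_le_neighborSum g hv).trans (le_neighborSum (neighborSum_nonneg hG) hν hS)
  have hD : 0 < cellDiam T := cellDiam_pos hd (𝒯.isSimplex hT)
  have hstar : ∀ {ν : E d} {S S' : Finset (E d)}, S ∈ 𝒯.star ν → S' ∈ 𝒯.star ν →
      𝒯.starInt g ν ≤ A → cellDiam S' ^ d * (c S - c S') ^ 2 ≤
        N ^ 2 * jumpConst d σ κ * (cellDiam S' ^ 2 * A) := fun hS hS' hle =>
    (h.mul_sq_le_of_star hd hσ hκ0 hΩ hum hu hg hug hc hS hS').trans (by gcongr)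
  have hB0 : 0 ≤ traceConst d σ κ N := by unfold traceConst; positivity
  have main : ∃ a : ℝ, (a = 0 ∨ ∀ ν ∈ T, ∀ S ∈ 𝒯.star ν, ∀ v ∈ S, v ∉ γ) ∧
      cellDiam T ^ d * (c T - a) ^ 2 ≤ traceConst d σ κ N * (cellDiam T ^ 2 * A) := by
    by_cases hfree : ∀ ν ∈ T, ∀ S ∈ 𝒯.star ν, ∀ v ∈ S, v ∉ γ
    · refine ⟨c T, Or.inr hfree, ?_⟩
      rw [sub_self, zero_pow two_ne_zero, mul_zero]
      positivity
    · refine ⟨0, Or.inl rfl, ?_⟩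
      push Not at hfree
      obtain ⟨ν, hν, T₁, hT₁, v, hv, hvγ⟩ := hfree
      have hTν : T ∈ 𝒯.star ν := 𝒯.mem_star.2 ⟨hT, hν⟩
      have hT₁v : T₁ ∈ 𝒯.star v := 𝒯.mem_star.2 ⟨(𝒯.mem_star.1 hT₁).1, hv⟩
      obtain ⟨S, hS, f, b, hf, hvf, hfγ⟩ :=
        𝒯.exists_isFace_of_mem hγ hvγ (𝒯.mem_star.1 hT₁).1 hv
      have hSv : S ∈ 𝒯.star v := 𝒯.mem_star.2 ⟨hS, hf.subset hvf⟩
      have hSΩ := 𝒯.interior_conv_subset hΩ hS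
      have hvA := hstarA ν hν T₁ hT₁ v hv
      have hνA := hstarA ν hν T hTν ν hν
      have hD₁ : 0 < cellDiam T₁ := cellDiam_pos hd (𝒯.isSimplex (𝒯.mem_star.1 hT₁).1)
      have e1 : cellDiam T₁ ^ d * c S ^ 2 ≤ jumpConst d σ κ * (cellDiam T₁ ^ 2 * A) := by
        refine (h.mul_sq_le_of_isFace hd hσ hκ hf hum hu hg ?_ (hc S hS) hSv hT₁v).trans
          (by gcongr)
        rw [hudef, hgdef, indicator_indicator, indicator_indicator, inter_eq_left.2 hSΩ]
        exact localWeakGrad_faceCone hΩo hf hSΩ hfγ hz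
      have e2 := hstar hSv hT₁v hvA
      have e3 := hstar hT₁ hTν hνA
      have e4 : cellDiam T₁ ^ d * c T₁ ^ 2 ≤
          2 * (1 + N ^ 2) * jumpConst d σ κ * (cellDiam T₁ ^ 2 * A) := by
        have : c T₁ ^ 2 ≤ 2 * c S ^ 2 + 2 * (c S - c T₁) ^ 2 := by
          nlinarith [sq_nonneg (c S - (c S - c T₁) - 2 * c S)]
        calc _ ≤ cellDiam T₁ ^ d * (2 * c S ^ 2 + 2 * (c S - c T₁) ^ 2) := by gcongr
          _ ≤ _ := by linarith
      -- Exchanging diam T₁ for diam T costs κ^d on the left and κ² on the right.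
      have e5 : cellDiam T ^ d * c T₁ ^ 2 ≤
          2 * κ ^ (d + 2) * (1 + N ^ 2) * jumpConst d σ κ * (cellDiam T ^ 2 * A) := by
        calc _ ≤ (κ * cellDiam T₁) ^ d * c T₁ ^ 2 := by
              gcongr; exact h.comparable ν T hTν T₁ hT₁
          _ = κ ^ d * (cellDiam T₁ ^ d * c T₁ ^ 2) := by ring
          _ ≤ κ ^ d * (2 * (1 + N ^ 2) * jumpConst d σ κ * (cellDiam T₁ ^ 2 * A)) := by gcongr
          _ ≤ κ ^ d * (2 * (1 + N ^ 2) * jumpConst d σ κ * ((κ * cellDiam T) ^ 2 * A)) := by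
              gcongr; exact h.comparable ν T₁ hT₁ T hTν
          _ = _ := by ring
      have : (c T - 0) ^ 2 ≤ 2 * c T₁ ^ 2 + 2 * (c T₁ - c T) ^ 2 := by
        nlinarith [sq_nonneg (c T₁ - (c T₁ - c T) - 2 * c T₁)]
      calc _ ≤ cellDiam T ^ d * (2 * c T₁ ^ 2 + 2 * (c T₁ - c T) ^ 2) := by gcongr
        _ ≤ _ := by unfold traceConst; linarith
  obtain ⟨a, ha, haT⟩ := main
  refine ⟨a, ha, fun ν hν S hS => ?_⟩
  have hTν : T ∈ 𝒯.star ν := 𝒯.mem_star.2 ⟨hT, hν⟩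
  have hSc := (𝒯.mem_star.1 hS).1
  have hνA := hstarA ν hν T hTν ν hν
  have hdev : sqInt (interior (conv S)) (fun x => u x - c S) ≤
      σ * ballVol d * κ ^ 2 * (cellDiam T ^ 2 * A) := by
    have hDS : 0 ≤ cellDiam S := Metric.diam_nonneg
    calc _ ≤ _ := hc S hSc
      _ ≤ σ * ballVol d * (κ * cellDiam T) ^ 2 * A := by
        have := h.comparable ν S hS T hTν
        have := (sqInt_le_starInt g hS).trans hνA
        have := hG S
        gcongr
      _ = _ := by ring
  have e1 := hstar hS hTν hνA
  have e2 : (c S - a) ^ 2 ≤ 2 * (c S - c T) ^ 2 + 2 * (c T - a) ^ 2 := by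
    nlinarith [sq_nonneg ((c S - c T) - (c T - a))]
  have hv := (vol_pos (𝒯.isSimplex hSc)).le
  have e3 : vol S * (c S - a) ^ 2 ≤ κ ^ d * ballVol d *
      (2 * (N ^ 2 * jumpConst d σ κ + traceConst d σ κ N)) * (cellDiam T ^ 2 * A) := by
    calc _ ≤ (κ ^ d * ballVol d * cellDiam T ^ d) *
          (2 * (c S - c T) ^ 2 + 2 * (c T - a) ^ 2) := by
          gcongr; exact h.vol_le hS hTν
      _ = κ ^ d * ballVol d * (2 * (cellDiam T ^ d * (c S - c T) ^ 2 +
          cellDiam T ^ d * (c T - a) ^ 2)) := by ring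
      _ ≤ κ ^ d * ballVol d * (2 * (N ^ 2 * jumpConst d σ κ * (cellDiam T ^ 2 * A) +
          traceConst d σ κ N * (cellDiam T ^ 2 * A))) := by gcongr
      _ = _ := by ring
  calc _ ≤ 2 * (sqInt (interior (conv S)) (fun x => u x - c S) + vol S * (c S - a) ^ 2) :=
        sqInt_sub_const_le hv (volume_interior_eq S) (hu.restrict _) a (c S)
    _ ≤ _ := by unfold oscConst; linarith

end Mesh

end OpPrec

/-! ### Coefficients of the biorthogonal projector -/

namespace OpPrec

theorem sq_integral_mul_le {d : ℕ} {Ω : Set (E d)} {w : E d → ℝ} (hw : AEMeasurable w (mu Ω))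
    (ψ : L2 Ω) :
    ‖∫ x in Ω, w x * ψ x‖ₑ ^ 2 ≤ (∫⁻ x in Ω, ‖w x‖ₑ ^ 2) * ‖ψ‖ₑ ^ 2 := by
  rw [enorm_Lp_sq]
  refine le_trans ?_ (sq_lintegral_mul_le (mu Ω) hw.enorm
    (Lp.aestronglyMeasurable ψ).aemeasurable.enorm)
  gcongr
  refine (enorm_integral_le_lintegral_enorm _).trans (lintegral_mono fun x => ?_)
  rw [enorm_mul]

namespace Mesh

/-- The collection `ψ` is biorthogonal to the nodal basis, uniformly with constant `c`, and
supported in the patches. -/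
structure IsDual {d : ℕ} {Ω : Set (E d)} (𝒯 : Mesh Ω) (γ : Set (E d)) (c : ℝ)
    (ψ : 𝒯.freeVertices γ → L2 Ω) : Prop where
  orthogonal : ∀ ν ν' : 𝒯.freeVertices γ, ν ≠ ν' → ∫ x in Ω, 𝒯.hat ν x * ψ ν' x = 0
  diag_ne_zero : ∀ ν : 𝒯.freeVertices γ, ∫ x in Ω, 𝒯.hat ν x * ψ ν x ≠ 0
  lower_bound : ∀ ν : 𝒯.freeVertices γ,
    c * ((eLpNorm (𝒯.hat ν) 2 (mu Ω)).toReal * ‖ψ ν‖) ≤ |∫ x in Ω, 𝒯.hat ν x * ψ ν x|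
  support : ∀ ν : 𝒯.freeVertices γ, ∀ᵐ x ∂(mu Ω), x ∉ 𝒯.patch ν → ψ ν x = 0

/-- The coefficient of the nodal function `φ_ν` in the biorthogonal projection of `w`. -/
def dualCoef {d : ℕ} {Ω γ : Set (E d)} (𝒯 : Mesh Ω) (ψ : 𝒯.freeVertices γ → L2 Ω)
    (ν : 𝒯.freeVertices γ) (w : E d → ℝ) : ℝ :=
  (∫ x in Ω, w x * ψ ν x) / ∫ x in Ω, 𝒯.hat ν x * ψ ν x

variable {d : ℕ} {Ω γ : Set (E d)} {𝒯 : Mesh Ω}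

theorem notMem_patch {T : Finset (E d)} (hT : T ∈ 𝒯.cells) {ν : E d} (hν : ν ∉ T) {x : E d}
    (hx : x ∈ interior (conv T)) : x ∉ 𝒯.patch ν := by
  intro h
  obtain ⟨S, hS, hxS⟩ := mem_iUnion₂.1 h
  obtain ⟨hS, hνS⟩ := Finset.mem_filter.1 hS
  have hxT := (mem_interior_conv_iff (𝒯.isSimplex hT)).1 hx
  have hsub : T ⊆ S := fun v hv => by
    by_contra hvS
    have := hxT v hv
    rw [← 𝒯.bary_eq_of_mem hS hT hxS (interior_subset hx), bary_of_notMem hvS] at this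
    exact lt_irrefl _ this
  have : T = S := Finset.eq_of_subset_of_card_le hsub
    (by rw [𝒯.card_eq T hT, 𝒯.card_eq S hS])
  exact hν (this ▸ hνS)

theorem IsDual.eq_zero_of_notMem {c : ℝ} {ψ : 𝒯.freeVertices γ → L2 Ω} (h : 𝒯.IsDual γ c ψ)
    (ν : 𝒯.freeVertices γ) : ∀ᵐ x ∂(mu Ω), ∀ T ∈ 𝒯.cells, x ∈ interior (conv T) → (ν : E d) ∉ T →
      ψ ν x = 0 := by
  filter_upwards [h.support ν] with x hx T hT hxT hν
  exact hx (notMem_patch hT hν hxT)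

theorem memLp_restrict_cell (hΩ : interior (closure Ω) = Ω) {F : Type*} [NormedAddCommGroup F]
    {w : E d → F} (hw : MemLp w 2 (mu Ω)) {T : Finset (E d)} (hT : T ∈ 𝒯.cells) :
    MemLp w 2 (volume.restrict (interior (conv T))) :=
  hw.mono_measure (Measure.restrict_mono (𝒯.interior_conv_subset hΩ hT) le_rfl)

/-- Cauchy–Schwarz after cutting w off to the patch, outside of which ψ_ν vanishes. -/
theorem IsDual.sq_integral_le {c : ℝ} {ψ : 𝒯.freeVertices γ → L2 Ω} (h : 𝒯.IsDual γ c ψ)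
    (hΩo : IsOpen Ω) (hΩ : interior (closure Ω) = Ω) {w : E d → ℝ} (hw : MemLp w 2 (mu Ω))
    (ν : 𝒯.freeVertices γ) :
    (∫ x in Ω, w x * ψ ν x) ^ 2 ≤ ‖ψ ν‖ ^ 2 * 𝒯.starInt w ν := by
  set P := ⋃ T ∈ 𝒯.star (ν : E d), interior (conv T) with hP
  have hPm : MeasurableSet P :=
    Finset.measurableSet_biUnion _ fun _ _ => measurableSet_interior
  have e1 : ∫ x in Ω, w x * ψ ν x = ∫ x in Ω, P.indicator w x * ψ ν x := by
    refine integral_congr_ae ?_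
    filter_upwards [h.eq_zero_of_notMem ν, 𝒯.ae_mem_cells hΩo hΩ] with x hx hxT
    by_cases hxP : x ∈ P
    · rw [indicator_of_mem hxP]
    · obtain ⟨T, hT, hxT⟩ := hxT
      have hν : (ν : E d) ∉ T := fun hν =>
        hxP (mem_iUnion₂.2 ⟨T, 𝒯.mem_star.2 ⟨hT, hν⟩, hxT⟩)
      rw [hx T hT hxT hν, mul_zero, mul_zero]
  have e2 : ∫⁻ x in Ω, ‖P.indicator w x‖ₑ ^ 2 ≤ ENNReal.ofReal (𝒯.starInt w ν) := by
    calc _ ≤ ∫⁻ x, ‖P.indicator w x‖ₑ ^ 2 := setLIntegral_le_lintegral _ _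
      _ = ∫⁻ x, P.indicator (fun x => ‖w x‖ₑ ^ 2) x := by
        refine lintegral_congr fun x => ?_
        by_cases hx : x ∈ P <;> simp [hx]
      _ = ∫⁻ x in P, ‖w x‖ₑ ^ 2 := lintegral_indicator hPm _
      _ = ∑ T ∈ 𝒯.star (ν : E d), ∫⁻ x in interior (conv T), ‖w x‖ₑ ^ 2 :=
        lintegral_biUnion_finset (fun S hS T hT hne => 𝒯.disjoint_interior
          (𝒯.mem_star.1 hS).1 (𝒯.mem_star.1 hT).1 hne) (fun _ _ => measurableSet_interior) _
      _ = _ := by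
        rw [starInt, ENNReal.ofReal_sum_of_nonneg fun _ _ => sqInt_nonneg _ _]
        exact Finset.sum_congr rfl fun T hT =>
          (ofReal_sqInt (memLp_restrict_cell hΩ hw (𝒯.mem_star.1 hT).1)).symm
  have e3 := sq_integral_mul_le (hw.1.aemeasurable.indicator hPm) (ψ ν)
  rw [← e1, enorm_sq] at e3
  have e4 := e3.trans (mul_le_mul_left e2 _)
  have hψ : ‖ψ ν‖ₑ ^ 2 = ENNReal.ofReal (‖ψ ν‖ ^ 2) := enorm_norm_sq _
  have h0 := 𝒯.starInt_nonneg w ν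
  rw [hψ, ← ENNReal.ofReal_mul h0, ENNReal.ofReal_le_ofReal_iff (by positivity)] at e4
  linarith

/-- On the copy of T shrunk by 1/2 about ν, the nodal function is at least 1/2; this gives 2^(-2)
for the value and 2^(-d) for the volume. -/
theorem vol_le_sq_eLpNorm_hat (hΩ : interior (closure Ω) = Ω) {ν : E d}
    (hmem : MemLp (𝒯.hat ν) 2 (mu Ω)) {T : Finset (E d)} (hT : T ∈ 𝒯.star ν) :
    (1 / 2) ^ (d + 2) * vol T ≤ (eLpNorm (𝒯.hat ν) 2 (mu Ω)).toReal ^ 2 := by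
  obtain ⟨hTc, hνT⟩ := 𝒯.mem_star.1 hT
  have hs := 𝒯.isSimplex hTc
  have hv := (vol_pos hs).le
  have hν := mem_conv_of_mem hνT
  have hXT := scaledCell_subset_interior hs hν (δ := 1 / 2) (by norm_num) (by norm_num)
  rw [← ENNReal.toReal_pow, ← ENNReal.ofReal_le_iff_le_toReal
    (ENNReal.pow_ne_top hmem.eLpNorm_ne_top), eLpNorm_two_sq]
  calc _ = ENNReal.ofReal ((1 / 2) ^ 2) * volume (scaledCell T ν (1 / 2)) := by
        rw [volume_scaledCell, ← ENNReal.ofReal_mul (by positivity), abs_of_pos (by norm_num)]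
        congr 1; ring
    _ = ∫⁻ _ in scaledCell T ν (1 / 2), ENNReal.ofReal ((1 / 2) ^ 2) := by
        rw [setLIntegral_const]
    _ ≤ ∫⁻ x in scaledCell T ν (1 / 2), ‖𝒯.hat ν x‖ₑ ^ 2 := by
        refine setLIntegral_mono' (measurableSet_scaledCell T ν (by norm_num)) fun x hx => ?_
        rw [enorm_sq, 𝒯.hat_eq_bary hTc (interior_subset (hXT hx))]
        obtain ⟨y, hy, rfl⟩ := hx
        rw [affineMap_homothety, bary_self hs hνT]
        have := bary_nonneg hs (interior_subset hy) ν
        refine ENNReal.ofReal_le_ofReal (pow_le_pow_left₀ (by norm_num) ?_ 2)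
        linarith
    _ ≤ _ := lintegral_mono_set (hXT.trans (𝒯.interior_conv_subset hΩ hTc))

/-- The denominator is at least c ‖φ_ν‖ ‖ψ_ν‖ and the numerator at most ‖ψ_ν‖ times the norm of w on
the patch. So ‖ψ_ν‖ cancels, and ‖φ_ν‖² is bounded below by |T|. -/
theorem IsDual.vol_mul_sq_dualCoef_le {c : ℝ} (hc : 0 < c) {ψ : 𝒯.freeVertices γ → L2 Ω}
    (h : 𝒯.IsDual γ c ψ) (hΩo : IsOpen Ω) (hΩ : interior (closure Ω) = Ω) {w : E d → ℝ}
    (hw : MemLp w 2 (mu Ω)) (ν : 𝒯.freeVertices γ) (hmem : MemLp (𝒯.hat ν) 2 (mu Ω))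
    {T : Finset (E d)} (hT : T ∈ 𝒯.star (ν : E d)) :
    vol T * 𝒯.dualCoef ψ ν w ^ 2 ≤ 2 ^ (d + 2) / c ^ 2 * 𝒯.starInt w ν := by
  have h1 := h.sq_integral_le hΩo hΩ hw ν
  have h2 := 𝒯.vol_le_sq_eLpNorm_hat hΩ hmem hT
  have h3 := h.lower_bound ν
  have hD : 0 < (∫ x in Ω, 𝒯.hat ν x * ψ ν x) ^ 2 := by
    have := h.diag_ne_zero ν
    positivity
  have h4 : c ^ 2 * ((eLpNorm (𝒯.hat ν) 2 (mu Ω)).toReal ^ 2 * ‖ψ ν‖ ^ 2) ≤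
      (∫ x in Ω, 𝒯.hat ν x * ψ ν x) ^ 2 := by
    rw [← sq_abs (∫ x in Ω, 𝒯.hat ν x * ψ ν x), ← mul_pow, ← mul_pow]
    gcongr
  have hW := 𝒯.starInt_nonneg w ν
  have hv := (vol_pos (𝒯.isSimplex (𝒯.mem_star.1 hT).1)).le
  unfold dualCoef
  rw [div_pow, ← mul_div_assoc, div_le_iff₀ hD]
  calc _ ≤ vol T * (‖ψ ν‖ ^ 2 * 𝒯.starInt w ν) := by gcongr
    _ = 2 ^ (d + 2) * ((1 / 2) ^ (d + 2) * vol T) * ‖ψ ν‖ ^ 2 * 𝒯.starInt w ν := by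
        rw [← mul_assoc (2 ^ (d + 2)), ← mul_pow]; norm_num; ring
    _ ≤ 2 ^ (d + 2) * (eLpNorm (𝒯.hat ν) 2 (mu Ω)).toReal ^ 2 * ‖ψ ν‖ ^ 2 *
          𝒯.starInt w ν := by gcongr
    _ = 2 ^ (d + 2) / c ^ 2 * 𝒯.starInt w ν *
          (c ^ 2 * ((eLpNorm (𝒯.hat ν) 2 (mu Ω)).toReal ^ 2 * ‖ψ ν‖ ^ 2)) := by
        field_simp
    _ ≤ _ := by gcongr

theorem integrable_mul_dual {w : E d → ℝ} (hw : MemLp w 2 (mu Ω)) (ψ : L2 Ω) :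
    Integrable (fun x => w x * ψ x) (mu Ω) :=
  MemLp.integrable_mul (p := 2) (q := 2) hw (Lp.memLp ψ)

theorem memLp_const_of_isBounded (hΩb : Bornology.IsBounded Ω) (a : ℝ) :
    MemLp (fun _ : E d => a) 2 (mu Ω) := by
  have : IsFiniteMeasure (mu Ω) := ⟨by simpa using hΩb.measure_lt_top⟩
  exact memLp_const a

theorem dualCoef_sub_const (hΩb : Bornology.IsBounded Ω) (ψ : 𝒯.freeVertices γ → L2 Ω)
    (ν : 𝒯.freeVertices γ) {w : E d → ℝ} (hw : MemLp w 2 (mu Ω)) (a : ℝ) :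
    𝒯.dualCoef ψ ν (fun x => w x - a) =
      𝒯.dualCoef ψ ν w - a * 𝒯.dualCoef ψ ν (fun _ => 1) := by
  unfold dualCoef
  rw [← mul_div_assoc, ← sub_div, ← integral_const_mul, ← integral_sub
    (integrable_mul_dual hw _) ((integrable_mul_dual (memLp_const_of_isBounded hΩb 1) _).const_mul a)]
  congr 2
  ext x
  ring

/-- Where no cell of the star has a vertex on γ, the free nodal functions sum to one on the patch,
and biorthogonality leaves only the term of ν. Thus the projector reproduces constants away from γ.
-/
theorem IsDual.dualCoef_one {c : ℝ} {ψ : 𝒯.freeVertices γ → L2 Ω}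
    (h : 𝒯.IsDual γ c ψ) (hΩo : IsOpen Ω) (hΩ : interior (closure Ω) = Ω)
    (hmem : ∀ ν : 𝒯.freeVertices γ, MemLp (𝒯.hat ν) 2 (mu Ω)) (ν : 𝒯.freeVertices γ)
    (hfree : ∀ S ∈ 𝒯.star (ν : E d), ∀ v ∈ S, v ∉ γ) : 𝒯.dualCoef ψ ν (fun _ => 1) = 1 := by
  unfold dualCoef
  rw [div_eq_one_iff_eq (h.diag_ne_zero ν)]
  have e1 : ∫ x in Ω, 1 * ψ ν x = ∫ x in Ω, ∑ ν' : 𝒯.freeVertices γ, 𝒯.hat ν' x * ψ ν x := by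
    refine integral_congr_ae ?_
    filter_upwards [h.eq_zero_of_notMem ν, 𝒯.ae_mem_cells hΩo hΩ] with x hx hxT
    obtain ⟨T, hT, hxT⟩ := hxT
    by_cases hν : (ν : E d) ∈ T
    · rw [← Finset.sum_mul, 𝒯.sum_freeVertices_eq hT (fun v => 𝒯.hat v x)]
      · congr 1
        rw [← sum_bary (𝒯.isSimplex hT) x]
        exact Finset.sum_congr rfl fun v _ => (𝒯.hat_eq_bary hT (interior_subset hxT) v).symm
      · rintro v (hv | hv)
        · rw [𝒯.hat_eq_bary hT (interior_subset hxT), bary_of_notMem hv]; rfl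
        · rw [𝒯.hat_eq_bary hT (interior_subset hxT), bary_of_notMem fun hvT =>
            hfree T (𝒯.mem_star.2 ⟨hT, hν⟩) v hvT hv]; rfl
    · simp [hx T hT hxT hν]
  rw [e1, integral_finsetSum _ fun ν' _ => integrable_mul_dual (hmem ν') _]
  exact Finset.sum_eq_single_of_mem ν (Finset.mem_univ _) fun ν' _ hne => h.orthogonal ν' ν hne

end Mesh

end OpPrec

/-! ### Boundedness of the projector in L₂ and in the H¹-seminorm -/

namespace OpPrec

namespace Mesh

/-- `z` consists of the nodal functions `φ_ν` and their gradients, as elements of `H¹_{0,γ}(Ω)`. -/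
structure IsHatFamily {d : ℕ} {Ω : Set (E d)} (𝒯 : Mesh Ω) (γ : Set (E d))
    (z : 𝒯.freeVertices γ → L2pair Ω) : Prop where
  mem : ∀ ν, z ν ∈ H10 Ω γ
  fst_eq : ∀ ν, (z ν).fst =ᵐ[mu Ω] 𝒯.hat ν
  snd_eq : ∀ ν, ∀ T ∈ 𝒯.cells, ∀ᵐ x ∂(mu Ω), x ∈ interior (conv T) →
    (z ν).snd x = affGrad (bary T ν)

variable {d : ℕ} {Ω γ : Set (E d)} {𝒯 : Mesh Ω}

theorem exists_isHatFamily (hΩo : IsOpen Ω) (hΩb : Bornology.IsBounded Ω)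
    (hΩ : interior (closure Ω) = Ω) (hγΩ : γ ⊆ frontier Ω) (hγ : 𝒯.IsUnionOfFaces γ) :
    ∃ z, 𝒯.IsHatFamily γ z := by
  choose z h1 h2 h3 using fun ν : 𝒯.freeVertices γ =>
    𝒯.exists_hat_mem_H10 hΩo hΩb hΩ hγΩ hγ ν.2.2
  exact ⟨z, h1, h2, h3⟩

theorem IsHatFamily.memLp_hat {z : 𝒯.freeVertices γ → L2pair Ω} (h : 𝒯.IsHatFamily γ z)
    (ν : 𝒯.freeVertices γ) : MemLp (𝒯.hat ν) 2 (mu Ω) :=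
  (memLp_congr_ae (h.fst_eq ν)).1 (Lp.memLp (z ν).fst)

/-- The extension of nodal values by zero to all points. -/
def nodalExt (𝒯 : Mesh Ω) (e : 𝒯.freeVertices γ → ℝ) : E d → ℝ :=
  Function.extend Subtype.val e 0

theorem nodalExt_coe (e : 𝒯.freeVertices γ → ℝ) (ν : 𝒯.freeVertices γ) :
    𝒯.nodalExt e ν = e ν :=
  Subtype.val_injective.extend_apply e 0 ν

theorem nodalExt_of_notMem (e : 𝒯.freeVertices γ → ℝ) {v : E d} (hv : v ∉ 𝒯.freeVertices γ) :
    𝒯.nodalExt e v = 0 :=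
  Function.extend_apply' (f := Subtype.val) e (0 : E d → ℝ) v (by rintro ⟨ν, rfl⟩; exact hv ν.2)

theorem sum_freeVertices_smul {F : Type*} [AddCommGroup F] [Module ℝ F]
    (e : 𝒯.freeVertices γ → ℝ) {T : Finset (E d)} {G : E d → F}
    (hG : ∀ v, v ∉ T → G v = 0) :
    ∑ ν : 𝒯.freeVertices γ, e ν • G ν = ∑ v ∈ T, 𝒯.nodalExt e v • G v := by
  rw [Finset.sum_congr rfl fun ν _ => by rw [← nodalExt_coe e ν],
    Finset.sum_set_coe (𝒯.freeVertices γ) (f := fun v => 𝒯.nodalExt e v • G v)]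
  refine Finset.sum_congr_of_eq_on_inter (fun v _ hv => by rw [hG v hv, smul_zero])
    (fun v _ hv => ?_) fun _ _ _ => rfl
  rw [nodalExt_of_notMem e (fun h => hv (mem_toFinset.2 h)), zero_smul]

theorem IsHatFamily.sum_fst_eq {z : 𝒯.freeVertices γ → L2pair Ω} (h : 𝒯.IsHatFamily γ z)
    (e : 𝒯.freeVertices γ → ℝ) : ∀ᵐ x ∂(mu Ω), ∀ T ∈ 𝒯.cells, x ∈ interior (conv T) →
      (∑ ν, e ν • (z ν).fst : L2 Ω) x = ∑ v ∈ T, 𝒯.nodalExt e v • bary T v x := by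
  filter_upwards [Lp.coeFn_finsetSum Finset.univ fun ν => e ν • (z ν).fst,
    eventually_all.2 fun ν => Lp.coeFn_smul (e ν) (z ν).fst,
    eventually_all.2 h.fst_eq] with x h1 h2 h3 T hT hxT
  rw [h1, Finset.sum_apply, ← sum_freeVertices_smul e (G := fun v => bary T v x)
    fun v hv => by rw [bary_of_notMem hv]; rfl]
  refine Finset.sum_congr rfl fun ν _ => ?_
  rw [h2 ν, Pi.smul_apply, h3 ν, 𝒯.hat_eq_bary hT (interior_subset hxT)]

theorem affGrad_zero : affGrad (0 : E d →ᵃ[ℝ] ℝ) = 0 := by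
  refine ext_inner_right ℝ fun v => ?_
  rw [inner_affGrad, inner_zero_left]; rfl

theorem IsHatFamily.sum_snd_eq {z : 𝒯.freeVertices γ → L2pair Ω} (h : 𝒯.IsHatFamily γ z)
    (e : 𝒯.freeVertices γ → ℝ) : ∀ᵐ x ∂(mu Ω), ∀ T ∈ 𝒯.cells, x ∈ interior (conv T) →
      (∑ ν, e ν • (z ν).snd : L2vec Ω) x = ∑ v ∈ T, 𝒯.nodalExt e v • affGrad (bary T v) := by
  filter_upwards [Lp.coeFn_finsetSum Finset.univ fun ν => e ν • (z ν).snd,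
    eventually_all.2 fun ν => Lp.coeFn_smul (e ν) (z ν).snd,
    eventually_all.2 fun ν => (ae_ball_iff 𝒯.cells.countable_toSet).2 (h.snd_eq ν)]
    with x h1 h2 h3 T hT hxT
  rw [h1, Finset.sum_apply, ← sum_freeVertices_smul e (G := fun v => affGrad (bary T v))
    fun v hv => by rw [bary_of_notMem hv, affGrad_zero]]
  refine Finset.sum_congr rfl fun ν _ => ?_
  rw [h2 ν, Pi.smul_apply, h3 ν T hT hxT]

theorem norm_sq_eq_sum (hΩ : interior (closure Ω) = Ω) {F : Type*}
    [NormedAddCommGroup F] (f : Lp F 2 (mu Ω)) :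
    ‖f‖ ^ 2 = ∑ T ∈ 𝒯.cells, sqInt (interior (conv T)) f := by
  have h1 := enorm_Lp_sq f
  rw [𝒯.lintegral_eq_sum hΩ, Finset.sum_congr rfl fun T hT =>
    (ofReal_sqInt (memLp_restrict_cell hΩ (Lp.memLp f) hT)).symm,
    ← ENNReal.ofReal_sum_of_nonneg fun _ _ => sqInt_nonneg _ _, enorm_norm_sq] at h1
  rwa [ENNReal.ofReal_eq_ofReal_iff (by positivity)
    (Finset.sum_nonneg fun _ _ => sqInt_nonneg _ _)] at h1

theorem sqInt_le_of_ae_le {F : Type*} [NormedAddCommGroup F] {f : E d → F} {T : Finset (E d)}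
    {B : ℝ} (hB : 0 ≤ B) (h : ∀ᵐ x, x ∈ interior (conv T) → ‖f x‖ ^ 2 ≤ B) :
    sqInt (interior (conv T)) f ≤ vol T * B := by
  have hv : 0 ≤ vol T := ENNReal.toReal_nonneg
  refine sqInt_le_of_le (by positivity) ?_
  rw [mul_comm, ENNReal.ofReal_mul hB, ← volume_interior_eq, ← setLIntegral_const]
  refine setLIntegral_mono_ae' measurableSet_interior ?_
  filter_upwards [h] with x hx hxT
  rw [enorm_norm_sq]
  exact ENNReal.ofReal_le_ofReal (hx hxT)

theorem ae_cell_of_ae (hΩo : IsOpen Ω) (hΩ : interior (closure Ω) = Ω) {p : E d → Prop}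
    {T : Finset (E d)} (hT : T ∈ 𝒯.cells)
    (h : ∀ᵐ x ∂(mu Ω), x ∈ interior (conv T) → p x) :
    ∀ᵐ x, x ∈ interior (conv T) → p x := by
  filter_upwards [(ae_restrict_iff' hΩo.measurableSet).1 h] with x hx hxT
  exact hx (𝒯.interior_conv_subset hΩ hT hxT) hxT

theorem norm_sum_smul_sq_le {F : Type*} [NormedAddCommGroup F] [NormedSpace ℝ F]
    (T : Finset (E d)) (e : E d → ℝ) (G : E d → F) :
    ‖∑ v ∈ T, e v • G v‖ ^ 2 ≤ T.card * ∑ v ∈ T, e v ^ 2 * ‖G v‖ ^ 2 := by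
  calc _ ≤ (∑ v ∈ T, ‖e v • G v‖) ^ 2 := by gcongr; exact norm_sum_le _ _
    _ ≤ _ := sq_sum_le_card_mul_sum_sq
    _ = _ := by simp only [norm_smul, mul_pow, Real.norm_eq_abs, sq_abs]

theorem IsDual.vol_mul_sq_nodalExt_le {c : ℝ} (hc : 0 < c) {ψ : 𝒯.freeVertices γ → L2 Ω}
    (h : 𝒯.IsDual γ c ψ) (hΩo : IsOpen Ω) (hΩ : interior (closure Ω) = Ω)
    (hmem : ∀ ν : 𝒯.freeVertices γ, MemLp (𝒯.hat ν) 2 (mu Ω)) {w : E d → ℝ}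
    (hw : MemLp w 2 (mu Ω)) {T : Finset (E d)} (hT : T ∈ 𝒯.cells) {v : E d} (hv : v ∈ T) :
    vol T * 𝒯.nodalExt (fun ν => 𝒯.dualCoef ψ ν w) v ^ 2 ≤
      2 ^ (d + 2) / c ^ 2 * 𝒯.starInt w v := by
  by_cases hvf : v ∈ 𝒯.freeVertices γ
  · have := h.vol_mul_sq_dualCoef_le hc hΩo hΩ hw ⟨v, hvf⟩ (hmem _) (𝒯.mem_star.2 ⟨hT, hv⟩)
    rwa [← nodalExt_coe (fun ν => 𝒯.dualCoef ψ ν w)] at this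
  · rw [nodalExt_of_notMem _ hvf, zero_pow two_ne_zero, mul_zero]
    have := 𝒯.starInt_nonneg w v
    positivity

/-- The square of the norm of the biorthogonal projector on `L₂(Ω)`. -/
def projConst (d : ℕ) (N : ℕ) (c : ℝ) : ℝ :=
  (d + 1) * (2 ^ (d + 2) / c ^ 2) * (N * (d + 1))

/-- On a cell only d + 1 nodal functions, with values in [0, 1], are present; their coefficients are
controlled on patches, which overlap boundedly. -/
theorem norm_sq_proj_le {σ κ : ℝ} {N : ℕ} (hreg : 𝒯.Regular σ κ N) {c : ℝ} (hc : 0 < c)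
    {ψ : 𝒯.freeVertices γ → L2 Ω} (h : 𝒯.IsDual γ c ψ) (hΩo : IsOpen Ω)
    (hΩ : interior (closure Ω) = Ω) {z : 𝒯.freeVertices γ → L2pair Ω}
    (hz : 𝒯.IsHatFamily γ z) (w : L2 Ω) :
    ‖∑ ν, 𝒯.dualCoef ψ ν w • (z ν).fst‖ ^ 2 ≤ projConst d N c * ‖w‖ ^ 2 := by
  rw [norm_sq_eq_sum (𝒯 := 𝒯) hΩ, norm_sq_eq_sum (𝒯 := 𝒯) hΩ]
  have hcell : ∀ T ∈ 𝒯.cells,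
      sqInt (interior (conv T)) (∑ ν, 𝒯.dualCoef ψ ν w • (z ν).fst : L2 Ω) ≤
      (d + 1) * (2 ^ (d + 2) / c ^ 2) *
        𝒯.neighborSum (fun S => sqInt (interior (conv S)) w) T := by
    intro T hT
    set e := 𝒯.nodalExt fun ν => 𝒯.dualCoef ψ ν w
    have hv := (vol_pos (𝒯.isSimplex hT)).le
    calc _ ≤ vol T * ((d + 1) * ∑ v ∈ T, e v ^ 2) := by
          refine sqInt_le_of_ae_le (by positivity) (ae_cell_of_ae hΩo hΩ hT ?_)
          filter_upwards [hz.sum_fst_eq fun ν => 𝒯.dualCoef ψ ν w] with x hx hxT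
          rw [hx T hT hxT]
          refine (norm_sum_smul_sq_le T e fun v => bary T v x).trans ?_
          rw [𝒯.card_eq T hT]
          push_cast
          gcongr with v hv
          have h0 := bary_nonneg (𝒯.isSimplex hT) (interior_subset hxT) v
          have h1 := bary_le_one (𝒯.isSimplex hT) (interior_subset hxT) v
          rw [Real.norm_of_nonneg h0]
          exact mul_le_of_le_one_right (sq_nonneg _) (pow_le_one₀ h0 h1)
      _ = (d + 1) * ∑ v ∈ T, vol T * e v ^ 2 := by rw [← Finset.mul_sum]; ring
      _ ≤ (d + 1) * ∑ v ∈ T, 2 ^ (d + 2) / c ^ 2 * 𝒯.starInt w v := by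
          refine mul_le_mul_of_nonneg_left (Finset.sum_le_sum fun v hv => ?_) (by positivity)
          exact h.vol_mul_sq_nodalExt_le hc hΩo hΩ hz.memLp_hat (Lp.memLp w) hT hv
      _ = _ := by rw [← Finset.mul_sum, ← mul_assoc]; rfl
  refine (Finset.sum_le_sum hcell).trans ?_
  rw [← Finset.mul_sum, projConst, mul_assoc _ (N * ((d : ℝ) + 1))]
  gcongr
  exact hreg.sum_neighborSum_le fun S => sqInt_nonneg _ _

/-- The square of the norm of the biorthogonal projector in the `H¹(Ω)`-seminorm. -/
def gradConst (d : ℕ) (σ κ : ℝ) (N : ℕ) (c : ℝ) : ℝ :=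
  (d + 1) ^ 2 * (2 ^ (d + 2) / c ^ 2 * (N * oscConst d σ κ N)) *
    (σ * (3 ^ d * ballVol d)) ^ 2 * (N * (d + 1)) ^ 2

theorem sum_affGrad_bary {T : Finset (E d)} (hT : IsSimplex T) :
    ∑ v ∈ T, affGrad (bary T v) = 0 := by
  refine ext_inner_right ℝ fun x => ?_
  rw [sum_inner, inner_zero_left]
  have h1 : ∀ v, ⟪affGrad (bary T v), x⟫ = bary T v x - bary T v 0 := fun v => by
    rw [affineMap_sub, sub_zero]
  rw [Finset.sum_congr rfl fun v _ => h1 v, Finset.sum_sub_distrib, sum_bary hT, sum_bary hT,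
    sub_self]

/-- If a ≠ 0, all vertices of T are free and their coefficients shift by exactly a, which is
harmless since the gradients of the barycentric coordinates sum to zero. -/
theorem sum_nodalExt_sub_smul (hΩo : IsOpen Ω) (hΩb : Bornology.IsBounded Ω)
    (hΩ : interior (closure Ω) = Ω) {c : ℝ} {ψ : 𝒯.freeVertices γ → L2 Ω}
    (h : 𝒯.IsDual γ c ψ) (hmem : ∀ ν : 𝒯.freeVertices γ, MemLp (𝒯.hat ν) 2 (mu Ω))
    {w : E d → ℝ} (hw : MemLp w 2 (mu Ω)) {T : Finset (E d)} (hT : T ∈ 𝒯.cells) {a : ℝ}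
    (ha : a = 0 ∨ ∀ ν ∈ T, ∀ S ∈ 𝒯.star ν, ∀ v ∈ S, v ∉ γ) :
    ∑ v ∈ T, 𝒯.nodalExt (fun ν => 𝒯.dualCoef ψ ν w) v • affGrad (bary T v) =
      ∑ v ∈ T, 𝒯.nodalExt (fun ν => 𝒯.dualCoef ψ ν fun x => w x - a) v • affGrad (bary T v) := by
  rcases ha with rfl | ha
  · simp only [sub_zero]
  · have e1 : ∀ v ∈ T, 𝒯.nodalExt (fun ν => 𝒯.dualCoef ψ ν fun x => w x - a) v =
        𝒯.nodalExt (fun ν => 𝒯.dualCoef ψ ν w) v - a := by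
      intro v hv
      have hvf : v ∈ 𝒯.freeVertices γ :=
        ⟨⟨T, hT, hv⟩, ha v hv T (𝒯.mem_star.2 ⟨hT, hv⟩) v hv⟩
      have := dualCoef_sub_const hΩb ψ ⟨v, hvf⟩ hw a
      rw [h.dualCoef_one hΩo hΩ hmem ⟨v, hvf⟩ (ha v hv), mul_one] at this
      have e2 := nodalExt_coe (fun ν => 𝒯.dualCoef ψ ν fun x => w x - a) ⟨v, hvf⟩
      have e3 := nodalExt_coe (fun ν => 𝒯.dualCoef ψ ν w) ⟨v, hvf⟩
      dsimp only at e2 e3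
      rw [e2, e3, this]
    rw [Finset.sum_congr rfl fun v hv => congrArg (· • affGrad (bary T v)) (e1 v hv)]
    simp only [sub_smul]
    rw [Finset.sum_sub_distrib, ← Finset.smul_sum, sum_affGrad_bary (𝒯.isSimplex hT), smul_zero,
      sub_zero]

/-- The factor diam T ^ 2 from the approximation of y by a constant cancels the squared gradients of
the nodal functions, of order diam T ^ (-2). The nested neighbour sum costs the overlap constant
twice. -/
theorem norm_sq_grad_proj_le {σ κ : ℝ} {N : ℕ} (hreg : 𝒯.Regular σ κ N) (hd : 1 ≤ d)
    (hσ : 0 ≤ σ) (hκ : 1 ≤ κ) (hΩo : IsOpen Ω) (hΩb : Bornology.IsBounded Ω)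
    (hΩ : interior (closure Ω) = Ω) (hγ : 𝒯.IsUnionOfFaces γ) {c : ℝ} (hc : 0 < c)
    {ψ : 𝒯.freeVertices γ → L2 Ω} (h : 𝒯.IsDual γ c ψ)
    {z : 𝒯.freeVertices γ → L2pair Ω} (hz : 𝒯.IsHatFamily γ z) {y : L2pair Ω}
    (hy : y ∈ H10 Ω γ) :
    ‖∑ ν, 𝒯.dualCoef ψ ν y.fst • (z ν).snd‖ ^ 2 ≤ gradConst d σ κ N c * ‖y.snd‖ ^ 2 := by
  have hβ := ballVol_pos d
  have hκ0 : 0 ≤ κ := zero_le_one.trans hκ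
  have hJ := jumpConst_nonneg d hσ hκ0
  have hosc : 0 ≤ oscConst d σ κ N := by unfold oscConst traceConst; positivity
  rw [norm_sq_eq_sum (𝒯 := 𝒯) hΩ, norm_sq_eq_sum (𝒯 := 𝒯) hΩ]
  set G : Finset (E d) → ℝ := fun S => sqInt (interior (conv S)) (Ω.indicator y.snd)
  have hG : ∀ S, 0 ≤ G S := fun S => sqInt_nonneg _ _
  have hGe : ∑ T ∈ 𝒯.cells, sqInt (interior (conv T)) y.snd = ∑ T ∈ 𝒯.cells, G T :=
    Finset.sum_congr rfl fun T hT => sqInt_congr measurableSet_interior fun x hx => by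
      rw [indicator_of_mem (𝒯.interior_conv_subset hΩ hT hx)]
  set L := (d + 1) ^ 2 * (2 ^ (d + 2) / c ^ 2 * (N * oscConst d σ κ N)) *
    (σ * (3 ^ d * ballVol d)) ^ 2 with hL
  have hcell : ∀ T ∈ 𝒯.cells,
      sqInt (interior (conv T)) (∑ ν, 𝒯.dualCoef ψ ν y.fst • (z ν).snd : L2vec Ω) ≤
      L * 𝒯.neighborSum (𝒯.neighborSum G) T := by
    intro T hT
    set A := 𝒯.neighborSum (𝒯.neighborSum G) T
    have hA0 : 0 ≤ A := neighborSum_nonneg (neighborSum_nonneg hG) T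
    obtain ⟨a, ha, hosc'⟩ := hreg.exists_const hd hσ hκ hΩo hΩ hγ hy hT
    have hw : MemLp (fun x => y.fst x - a) 2 (mu Ω) :=
      memLp_sub_const hΩb.measure_lt_top.ne (Lp.memLp _) a
    have hV := sum_nodalExt_sub_smul hΩo hΩb hΩ h hz.memLp_hat (Lp.memLp y.fst) hT ha
    set e := 𝒯.nodalExt fun ν => 𝒯.dualCoef ψ ν fun x => y.fst x - a with he
    have hv := (vol_pos (𝒯.isSimplex hT)).le
    have hD := cellDiam_pos hd (𝒯.isSimplex hT)
    calc _ ≤ vol T * ((d + 1) * ∑ v ∈ T, e v ^ 2 * ‖affGrad (bary T v)‖ ^ 2) := by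
          refine sqInt_le_of_ae_le (by positivity) (ae_cell_of_ae hΩo hΩ hT ?_)
          filter_upwards [hz.sum_snd_eq fun ν => 𝒯.dualCoef ψ ν y.fst] with x hx hxT
          rw [hx T hT hxT, hV]
          refine (norm_sum_smul_sq_le T e fun v => affGrad (bary T v)).trans (le_of_eq ?_)
          rw [𝒯.card_eq T hT]
          push_cast
          rfl
      _ = (d + 1) * ∑ v ∈ T, vol T * e v ^ 2 * ‖affGrad (bary T v)‖ ^ 2 := by
          rw [mul_left_comm, Finset.mul_sum]
          simp only [mul_assoc]
      _ ≤ (d + 1) * ∑ v ∈ T, 2 ^ (d + 2) / c ^ 2 * (N * oscConst d σ κ N) *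
            (σ * (3 ^ d * ballVol d)) ^ 2 * A := by
          refine mul_le_mul_of_nonneg_left (Finset.sum_le_sum fun v hvT => ?_) (by positivity)
          have h1 := h.vol_mul_sq_nodalExt_le hc hΩo hΩ hz.memLp_hat hw hT hvT
          have h2 : 𝒯.starInt (fun x => y.fst x - a) v ≤
              N * (oscConst d σ κ N * (cellDiam T ^ 2 * A)) := by
            calc _ ≤ ∑ S ∈ 𝒯.star v, oscConst d σ κ N * (cellDiam T ^ 2 * A) := by
                  refine Finset.sum_le_sum fun S hS => ?_
                  rw [sqInt_congr (g := fun x => Ω.indicator y.fst x - a) measurableSet_interior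
                    fun x hx => by rw [indicator_of_mem
                      (𝒯.interior_conv_subset hΩ (𝒯.mem_star.1 hS).1 hx)]]
                  exact hosc' v hvT S hS
              _ ≤ _ := by
                  rw [Finset.sum_const, nsmul_eq_mul]
                  have : ((𝒯.star v).card : ℝ) ≤ N := by exact_mod_cast hreg.valence v
                  gcongr
          have h3 := norm_affGrad_bary_mul_le hd (𝒯.isSimplex hT) (hreg.shape T hT) v
          calc _ ≤ 2 ^ (d + 2) / c ^ 2 * (N * (oscConst d σ κ N * (cellDiam T ^ 2 * A))) *
                ‖affGrad (bary T v)‖ ^ 2 := by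
                exact mul_le_mul_of_nonneg_right (h1.trans (mul_le_mul_of_nonneg_left h2
                  (by positivity))) (sq_nonneg _)
            _ = 2 ^ (d + 2) / c ^ 2 * (N * oscConst d σ κ N) *
                (‖affGrad (bary T v)‖ * cellDiam T) ^ 2 * A := by ring
            _ ≤ _ := by gcongr
      _ = _ := by
          rw [Finset.sum_const, nsmul_eq_mul, 𝒯.card_eq T hT, hL]
          push_cast
          ring
  have hL0 : 0 ≤ L := by positivity
  calc _ ≤ ∑ T ∈ 𝒯.cells, L * 𝒯.neighborSum (𝒯.neighborSum G) T := Finset.sum_le_sum hcell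
    _ = L * ∑ T ∈ 𝒯.cells, 𝒯.neighborSum (𝒯.neighborSum G) T := by rw [Finset.mul_sum]
    _ ≤ L * (N * (d + 1) * (N * (d + 1) * ∑ T ∈ 𝒯.cells, G T)) := by
        gcongr
        refine (hreg.sum_neighborSum_le (neighborSum_nonneg hG)).trans ?_
        gcongr
        exact hreg.sum_neighborSum_le hG
    _ = _ := by rw [hGe, gradConst, hL]; ring

end Mesh

end OpPrec

/-! ### Interpolation of the projector, and elements of 𝒱_𝒯 -/

namespace OpPrec

/-- P maps each decomposition of u to a decomposition of P u, with both parts enlarged by at most C.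
-/
theorem K_map_le {d : ℕ} {Ω γ : Set (E d)} {P : L2 Ω →ₗ[ℝ] L2 Ω} {C : ℝ} (hC : 0 < C)
    (h0 : ∀ u, ‖P u‖ ≤ C * ‖u‖)
    (h1 : ∀ y : H10 Ω γ, ∃ y' : H10 Ω γ, (y' : L2pair Ω).fst = P (y : L2pair Ω).fst ∧
      ‖y'‖ ≤ C * ‖y‖) (t : ℝ) (u : L2 Ω) :
    K Ω γ t (P u) ≤ ENNReal.ofReal C * K Ω γ t u := by
  conv_rhs => unfold K
  rw [ENNReal.mul_iInf_of_ne (ENNReal.ofReal_pos.2 hC).ne' ENNReal.ofReal_ne_top]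
  refine le_iInf fun y => ?_
  obtain ⟨y', hy', hn⟩ := h1 y
  refine (iInf_le _ y').trans ?_
  rw [hy', ← map_sub, mul_add, mul_left_comm]
  have e1 : ‖P (u - (y : L2pair Ω).fst)‖ₑ ≤ ENNReal.ofReal C * ‖u - (y : L2pair Ω).fst‖ₑ := by
    rw [← ofReal_norm, ← ofReal_norm, ← ENNReal.ofReal_mul hC.le]
    exact ENNReal.ofReal_le_ofReal (h0 _)
  have e2 : ‖y'‖ₑ ≤ ENNReal.ofReal C * ‖y‖ₑ := by
    rw [← ofReal_norm y', ← ofReal_norm y, ← ENNReal.ofReal_mul hC.le]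
    exact ENNReal.ofReal_le_ofReal hn
  gcongr

/-- Interpolation of an operator that is bounded on `L₂(Ω)` and on `H¹_{0,γ}(Ω)`. -/
theorem interpNorm_map_le {d : ℕ} {Ω γ : Set (E d)} {P : L2 Ω →ₗ[ℝ] L2 Ω} {C : ℝ} (hC : 0 < C)
    (h0 : ∀ u, ‖P u‖ ≤ C * ‖u‖)
    (h1 : ∀ y : H10 Ω γ, ∃ y' : H10 Ω γ, (y' : L2pair Ω).fst = P (y : L2pair Ω).fst ∧
      ‖y'‖ ≤ C * ‖y‖) (s : ℝ) (u : L2 Ω) :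
    interpNorm Ω γ s (P u) ≤ ENNReal.ofReal C * interpNorm Ω γ s u := by
  have hC0 : ENNReal.ofReal C ≠ 0 := (ENNReal.ofReal_pos.2 hC).ne'
  unfold interpNorm
  split_ifs
  · rw [← ofReal_norm, ← ofReal_norm, ← ENNReal.ofReal_mul hC.le]
    exact ENNReal.ofReal_le_ofReal (h0 _)
  · rw [ENNReal.mul_iInf_of_ne hC0 ENNReal.ofReal_ne_top]
    refine le_iInf fun y => ?_
    rw [ENNReal.mul_iInf_of_ne hC0 ENNReal.ofReal_ne_top]
    refine le_iInf fun hy => ?_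
    obtain ⟨y', hy', hn⟩ := h1 y
    refine (iInf₂_le y' (by rw [hy', hy])).trans ?_
    rw [← ofReal_norm y', ← ofReal_norm y, ← ENNReal.ofReal_mul hC.le]
    exact ENNReal.ofReal_le_ofReal hn
  · calc _ ≤ (∫⁻ t, ENNReal.ofReal C ^ (2 : ℝ) *
            (ENNReal.ofReal (t ^ (-s)) * K Ω γ t u) ^ (2 : ℝ) ∂logMeasure) ^ (1 / (2 : ℝ)) := by
          refine ENNReal.rpow_le_rpow (lintegral_mono fun t => ?_) (by norm_num)
          rw [← ENNReal.mul_rpow_of_nonneg _ _ zero_le_two]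
          refine ENNReal.rpow_le_rpow ?_ zero_le_two
          rw [mul_left_comm]
          gcongr
          exact K_map_le hC h0 h1 t u
      _ = _ := by
        rw [lintegral_const_mul' _ _ (ENNReal.rpow_ne_top_of_nonneg zero_le_two
          ENNReal.ofReal_ne_top), ENNReal.mul_rpow_of_nonneg _ _ (by norm_num),
          ← ENNReal.rpow_mul]
        norm_num

namespace Mesh

variable {d : ℕ} {Ω γ : Set (E d)} {𝒯 : Mesh Ω}

theorem dualCoef_coe (ψ : 𝒯.freeVertices γ → L2 Ω) (ν : 𝒯.freeVertices γ) (w : L2 Ω) :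
    𝒯.dualCoef ψ ν w = ⟪ψ ν, w⟫ / ∫ x in Ω, 𝒯.hat ν x * ψ ν x := by
  unfold dualCoef
  rw [L2.inner_def]
  rfl

theorem IsHatFamily.inner_eq {z : 𝒯.freeVertices γ → L2pair Ω} (hz : 𝒯.IsHatFamily γ z)
    (ψ : L2 Ω) (ν : 𝒯.freeVertices γ) :
    ⟪ψ, (z ν).fst⟫ = ∫ x in Ω, 𝒯.hat ν x * ψ x := by
  rw [L2.inner_def]
  refine integral_congr_ae ?_
  filter_upwards [hz.fst_eq ν] with x hx
  rw [← hx]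
  rfl

/-- The biorthogonal projector onto the span of the nodal functions. -/
def dualProj (𝒯 : Mesh Ω) (ψ : 𝒯.freeVertices γ → L2 Ω) (z : 𝒯.freeVertices γ → L2pair Ω) :
    L2 Ω →ₗ[ℝ] L2 Ω where
  toFun w := ∑ ν, 𝒯.dualCoef ψ ν w • (z ν).fst
  map_add' w w' := by
    simp only [dualCoef_coe, inner_add_right, add_div, add_smul, Finset.sum_add_distrib]
  map_smul' a w := by
    simp only [dualCoef_coe, inner_smul_right, mul_div_assoc, mul_smul, Finset.smul_sum]
    rfl

theorem dualProj_apply (ψ : 𝒯.freeVertices γ → L2 Ω) (z : 𝒯.freeVertices γ → L2pair Ω)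
    (w : L2 Ω) : 𝒯.dualProj ψ z w = ∑ ν, 𝒯.dualCoef ψ ν w • (z ν).fst := rfl

/-- A bound for the norm of the biorthogonal projector on `L₂(Ω)` and on `H¹_{0,γ}(Ω)`. -/
def normConst (d : ℕ) (σ κ : ℝ) (N : ℕ) (c : ℝ) : ℝ :=
  √(projConst d N c + gradConst d σ κ N c + 1)

theorem projConst_nonneg (d : ℕ) (N : ℕ) (c : ℝ) : 0 ≤ projConst d N c := by
  unfold projConst; positivity

theorem gradConst_nonneg (d : ℕ) {σ κ : ℝ} (hσ : 0 ≤ σ) (hκ : 0 ≤ κ) (N : ℕ) (c : ℝ) :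
    0 ≤ gradConst d σ κ N c := by
  have hβ := ballVol_pos d
  have hJ := jumpConst_nonneg d hσ hκ
  have hosc : 0 ≤ oscConst d σ κ N := by unfold oscConst traceConst; positivity
  unfold gradConst; positivity

theorem normConst_pos (d : ℕ) {σ κ : ℝ} (hσ : 0 ≤ σ) (hκ : 0 ≤ κ) (N : ℕ) (c : ℝ) :
    0 < normConst d σ κ N c := by
  have h1 := projConst_nonneg d N c
  have h2 := gradConst_nonneg d hσ hκ N c
  unfold normConst; positivity

theorem sum_smul_fst {ι : Type*} (s : Finset ι) (e : ι → ℝ) (z : ι → L2pair Ω) :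
    (∑ ν ∈ s, e ν • z ν).fst = ∑ ν ∈ s, e ν • (z ν).fst :=
  (map_sum (WithLp.fstₗ 2 ℝ (L2 Ω) (L2vec Ω)) _ _).trans rfl

theorem sum_smul_snd {ι : Type*} (s : Finset ι) (e : ι → ℝ) (z : ι → L2pair Ω) :
    (∑ ν ∈ s, e ν • z ν).snd = ∑ ν ∈ s, e ν • (z ν).snd :=
  (map_sum (WithLp.sndₗ 2 ℝ (L2 Ω) (L2vec Ω)) _ _).trans rfl

/-- The square of `normConst` is the sum of the bounds for function and gradient, so it serves on L₂
and on H¹_{0,γ} alike; the summand 1 makes it positive. -/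
theorem interpNorm_dualProj_le {σ κ : ℝ} {N : ℕ} (hreg : 𝒯.Regular σ κ N) (hd : 1 ≤ d)
    (hσ : 0 ≤ σ) (hκ : 1 ≤ κ) (hΩo : IsOpen Ω) (hΩb : Bornology.IsBounded Ω)
    (hΩ : interior (closure Ω) = Ω) (hγ : 𝒯.IsUnionOfFaces γ) {c : ℝ} (hc : 0 < c)
    {ψ : 𝒯.freeVertices γ → L2 Ω} (h : 𝒯.IsDual γ c ψ)
    {z : 𝒯.freeVertices γ → L2pair Ω} (hz : 𝒯.IsHatFamily γ z) (s : ℝ) (u : L2 Ω) :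
    interpNorm Ω γ s (𝒯.dualProj ψ z u) ≤
      ENNReal.ofReal (normConst d σ κ N c) * interpNorm Ω γ s u := by
  have hκ0 : 0 ≤ κ := zero_le_one.trans hκ
  have h1 := projConst_nonneg d N c
  have h2 := gradConst_nonneg d hσ hκ0 N c
  have hC := normConst_pos d hσ hκ0 N c
  have hCsq : normConst d σ κ N c ^ 2 = projConst d N c + gradConst d σ κ N c + 1 :=
    Real.sq_sqrt (by positivity)
  refine interpNorm_map_le hC (fun w => ?_) (fun y => ?_) s u
  · rw [← pow_le_pow_iff_left₀ (norm_nonneg _) (by positivity) two_ne_zero, mul_pow, hCsq]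
    refine (norm_sq_proj_le hreg hc h hΩo hΩ hz w).trans ?_
    gcongr
    linarith
  · refine ⟨⟨∑ ν, 𝒯.dualCoef ψ ν (y : L2pair Ω).fst • z ν,
      sum_mem fun ν _ => Submodule.smul_mem _ _ (hz.mem ν)⟩, sum_smul_fst _ _ _, ?_⟩
    rw [← pow_le_pow_iff_left₀ (norm_nonneg _) (by positivity) two_ne_zero, mul_pow, hCsq,
      Submodule.coe_norm, Submodule.coe_norm, WithLp.prod_norm_sq_eq_of_L2,
      WithLp.prod_norm_sq_eq_of_L2, sum_smul_fst, sum_smul_snd]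
    have e1 := norm_sq_proj_le hreg hc h hΩo hΩ hz (y : L2pair Ω).fst
    have e2 := norm_sq_grad_proj_le hreg hd hσ hκ hΩo hΩb hΩ hγ hc h hz y.2
    nlinarith [sq_nonneg ‖(y : L2pair Ω).fst‖, sq_nonneg ‖(y : L2pair Ω).snd‖,
      mul_nonneg h1 (sq_nonneg ‖(y : L2pair Ω).snd‖),
      mul_nonneg h2 (sq_nonneg ‖(y : L2pair Ω).fst‖)]

theorem IsHatFamily.exists_mem_VT {z : 𝒯.freeVertices γ → L2pair Ω} (hz : 𝒯.IsHatFamily γ z)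
    {s : ℝ} (hs : s ∈ Icc (0 : ℝ) 1) (ν : 𝒯.freeVertices γ) :
    ∃ v : 𝒯.VT γ s, VSpace.toL2 Ω γ s v = (z ν).fst := by
  refine ⟨⟨(⟨(z ν).fst, interpNorm_fst_lt_top hs ⟨z ν, hz.mem ν⟩⟩ : interpSubmodule Ω γ s),
    ⟨⟨z ν, hz.mem ν⟩, rfl⟩, fun T hT => ⟨bary T ν, ?_⟩⟩, rfl⟩
  filter_upwards [hz.fst_eq ν] with x hx hxT
  exact hx.trans (𝒯.hat_eq_bary hT hxT ν)

theorem exists_eq_sum_of_mem_VT (hd : 1 ≤ d) (hΩo : IsOpen Ω)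
    (hΩ : interior (closure Ω) = Ω) (hγ : 𝒯.IsUnionOfFaces γ)
    {z : 𝒯.freeVertices γ → L2pair Ω} (hz : 𝒯.IsHatFamily γ z) {s : ℝ} (v : 𝒯.VT γ s) :
    ∃ e : 𝒯.freeVertices γ → ℝ, VSpace.toL2 Ω γ s v = ∑ ν, e ν • (z ν).fst := by
  obtain ⟨⟨y, hy⟩, hp⟩ := v.2
  rw [← hy] at hp ⊢
  obtain ⟨e, he⟩ := 𝒯.exists_nodal_values hd hΩo hΩ hγ y.2 hp
  refine ⟨e, Lp.ext (he.trans ?_)⟩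
  filter_upwards [Lp.coeFn_finsetSum Finset.univ fun ν => e ν • (z ν).fst,
    eventually_all.2 fun ν => Lp.coeFn_smul (e ν) (z ν).fst,
    eventually_all.2 hz.fst_eq] with x h1 h2 h3
  rw [h1, Finset.sum_apply]
  refine Finset.sum_congr rfl fun ν _ => ?_
  rw [h2 ν, Pi.smul_apply, h3 ν, smul_eq_mul]

end Mesh

end OpPrec

/-! ### Stability of D and the bases -/

namespace OpPrec

theorem uniform_preconditioner_of_bounds {ι : Type*} {V W : ι → Type*}
    [∀ i, NormedAddCommGroup (V i)]
    [∀ i, NormedSpace ℝ (V i)] [∀ i, NormedAddCommGroup (W i)] [∀ i, NormedSpace ℝ (W i)]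
    [∀ i, FiniteDimensional ℝ (V i)]
    (D : ∀ i, V i →L[ℝ] StrongDual ℝ (W i)) (hD : ∀ i, (D i).IsInvertible)
    (hD' : ∀ i, (D i).flip.IsInvertible) (hD1 : ∀ i v w, ‖D i v w‖ ≤ ‖v‖ * ‖w‖) {C : ℝ}
    (hC0 : 0 ≤ C) (hC : ∀ i v, ‖v‖ ≤ C * ‖D i v‖) (B : ∀ i, W i →L[ℝ] StrongDual ℝ (W i))
    (hB : UniformLisc B) :
    UniformLiscDual (fun i => precond (D i) (B i)) ∧
      ∀ A : ∀ i, V i →L[ℝ] StrongDual ℝ (V i), UniformLisc A →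
        UniformLis (fun i => (precond (D i) (B i)).comp (A i)) := by
  refine uniform_preconditioner D hD hD' (fun i => ?_) (C := C) (fun i => ?_) B hB
  · refine ContinuousLinearMap.opNorm_le_bound _ zero_le_one fun v => ?_
    refine ContinuousLinearMap.opNorm_le_bound _ (by positivity) fun w => ?_
    rw [one_mul]
    exact hD1 i v w
  · refine ContinuousLinearMap.opNorm_le_bound _ hC0 fun w => ?_
    obtain ⟨e, he⟩ := hD i
    have := hC i (e.symm w)
    rw [← he] at this ⊢
    rw [ContinuousLinearMap.inverse_equiv]
    simpa using this

section Invertibility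

variable {V W : Type*} [NormedAddCommGroup V] [NormedSpace ℝ V] [NormedAddCommGroup W]
  [NormedSpace ℝ W] [FiniteDimensional ℝ V] [FiniteDimensional ℝ W]

theorem isInvertible_of_norm_le (D : V →L[ℝ] StrongDual ℝ W)
    (hdim : Module.finrank ℝ V = Module.finrank ℝ W) {C : ℝ} (hC : ∀ v, ‖v‖ ≤ C * ‖D v‖) :
    D.IsInvertible := by
  refine isInvertible_of_injective D ?_ (hdim.trans finrank_strongDual.symm)
  refine (injective_iff_map_eq_zero _).2 fun v hv => ?_
  have := hC v
  rw [hv, norm_zero, mul_zero] at this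
  exact norm_le_zero_iff.1 this

theorem flip_isInvertible_of_forall (D : V →L[ℝ] StrongDual ℝ W)
    (hdim : Module.finrank ℝ V = Module.finrank ℝ W) (h : ∀ w, (∀ v, D v w = 0) → w = 0) :
    D.flip.IsInvertible := by
  refine isInvertible_of_injective D.flip ?_ (hdim.symm.trans finrank_strongDual.symm)
  refine (injective_iff_map_eq_zero _).2 fun w hw => h w fun v => ?_
  have := congrArg (fun F => F v) hw
  simpa using this

end Invertibility

namespace Mesh

section Preconditioner

variable {d : ℕ} {Ω γ : Set (E d)} {𝒯 : Mesh Ω} {s c : ℝ} {ψ : 𝒯.freeVertices γ → L2 Ω}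
  {z : 𝒯.freeVertices γ → L2pair Ω} {φ : 𝒯.freeVertices γ → 𝒯.VT γ s}

theorem IsDual.inner_of_ne (h : 𝒯.IsDual γ c ψ) (hz : 𝒯.IsHatFamily γ z)
    {ν ν' : 𝒯.freeVertices γ} (hne : ν ≠ ν') : ⟪ψ ν', (z ν).fst⟫ = 0 := by
  rw [hz.inner_eq, h.orthogonal ν ν' hne]

theorem IsDual.inner_self_ne_zero (h : 𝒯.IsDual γ c ψ) (hz : 𝒯.IsHatFamily γ z)
    (ν : 𝒯.freeVertices γ) : ⟪ψ ν, (z ν).fst⟫ ≠ 0 := by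
  rw [hz.inner_eq]
  exact h.diag_ne_zero ν

theorem IsDual.inner_sum_fst (h : 𝒯.IsDual γ c ψ) (hz : 𝒯.IsHatFamily γ z)
    (e : 𝒯.freeVertices γ → ℝ) (ν : 𝒯.freeVertices γ) :
    ⟪ψ ν, ∑ ν', e ν' • (z ν').fst⟫ = e ν * ⟪ψ ν, (z ν).fst⟫ := by
  rw [inner_sum, Finset.sum_eq_single_of_mem ν (Finset.mem_univ _), inner_smul_right]
  intro ν' _ hne
  rw [inner_smul_right, h.inner_of_ne hz hne, mul_zero]

theorem toL2_sum_smul {ι : Type*} [Fintype ι] (e : ι → ℝ) (f : ι → 𝒯.VT γ s) :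
    VSpace.toL2 Ω γ s (∑ ν, e ν • f ν : 𝒯.VT γ s) = ∑ ν, e ν • VSpace.toL2 Ω γ s (f ν) := by
  simp [map_sum]

theorem IsDual.linearIndependent_hat (h : 𝒯.IsDual γ c ψ) (hz : 𝒯.IsHatFamily γ z)
    (hφ : ∀ ν, VSpace.toL2 Ω γ s (φ ν) = (z ν).fst) : LinearIndependent ℝ φ := by
  refine Fintype.linearIndependent_iff.2 fun e he ν => ?_
  have h1 := congrArg (fun v : 𝒯.VT γ s => VSpace.toL2 Ω γ s v) he
  simp only [toL2_sum_smul, hφ] at h1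
  have h2 := h.inner_sum_fst hz e ν
  rw [h1, Submodule.coe_zero, map_zero, inner_zero_right] at h2
  exact (mul_eq_zero.1 h2.symm).resolve_right (h.inner_self_ne_zero hz ν)

theorem span_hat (hd : 1 ≤ d) (hΩo : IsOpen Ω) (hΩ : interior (closure Ω) = Ω)
    (hγ : 𝒯.IsUnionOfFaces γ) (hz : 𝒯.IsHatFamily γ z)
    (hφ : ∀ ν, VSpace.toL2 Ω γ s (φ ν) = (z ν).fst) :
    ⊤ ≤ Submodule.span ℝ (range φ) := by
  intro v _
  obtain ⟨e, he⟩ := exists_eq_sum_of_mem_VT hd hΩo hΩ hγ hz v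
  have : v = ∑ ν, e ν • φ ν := by
    refine Subtype.ext (VSpace.toL2_injective Ω γ s ?_)
    rw [toL2_sum_smul, he]
    simp only [hφ]
  rw [this]
  exact sum_mem fun ν _ => Submodule.smul_mem _ _ (Submodule.subset_span ⟨ν, rfl⟩)

theorem DT_hat_sum_gen (h : 𝒯.IsDual γ c ψ) (hz : 𝒯.IsHatFamily γ z)
    (hφ : ∀ ν, VSpace.toL2 Ω γ s (φ ν) = (z ν).fst) (e : 𝒯.freeVertices γ → ℝ)
    (ν : 𝒯.freeVertices γ) :
    DT γ s (𝒯.VT γ s) (WT γ s ψ) (φ ν) (∑ ν', e ν' • WT.gen γ s ψ ν') =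
      e ν * ⟪ψ ν, (z ν).fst⟫ := by
  rw [map_sum, Finset.sum_eq_single_of_mem ν (Finset.mem_univ _), map_smul, DT_apply_gen, hφ,
    smul_eq_mul]
  intro ν' _ hne
  rw [map_smul, DT_apply_gen, hφ, h.inner_of_ne hz hne.symm, smul_zero]

/-- Pairing with φ_ν isolates the coefficient of ψ_ν, so independence holds for the images in 𝒲. -/
theorem IsDual.linearIndependent_gen (h : 𝒯.IsDual γ c ψ) (hz : 𝒯.IsHatFamily γ z)
    (hφ : ∀ ν, VSpace.toL2 Ω γ s (φ ν) = (z ν).fst) :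
    LinearIndependent ℝ (WT.gen γ s ψ) := by
  refine Fintype.linearIndependent_iff.2 fun e he ν => ?_
  have h2 := DT_hat_sum_gen h hz hφ e ν
  rw [he, map_zero] at h2
  exact (mul_eq_zero.1 h2.symm).resolve_right (h.inner_self_ne_zero hz ν)

theorem span_gen : ⊤ ≤ Submodule.span ℝ (range (WT.gen γ s ψ)) := by
  rintro ⟨w, hw⟩ -
  refine Submodule.span_induction (p := fun w hw =>
    (⟨w, hw⟩ : WT γ s ψ) ∈ Submodule.span ℝ (range (WT.gen γ s ψ))) ?_ ?_ ?_ ?_ hw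
  · rintro _ ⟨ν, rfl⟩
    exact Submodule.subset_span ⟨ν, rfl⟩
  · exact zero_mem _
  · intro x y _ _ hx hy
    exact add_mem hx hy
  · intro a x _ hx
    exact Submodule.smul_mem _ a hx

theorem norm_DT_apply_le (V : Submodule ℝ (VSpace Ω γ s)) (W : Submodule ℝ (WSpace Ω γ s))
    (v : V) (w : W) : ‖DT γ s V W v w‖ ≤ ‖v‖ * ‖w‖ := by
  rw [DT_apply, mul_comm]
  refine ((WSpace.toDual Ω γ s w).le_opNorm _).trans (le_of_eq ?_)
  rw [LinearIsometryEquiv.norm_map]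
  rfl

/-- Dual form of Fortin's criterion: a functional f that norms v is replaced by f ∘ P, which is
represented in 𝒲_𝒯, has norm at most C, and has the same value at v since P v = v. -/
theorem norm_le_mul_norm_DT {C : ℝ} (hC : 0 < C)
    (h : 𝒯.IsDual γ c ψ) (hz : 𝒯.IsHatFamily γ z)
    (hφ : ∀ ν, VSpace.toL2 Ω γ s (φ ν) = (z ν).fst)
    (hspan : ⊤ ≤ Submodule.span ℝ (range φ))
    (hP : ∀ u, interpNorm Ω γ s (𝒯.dualProj ψ z u) ≤ ENNReal.ofReal C * interpNorm Ω γ s u)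
    (v : 𝒯.VT γ s) : ‖v‖ ≤ C * ‖DT γ s (𝒯.VT γ s) (WT γ s ψ) v‖ := by
  obtain ⟨f, hf1, hfv⟩ := exists_dual_vector'' ℝ (v : VSpace Ω γ s)
  set δ : 𝒯.freeVertices γ → ℝ := fun ν => ⟪ψ ν, (z ν).fst⟫ with hδ
  -- These coefficients make w the functional f ∘ P, as `hwf` shows.
  set w : WT γ s ψ := ∑ ν, (f (φ ν) / δ ν) • WT.gen γ s ψ ν with hw
  set P : VSpace Ω γ s → 𝒯.VT γ s := fun u =>
    ∑ ν, (⟪ψ ν, VSpace.toL2 Ω γ s u⟫ / δ ν) • φ ν with hPdef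
  have hPL2 : ∀ u, VSpace.toL2 Ω γ s (P u) = 𝒯.dualProj ψ z (VSpace.toL2 Ω γ s u) := by
    intro u
    rw [hPdef, toL2_sum_smul, dualProj_apply]
    refine Finset.sum_congr rfl fun ν _ => ?_
    rw [hφ, dualCoef_coe, hδ]
    dsimp only
    rw [hz.inner_eq]
  have hPn : ∀ u, ‖(P u : VSpace Ω γ s)‖ ≤ C * ‖u‖ := by
    intro u
    rw [VSpace.norm_def, VSpace.norm_def, hPL2, ← ENNReal.toReal_ofReal hC.le,
      ← ENNReal.toReal_mul]
    exact ENNReal.toReal_mono (ENNReal.mul_ne_top ENNReal.ofReal_ne_top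
      (VSpace.interpNorm_lt_top u).ne) (by simpa only [ENNReal.toReal_ofReal hC.le] using hP _)
  have hwf : ∀ u, WSpace.toDual Ω γ s w u = f (P u) := by
    intro u
    have e1 : ((w : WT γ s ψ) : WSpace Ω γ s) = ∑ ν, (f (φ ν) / δ ν) • toW Ω γ s (ψ ν) := by
      rw [hw]
      simp only [Submodule.coe_sum, Submodule.coe_smul]
      rfl
    have e2 : ((P u : 𝒯.VT γ s) : VSpace Ω γ s) =
        ∑ ν, (⟪ψ ν, VSpace.toL2 Ω γ s u⟫ / δ ν) • (φ ν : VSpace Ω γ s) := by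
      simp only [hPdef, Submodule.coe_sum, Submodule.coe_smul]
    rw [e1, e2, map_sum, map_sum, sum_apply]
    refine Finset.sum_congr rfl fun ν _ => ?_
    rw [map_smul, map_smul, smul_apply, toW_apply, smul_eq_mul, smul_eq_mul]
    ring
  have hPv : (P v : 𝒯.VT γ s) = v := by
    obtain ⟨e, he⟩ := (Submodule.mem_span_range_iff_exists_fun ℝ).1 (hspan (Submodule.mem_top (x := v)))
    rw [← he, hPdef]
    refine Finset.sum_congr rfl fun ν _ => ?_
    rw [toL2_sum_smul]
    simp only [hφ]
    rw [h.inner_sum_fst hz, mul_div_cancel_right₀ _ (h.inner_self_ne_zero hz ν)]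
  have hwn : ‖w‖ ≤ C := by
    rw [Submodule.coe_norm, ← (WSpace.toDual Ω γ s).norm_map]
    refine ContinuousLinearMap.opNorm_le_bound _ hC.le fun u => ?_
    rw [hwf]
    calc _ ≤ ‖f‖ * ‖(P u : VSpace Ω γ s)‖ := f.le_opNorm _
      _ ≤ 1 * (C * ‖u‖) := mul_le_mul hf1 (hPn u) (norm_nonneg _) zero_le_one
      _ = _ := one_mul _
  have hval : DT γ s (𝒯.VT γ s) (WT γ s ψ) v w = ‖v‖ := by
    rw [DT_apply, hwf, hPv, hfv]
    rfl
  calc ‖v‖ = ‖DT γ s (𝒯.VT γ s) (WT γ s ψ) v w‖ := by rw [hval, norm_norm]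
    _ ≤ ‖DT γ s (𝒯.VT γ s) (WT γ s ψ) v‖ * ‖w‖ := ContinuousLinearMap.le_opNorm _ _
    _ ≤ ‖DT γ s (𝒯.VT γ s) (WT γ s ψ) v‖ * C := by
        gcongr
    _ = _ := mul_comm _ _

end Preconditioner

end Mesh

end OpPrec

/-! ### The uniform preconditioner -/

theorem corollary4p2 {d : ℕ} (hd : 1 ≤ d)
    -- a bounded polytopal domain and a closed part of its boundary
    (Ω : Set (OpPrec.E d)) (hΩ_open : IsOpen Ω) (hΩ_conn : IsConnected Ω)
    (hΩ_bdd : Bornology.IsBounded Ω) (hΩ_reg : interior (closure Ω) = Ω)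
    (γ : Set (OpPrec.E d)) (hγ_closed : IsClosed γ) (hγ_bdry : γ ⊆ frontier Ω)
    (s : ℝ) (hs : s ∈ Set.Icc (0 : ℝ) 1)
    -- a uniformly shape regular family of conforming partitions
    {ι : Type*} (𝒯 : ι → OpPrec.Mesh Ω) (hγ : ∀ i, (𝒯 i).IsUnionOfFaces γ)
    (h_shape : OpPrec.UniformlyShapeRegular 𝒯) (h_kmesh : d = 1 → OpPrec.UniformKMesh 𝒯)
    -- the collections that span the spaces `𝒲_𝒯`
    (ψ : ∀ i, (𝒯 i).freeVertices γ → OpPrec.L2 Ω)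
    (hψ : OpPrec.UniformlyBiorthogonal γ 𝒯 ψ) :
    -- `D_𝒯` and its adjoint are invertible, and the matrix of `D_𝒯` is diagonal
    (∀ i,
      (OpPrec.DT γ s ((𝒯 i).VT γ s) (OpPrec.WT γ s (ψ i))).IsInvertible ∧
      (OpPrec.DT γ s ((𝒯 i).VT γ s) (OpPrec.WT γ s (ψ i))).flip.IsInvertible ∧
      ∃ (b : Module.Basis ((𝒯 i).freeVertices γ) ℝ ((𝒯 i).VT γ s))
        (c : Module.Basis ((𝒯 i).freeVertices γ) ℝ (OpPrec.WT γ s (ψ i))),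
        (∀ ν, OpPrec.VSpace.toL2 Ω γ s (b ν) =ᵐ[OpPrec.mu Ω] (𝒯 i).hat ν) ∧
        (∀ ν, c ν = OpPrec.WT.gen γ s (ψ i) ν) ∧
        (Matrix.of fun ν ν' =>
          OpPrec.DT γ s ((𝒯 i).VT γ s) (OpPrec.WT γ s (ψ i)) (b ν') (c ν)).IsDiag) ∧
    -- `G_𝒯` is a uniform coercive preconditioner
    ∀ B : ∀ i, OpPrec.WT γ s (ψ i) →L[ℝ] StrongDual ℝ (OpPrec.WT γ s (ψ i)),
      OpPrec.UniformLisc B →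
      OpPrec.UniformLiscDual (fun i =>
        OpPrec.precond (OpPrec.DT γ s ((𝒯 i).VT γ s) (OpPrec.WT γ s (ψ i))) (B i)) ∧
      ∀ A : ∀ i, (𝒯 i).VT γ s →L[ℝ] StrongDual ℝ ((𝒯 i).VT γ s),
        OpPrec.UniformLisc A →
        OpPrec.UniformLis (fun i =>
          (OpPrec.precond (OpPrec.DT γ s ((𝒯 i).VT γ s) (OpPrec.WT γ s (ψ i))) (B i)).comp
            (A i)) := by
  classical
  obtain ⟨σ, κ, N, hσ, hκ, hreg⟩ := OpPrec.exists_regular hd 𝒯 h_shape h_kmesh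
  obtain ⟨c, hc, hlow⟩ := hψ.lower_bound
  have hdual : ∀ i, (𝒯 i).IsDual γ c (ψ i) := fun i =>
    ⟨hψ.orthogonal i, hψ.diag_ne_zero i, hlow i, hψ.support i⟩
  choose z hz using fun i =>
    OpPrec.Mesh.exists_isHatFamily (𝒯 := 𝒯 i) hΩ_open hΩ_bdd hΩ_reg hγ_bdry (hγ i)
  choose φ hφ using fun i => (hz i).exists_mem_VT hs
  have hspan := fun i =>
    OpPrec.Mesh.span_hat hd hΩ_open hΩ_reg (hγ i) (hz i) (hφ i)
  let b : ∀ i, Module.Basis ((𝒯 i).freeVertices γ) ℝ ((𝒯 i).VT γ s) := fun i =>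
    Module.Basis.mk ((hdual i).linearIndependent_hat (hz i) (hφ i)) (hspan i)
  let w : ∀ i, Module.Basis ((𝒯 i).freeVertices γ) ℝ (OpPrec.WT γ s (ψ i)) := fun i =>
    Module.Basis.mk ((hdual i).linearIndependent_gen (hz i) (hφ i)) OpPrec.Mesh.span_gen
  have hfV : ∀ i, FiniteDimensional ℝ ((𝒯 i).VT γ s) := fun i => Module.Finite.of_basis (b i)
  have hfW : ∀ i, FiniteDimensional ℝ (OpPrec.WT γ s (ψ i)) := fun i =>
    Module.Finite.of_basis (w i)
  have hdim : ∀ i, Module.finrank ℝ ((𝒯 i).VT γ s) =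
      Module.finrank ℝ (OpPrec.WT γ s (ψ i)) := fun i => by
    rw [Module.finrank_eq_card_basis (b i), Module.finrank_eq_card_basis (w i)]
  -- The stability constant depends only on d, σ, κ, N and c, none of which varies with the mesh.
  have hC := OpPrec.Mesh.normConst_pos d hσ (zero_le_one.trans hκ) N c
  have hlb := fun i => OpPrec.Mesh.norm_le_mul_norm_DT hC (hdual i) (hz i) (hφ i) (hspan i)
    (OpPrec.Mesh.interpNorm_dualProj_le (hreg i) hd hσ hκ hΩ_open hΩ_bdd hΩ_reg (hγ i) hc
      (hdual i) (hz i) s)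
  have hD : ∀ i, (OpPrec.DT γ s ((𝒯 i).VT γ s) (OpPrec.WT γ s (ψ i))).IsInvertible := fun i =>
    OpPrec.isInvertible_of_norm_le _ (hdim i) (hlb i)
  have hD' : ∀ i, (OpPrec.DT γ s ((𝒯 i).VT γ s) (OpPrec.WT γ s (ψ i))).flip.IsInvertible := by
    refine fun i => OpPrec.flip_isInvertible_of_forall _ (hdim i) fun x hx => ?_
    obtain ⟨e, rfl⟩ := (Submodule.mem_span_range_iff_exists_fun ℝ).1
      (OpPrec.Mesh.span_gen (Submodule.mem_top (x := x)))
    -- An element of 𝒲_𝒯 that annihilates 𝒱_𝒯 has zero coefficients, by testing with each φ_ν.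
    refine Finset.sum_eq_zero fun ν _ => ?_
    have h1 := OpPrec.Mesh.DT_hat_sum_gen (hdual i) (hz i) (hφ i) e ν
    rw [hx] at h1
    rw [(mul_eq_zero.1 h1.symm).resolve_right ((hdual i).inner_self_ne_zero (hz i) ν), zero_smul]
  refine ⟨fun i => ⟨hD i, hD' i, b i, w i, fun ν => ?_, fun ν => ?_, ?_⟩, fun B hB => ?_⟩
  · rw [Module.Basis.mk_apply, hφ]
    exact (hz i).fst_eq ν
  · rw [Module.Basis.mk_apply]
  · intro ν ν' hne
    rw [Matrix.of_apply, Module.Basis.mk_apply, Module.Basis.mk_apply, OpPrec.DT_apply_gen, hφ,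
      (hdual i).inner_of_ne (hz i) hne.symm]
  · exact OpPrec.uniform_preconditioner_of_bounds _ hD hD'
      (fun i => OpPrec.Mesh.norm_DT_apply_le _ _) hC.le hlb B hB
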